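/- Let $\mathcal H$ be a separable complex Hilbert space with an orthogonal decomposition $\mathcal H=\mathcal H_+\oplus\mathcal H_-$ into infinite-dimensional closed subspaces, and let $P_+$ be the orthogonal projector onto $\mathcal H_+$. Write $L^2(E,F)$ for the space of Hilbert--Schmidt operators with the Hilbert--Schmidt norm, $U_+$ for the unitary group of $\mathcal H_+$ (a Banach Lie group, as a submanifold of the bounded operators on $\mathcal H_+$) and $\mathfrak u_+$ for the space of skew-adjoint bounded operators on $\mathcal H_+$. The restricted Grassmannian $\mathrm{Gr}_{\rm res}$ is the set of closed subspaces $W\subset\mathcal H$ for which the orthogonal projection $W\to\mathcal H_+$ is Fredholm and the orthogonal projection $W\to\mathcal H_-$ is Hilbert--Schmidt; $W$ is identified with its orthogonal projector $P_W$. Its manifold structure is given by the charts $$\phi_W(V)=P_{W^\perp}(P_W|_V)^{-1}\in L^2(W,W^\perp),\qquad W\in \mathrm{Gr}_{\rm res},$$ defined for those $V\in\mathrm{Gr}_{\rm res}$ for which $P_W|_V:V\to W$ is invertible. Let $$\mathfrak U_{\rm res}=\{u \text{ a partial isometry on }\mathcal H\;:\; u^*u,\,uu^*\in\mathrm{Gr}_{\rm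 res}\},$$ and let $U_{\rm res}$ be the Banach Lie group of unitary operators $g$ on $\mathcal H$ with $[g,P_+]\in L^2(\mathcal H)$, with the structure induced by the norm $\|X\|+\|[X,P_+]\|_2$. A local cross section $(\Omega_\beta,\sigma_\beta)$ based at $W_\beta\in \mathrm{Gr}_{\rm res}$ consists of an open set $\Omega_\beta\ni W_\beta$ contained in the domain of $\phi_{W_\beta}$ and of a smooth map $\sigma_\beta:\Omega_\beta\to U_{\rm res}$ with $\sigma_\beta(W)\mathcal H_+=W$ for all $W\in\Omega_\beta$. Then there is a local cross section based at every point of $\mathrm{Gr}_{\rm res}$, and there is a smooth chart $\psi:V\to\mathfrak u_+$ of $U_+$ around every point of $U_+$. Moreover, let $(\Omega_\beta,\sigma_\beta)_\beta$ be any family of local cross sections covering $\mathrm{Gr}_{\rm res}$, let $(V_\alpha,\psi_\alpha:V_\alpha\to\mathfrak u_+)_\alpha$ be any family of smooth charts covering $U_+$, and consider on $\mathfrak U_{\rm res}$ the charts $$\Phi_{\alpha\beta\gamma}(u)=\big(\phi_{W_\gamma}(uu^*),\ \phi_{W_\beta}(u^*u),\ \psi_\alpha(\sigma_\gamma(uu^*)^{-1}u\,\sigma_\beta(u^*u)|_{\mathcal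 H_+})\big)\in L^2(W_\gamma,W_\gamma^\perp)\times L^2(W_\beta,W_\beta^\perp)\times\mathfrak u_+ ,$$ $$\Omega_{\alpha\beta\gamma}=\{u\in\mathfrak U_{\rm res}: u^*u\in\Omega_\beta,\ uu^*\in\Omega_\gamma,\ \sigma_\gamma(uu^*)^{-1}u\,\sigma_\beta(u^*u)|_{\mathcal H_+}\in V_\alpha\}.$$ Then the following holds. (1) With the atlases $(\phi_W)$ and $(\Phi_{\alpha\beta\gamma})$, the maps $s(u)=u^*u$, $t(u)=uu^*$, $m(u_1,u_2)=u_1u_2$ (for $s(u_1)=t(u_2)$), $\epsilon(p)=p$ and $\iota(u)=u^*$ make $\mathfrak U_{\rm res}\rightrightarrows\mathrm{Gr}_{\rm res}$ a Banach Lie groupoid: both are Hausdorff smooth real Banach manifolds; $s$ and $t$ are surjective submersions (smooth, with surjective tangent maps whose kernels split); $m$ is smooth on the set of composable pairs and associative, in the sense that $(gh)k$ is defined if and only if $g(hk)$ is, and then they are equal; $\epsilon$ is a topological embedding with $g\,\epsilon(s(g))=g=\epsilon(t(g))\,g$; and $\iota$ is a diffeomorphism with $g\,\iota(g)=\epsilon(t(g))$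 and $\iota(g)\,g=\epsilon(s(g))$. (2) The image of $\Phi_{\alpha\beta\gamma}$ is $\phi_{W_\gamma}(\Omega_\gamma)\times\phi_{W_\beta}(\Omega_\beta)\times\psi_\alpha(V_\alpha)$, and in the charts $\Phi_{\alpha\beta\gamma}$, $\phi_{W_\gamma}$, $\phi_{W_\beta}$ the target and the source are the projections $(A,B,X)\mapsto A$ and $(A,B,X)\mapsto B$. (3) If $\Phi_{\alpha\beta\gamma}(u)=(A,B,X)$ and $\psi_\alpha^{-1}(X)^*\in V_{\alpha'}$, then $u^*\in\Omega_{\alpha'\gamma\beta}$ and $\Phi_{\alpha'\gamma\beta}(u^*)=(B,A,\psi_{\alpha'}(\psi_\alpha^{-1}(X)^*))$. (4) If $\Phi_{\alpha\beta\gamma}(u)=(A,B,X)$, $\Phi_{\alpha'\beta'\beta}(v)=(B,C,X')$ and $\psi_\alpha^{-1}(X)\psi_{\alpha'}^{-1}(X')\in V_{\alpha''}$, then $s(u)=t(v)$, $uv\in\Omega_{\alpha''\beta'\gamma}$ and $\Phi_{\alpha''\beta'\gamma}(uv)=(A,C,\psi_{\alpha''}(\psi_\alpha^{-1}(X)\psi_{\alpha'}^{-1}(X')))$.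 -/

import Mathlib

open scoped ContDiff InnerProductSpace ENNReal Topology

universe u

namespace RestrictedGroupoid

noncomputable section

/-! ### Hilbert–Schmidt operators -/

section HilbertSchmidt

variable {E F : Type u} [NormedAddCommGroup E] [InnerProductSpace ℂ E]
  [NormedAddCommGroup F] [InnerProductSpace ℂ F]

/-- The Hilbert–Schmidt norm `‖T‖₂`, with value `∞` if `T` is not Hilbert–Schmidt: the supremum of
`(∑ ‖T eᵢ‖²)^(1/2)` over all finite orthonormal families. It equals `(∑ ‖T bᵢ‖²)^(1/2)` for every
orthonormal basis `b`, see `hsENorm_eq_tsum`. -/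
def hsENorm (T : E →L[ℂ] F) : ℝ≥0∞ :=
  ⨆ (n : ℕ) (e : Fin n → E) (_ : Orthonormal ℂ e), (∑ i, ‖T (e i)‖ₑ ^ (2 : ℝ)) ^ (1 / (2 : ℝ))

/-- `T` is a Hilbert–Schmidt operator. -/
def IsHilbertSchmidt (T : E →L[ℂ] F) : Prop := hsENorm T ≠ ⊤

theorem le_hsENorm (T : E →L[ℂ] F) {n : ℕ} {e : Fin n → E} (he : Orthonormal ℂ e) :
    (∑ i, ‖T (e i)‖ₑ ^ (2 : ℝ)) ^ (1 / (2 : ℝ)) ≤ hsENorm T :=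
  le_iSup_of_le n (le_iSup_of_le e (le_iSup_of_le he le_rfl))

theorem hsENorm_le {T : E →L[ℂ] F} {C : ℝ≥0∞}
    (h : ∀ (n : ℕ) (e : Fin n → E), Orthonormal ℂ e →
      (∑ i, ‖T (e i)‖ₑ ^ (2 : ℝ)) ^ (1 / (2 : ℝ)) ≤ C) : hsENorm T ≤ C :=
  iSup_le fun n => iSup_le fun e => iSup_le fun he => h n e he

theorem hsENorm_zero : hsENorm (0 : E →L[ℂ] F) = 0 :=
  le_antisymm (hsENorm_le fun n e _ => by simp) bot_le

theorem hsENorm_add_le (S T : E →L[ℂ] F) : hsENorm (S + T) ≤ hsENorm S + hsENorm T := by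
  refine hsENorm_le fun n e he => ?_
  calc (∑ i, ‖(S + T) (e i)‖ₑ ^ (2 : ℝ)) ^ (1 / (2 : ℝ))
      ≤ (∑ i, (‖S (e i)‖ₑ + ‖T (e i)‖ₑ) ^ (2 : ℝ)) ^ (1 / (2 : ℝ)) := by
        gcongr with i
        exact enorm_add_le _ _
    _ ≤ (∑ i, ‖S (e i)‖ₑ ^ (2 : ℝ)) ^ (1 / (2 : ℝ)) + (∑ i, ‖T (e i)‖ₑ ^ (2 : ℝ)) ^ (1 / (2 : ℝ)) :=
        ENNReal.Lp_add_le _ _ _ (by norm_num)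
    _ ≤ hsENorm S + hsENorm T := add_le_add (le_hsENorm S he) (le_hsENorm T he)

theorem hsENorm_smul_le (c : ℂ) (T : E →L[ℂ] F) : hsENorm (c • T) ≤ ‖c‖ₑ * hsENorm T := by
  refine hsENorm_le fun n e he => ?_
  have h : (∑ i, ‖(c • T) (e i)‖ₑ ^ (2 : ℝ)) ^ (1 / (2 : ℝ))
      = ‖c‖ₑ * (∑ i, ‖T (e i)‖ₑ ^ (2 : ℝ)) ^ (1 / (2 : ℝ)) := by
    simp only [smul_apply, enorm_smul]
    simp_rw [ENNReal.mul_rpow_of_nonneg _ _ (by norm_num : (0 : ℝ) ≤ 2)]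
    rw [← Finset.mul_sum, ENNReal.mul_rpow_of_nonneg _ _ (by norm_num : (0 : ℝ) ≤ 1 / 2),
      ← ENNReal.rpow_mul]
    norm_num
  rw [h]
  gcongr
  exact le_hsENorm T he

theorem hsENorm_neg_le (T : E →L[ℂ] F) : hsENorm (-T) ≤ hsENorm T := by
  simpa using hsENorm_smul_le (-1) T

theorem enorm_apply_le (T : E →L[ℂ] F) {x : E} (hx : ‖x‖ = 1) : ‖T x‖ₑ ≤ hsENorm T := by
  have he : Orthonormal ℂ (fun _ : Fin 1 => x) :=
    ⟨fun _ => hx, fun i j hij => absurd (Subsingleton.elim i j) hij⟩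
  have h := le_hsENorm T he
  simp only [Finset.univ_unique, Finset.sum_singleton] at h
  rwa [← ENNReal.rpow_mul, mul_one_div_cancel two_ne_zero, ENNReal.rpow_one] at h

theorem norm_apply_le {T : E →L[ℂ] F} (hT : IsHilbertSchmidt T) (x : E) :
    ‖T x‖ ≤ (hsENorm T).toReal * ‖x‖ := by
  by_cases hx : x = 0
  · simp [hx]
  have hx' : ‖x‖ ≠ 0 := norm_ne_zero_iff.2 hx
  have h1 : ‖((‖x‖⁻¹ : ℝ) : ℂ) • x‖ = 1 := by simp [norm_smul, hx']
  have h2 := ENNReal.toReal_mono hT (enorm_apply_le T h1)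
  rw [toReal_enorm, map_smul, norm_smul] at h2
  simp only [Complex.norm_real, norm_inv, norm_norm] at h2
  rwa [inv_mul_le_iff₀ (by positivity), mul_comm] at h2

/-- The usual description of the Hilbert–Schmidt norm through an orthonormal basis. -/
theorem hsENorm_eq_tsum [CompleteSpace E] [CompleteSpace F] {ι : Type*} (b : HilbertBasis ι ℂ E)
    (T : E →L[ℂ] F) : hsENorm T = (∑' i, ‖T (b i)‖ₑ ^ (2 : ℝ)) ^ (1 / (2 : ℝ)) := by
  have hsq : ∀ {G : Type u} [NormedAddCommGroup G] (x : G),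
      ‖x‖ₑ ^ (2 : ℝ) = ENNReal.ofReal (‖x‖ ^ 2) := fun x => by
    rw [← ofReal_norm, ENNReal.rpow_ofNat, ENNReal.ofReal_pow (norm_nonneg x)]
  have hsqC : ∀ x : ℂ, ‖x‖ₑ ^ (2 : ℝ) = ENNReal.ofReal (‖x‖ ^ 2) := fun x => by
    rw [← ofReal_norm, ENNReal.rpow_ofNat, ENNReal.ofReal_pow (norm_nonneg x)]
  apply le_antisymm
  · refine hsENorm_le fun n e he => ?_
    gcongr
    let K : Submodule ℂ F := Submodule.span ℂ (Set.range fun k => T (e k))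
    have : FiniteDimensional ℂ K := FiniteDimensional.span_of_finite ℂ (Set.finite_range _)
    let f := stdOrthonormalBasis ℂ K
    let g : Fin (Module.finrank ℂ K) → E := fun j => T.adjoint (f j : F)
    have hf : Orthonormal ℂ fun j => (f j : F) :=
      f.orthonormal.comp_linearIsometry K.subtypeₗᵢ
    have h1 : ∀ k, ‖T (e k)‖ₑ ^ (2 : ℝ) = ∑ j, ‖⟪e k, g j⟫_ℂ‖ₑ ^ (2 : ℝ) := fun k => by
      have hk : T (e k) ∈ K := Submodule.subset_span ⟨k, rfl⟩
      have := f.sum_sq_norm_inner_left ⟨T (e k), hk⟩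
      simp_rw [hsqC, hsq]
      rw [← ENNReal.ofReal_sum_of_nonneg fun _ _ => by positivity]
      congr 1
      refine this.symm.trans ?_
      refine Finset.sum_congr rfl fun j _ => ?_
      rw [ContinuousLinearMap.adjoint_inner_right]
      rfl
    have h2 : ∀ j, ∑ k, ‖⟪e k, g j⟫_ℂ‖ₑ ^ (2 : ℝ) ≤ ‖g j‖ₑ ^ (2 : ℝ) := fun j => by
      simp_rw [hsqC, hsq]
      rw [← ENNReal.ofReal_sum_of_nonneg fun _ _ => by positivity]
      exact ENNReal.ofReal_le_ofReal (he.sum_inner_products_le (g j))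
    have h3 : ∀ j, ‖g j‖ₑ ^ (2 : ℝ) = ∑' i, ‖⟪b i, g j⟫_ℂ‖ₑ ^ (2 : ℝ) := fun j => by
      have hs := b.hasSum_inner_mul_inner (g j) (g j)
      have hs' : HasSum (fun i => ‖⟪b i, g j⟫_ℂ‖ ^ 2) (‖g j‖ ^ 2) := by
        have := Complex.hasSum_re hs
        convert! this using 1
        · ext i
          have h := inner_mul_symm_re_eq_norm (𝕜 := ℂ) (g j) (b i)
          rw [norm_mul, norm_inner_symm, ← sq] at h
          exact h.symm
        · exact (inner_self_eq_norm_sq (𝕜 := ℂ) (g j)).symm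
      simp_rw [hsqC, hsq]
      rw [← ENNReal.ofReal_tsum_of_nonneg (fun _ => by positivity) hs'.summable, hs'.tsum_eq]
    have h4 : ∀ i, ∑ j, ‖⟪b i, g j⟫_ℂ‖ₑ ^ (2 : ℝ) ≤ ‖T (b i)‖ₑ ^ (2 : ℝ) := fun i => by
      simp_rw [hsqC, hsq]
      rw [← ENNReal.ofReal_sum_of_nonneg fun _ _ => by positivity]
      refine ENNReal.ofReal_le_ofReal ?_
      have := hf.sum_inner_products_le (s := Finset.univ) (T (b i))
      refine le_trans (le_of_eq (Finset.sum_congr rfl fun j _ => ?_)) this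
      rw [ContinuousLinearMap.adjoint_inner_right, norm_inner_symm]
    calc ∑ k, ‖T (e k)‖ₑ ^ (2 : ℝ) = ∑ j, ∑ k, ‖⟪e k, g j⟫_ℂ‖ₑ ^ (2 : ℝ) := by
          rw [Finset.sum_comm]
          exact Finset.sum_congr rfl fun k _ => h1 k
      _ ≤ ∑ j, ∑' i, ‖⟪b i, g j⟫_ℂ‖ₑ ^ (2 : ℝ) :=
          Finset.sum_le_sum fun j _ => (h2 j).trans (h3 j).le
      _ = ∑' i, ∑ j, ‖⟪b i, g j⟫_ℂ‖ₑ ^ (2 : ℝ) :=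
          (Summable.tsum_finsetSum fun _ _ => ENNReal.summable).symm
      _ ≤ ∑' i, ‖T (b i)‖ₑ ^ (2 : ℝ) := ENNReal.tsum_le_tsum h4
  · rw [one_div, ENNReal.rpow_inv_le_iff (by norm_num)]
    refine ENNReal.summable.tsum_le_of_sum_le fun s => ?_
    have he : Orthonormal ℂ fun k : Fin s.card => b (s.equivFin.symm k) :=
      b.orthonormal.comp _ (Subtype.val_injective.comp s.equivFin.symm.injective)
    have h := le_hsENorm T he
    rw [one_div, ENNReal.rpow_inv_le_iff (by norm_num)] at h
    refine le_trans (le_of_eq ?_) h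
    rw [← Finset.sum_coe_sort s]
    exact (s.equivFin.symm.sum_comp fun i : s => ‖T (b i)‖ₑ ^ (2 : ℝ)).symm

variable (E F) in
/-- The Hilbert–Schmidt operators as a subspace of the bounded operators. -/
def hilbertSchmidt : Submodule ℂ (E →L[ℂ] F) where
  carrier := {T | IsHilbertSchmidt T}
  zero_mem' := by simp [IsHilbertSchmidt, hsENorm_zero]
  add_mem' {S T} hS hT :=
    ne_top_of_le_ne_top (ENNReal.add_ne_top.2 ⟨hS, hT⟩) (hsENorm_add_le S T)
  smul_mem' c T hT :=
    ne_top_of_le_ne_top (ENNReal.mul_ne_top enorm_ne_top hT) (hsENorm_smul_le c T)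

variable (E F) in
/-- The space `L²(E, F)` of Hilbert–Schmidt operators; a separate type, since it carries the
Hilbert–Schmidt norm and not the operator norm. -/
def HS : Type u := ↥(hilbertSchmidt E F)

namespace HS

instance : AddCommGroup (HS E F) := inferInstanceAs (AddCommGroup ↥(hilbertSchmidt E F))

instance : Module ℂ (HS E F) := inferInstanceAs (Module ℂ ↥(hilbertSchmidt E F))

/-- The bounded operator underlying a Hilbert–Schmidt operator. -/
def toCLM : HS E F →ₗ[ℂ] (E →L[ℂ] F) := (hilbertSchmidt E F).subtype

theorem isHilbertSchmidt (T : HS E F) : IsHilbertSchmidt (toCLM T) := T.2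

theorem toCLM_injective : Function.Injective (toCLM (E := E) (F := F)) := Subtype.val_injective

theorem exists_toCLM_eq {T : E →L[ℂ] F} (hT : IsHilbertSchmidt T) : ∃ S : HS E F, toCLM S = T :=
  ⟨(⟨T, hT⟩ : ↥(hilbertSchmidt E F)), rfl⟩

open Classical in
/-- A bounded operator as an element of `L²(E, F)`; it is only used for Hilbert–Schmidt
operators (junk value `0` otherwise). -/
def ofCLM (T : E →L[ℂ] F) : HS E F := 
  if h : T ∈ hilbertSchmidt E F then (⟨T, h⟩ : ↥(hilbertSchmidt E F)) else (0 : HS E F)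

instance : Norm (HS E F) := ⟨fun T => (hsENorm (toCLM T)).toReal⟩

theorem norm_def (T : HS E F) : ‖T‖ = (hsENorm (toCLM T)).toReal := rfl

theorem norm_apply_le (T : HS E F) (x : E) : ‖toCLM T x‖ ≤ ‖T‖ * ‖x‖ :=
  RestrictedGroupoid.norm_apply_le T.isHilbertSchmidt x

instance : NormedAddCommGroup (HS E F) :=
  AddGroupNorm.toNormedAddCommGroup
    { toFun := fun T => ‖T‖
      map_zero' := by simp [norm_def, hsENorm_zero]
      add_le' := fun S T => by
        rw [norm_def, norm_def, norm_def, map_add,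
          ← ENNReal.toReal_add S.isHilbertSchmidt T.isHilbertSchmidt]
        exact ENNReal.toReal_mono
          (ENNReal.add_ne_top.2 ⟨S.isHilbertSchmidt, T.isHilbertSchmidt⟩) (hsENorm_add_le _ _)
      neg' := fun T => by
        have h : hsENorm (-toCLM T) = hsENorm (toCLM T) :=
          le_antisymm (hsENorm_neg_le _) (by simpa using hsENorm_neg_le (-toCLM T))
        rw [norm_def, norm_def, map_neg, h]
      eq_zero_of_map_eq_zero' := fun T hT => by
        apply toCLM_injective
        ext x
        have h := norm_apply_le T x
        rw [show ‖T‖ = 0 from hT, zero_mul] at h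
        simpa using h }

instance : NormedSpace ℂ (HS E F) where
  norm_smul_le c T := by
    change (hsENorm (toCLM (c • T))).toReal ≤ ‖c‖ * (hsENorm (toCLM T)).toReal
    rw [map_smul, ← toReal_enorm c, ← ENNReal.toReal_mul]
    exact ENNReal.toReal_mono (ENNReal.mul_ne_top enorm_ne_top T.isHilbertSchmidt)
      (hsENorm_smul_le _ _)

instance [CompleteSpace F] : CompleteSpace (HS E F) := by
  refine Metric.complete_of_cauchySeq_tendsto fun S hS => ?_
  have hop : ∀ A B : HS E F, dist (toCLM A) (toCLM B) ≤ dist A B := fun A B => by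
    rw [dist_eq_norm, dist_eq_norm, ← map_sub]
    exact ContinuousLinearMap.opNorm_le_bound _ (norm_nonneg _) (norm_apply_le _)
  have hS' : CauchySeq fun k => toCLM (S k) := by
    rw [Metric.cauchySeq_iff'] at hS ⊢
    intro ε hε
    obtain ⟨N, hN⟩ := hS ε hε
    exact ⟨N, fun n hn => (hop _ _).trans_lt (hN n hn)⟩
  obtain ⟨T, hT⟩ := cauchySeq_tendsto_of_complete hS'
  have key : ∀ ε : ℝ, 0 < ε → ∃ N, ∀ k ≥ N,
      hsENorm (toCLM (S k) - T) ≤ ENNReal.ofReal ε := by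
    intro ε hε
    obtain ⟨N, hN⟩ := Metric.cauchySeq_iff.1 hS ε hε
    refine ⟨N, fun k hk => hsENorm_le fun n e he => ?_⟩
    have hlim : Filter.Tendsto
        (fun l => (∑ i, ‖(toCLM (S k) - toCLM (S l)) (e i)‖ₑ ^ (2 : ℝ)) ^ (1 / (2 : ℝ)))
        Filter.atTop (𝓝 ((∑ i, ‖(toCLM (S k) - T) (e i)‖ₑ ^ (2 : ℝ)) ^ (1 / (2 : ℝ)))) := by
      have hc : Continuous fun A : E →L[ℂ] F =>
          (∑ i, ‖(toCLM (S k) - A) (e i)‖ₑ ^ (2 : ℝ)) ^ (1 / (2 : ℝ)) := by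
        refine ENNReal.continuous_rpow_const.comp (continuous_finsetSum _ fun i _ => ?_)
        refine ENNReal.continuous_rpow_const.comp (continuous_enorm.comp ?_)
        fun_prop
      exact (hc.tendsto T).comp hT
    refine le_of_tendsto hlim (Filter.eventually_atTop.2 ⟨N, fun l hl => ?_⟩)
    refine (le_hsENorm _ he).trans ?_
    rw [← map_sub, ← ENNReal.ofReal_toReal (S k - S l).isHilbertSchmidt]
    refine ENNReal.ofReal_le_ofReal ?_
    rw [← norm_def, ← dist_eq_norm]
    exact (hN k hk l hl).le
  have hTHS : IsHilbertSchmidt T := by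
    obtain ⟨N, hN⟩ := key 1 one_pos
    have h1 : toCLM (S N) - T ∈ hilbertSchmidt E F :=
      ne_top_of_le_ne_top ENNReal.ofReal_ne_top (hN N le_rfl)
    have h2 := (hilbertSchmidt E F).sub_mem (S N).isHilbertSchmidt h1
    rwa [sub_sub_cancel] at h2
  obtain ⟨T', rfl⟩ := exists_toCLM_eq hTHS
  refine ⟨T', Metric.tendsto_atTop.2 fun ε hε => ?_⟩
  obtain ⟨N, hN⟩ := key (ε / 2) (half_pos hε)
  refine ⟨N, fun k hk => ?_⟩
  rw [dist_eq_norm, norm_def, map_sub]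
  refine lt_of_le_of_lt (ENNReal.toReal_mono ENNReal.ofReal_ne_top (hN k hk)) ?_
  rw [ENNReal.toReal_ofReal (half_pos hε).le]
  exact half_lt_self hε

end HS

end HilbertSchmidt

/-! ### Banach manifolds

The charts below take values in Banach spaces that vary with the chart, so a Banach manifold is
given by a set together with a smooth atlas whose charts each have their own model space. -/

/-- A chart of a set `M`, defined on `source`, with values in a real Banach space `E`. The values of
`toFun` outside `source` are irrelevant. -/
structure BanachChart (M : Type u) where
  E : Type u
  [normedAddCommGroup : NormedAddCommGroup E]
  [normedSpace : NormedSpace ℝ E]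
  [completeSpace : CompleteSpace E]
  source : Set M
  toFun : M → E

attribute [instance] BanachChart.normedAddCommGroup BanachChart.normedSpace
  BanachChart.completeSpace

section Manifold

variable {M N P : Type u}

open Classical in
/-- `f ∘ c⁻¹`, for a function `f` on `M` and a chart `c` (value `0` outside the image of `c`). -/
def BanachChart.pull (c : BanachChart M) {F : Type*} [Zero F] (f : M → F) : c.E → F := fun y =>
  if h : ∃ x ∈ c.source, c.toFun x = y then f h.choose else 0

/-- The topology defined by a set of charts, generated by the preimages of open sets. -/
@[reducible]
def atlasTopology (𝒜 : Set (BanachChart M)) : TopologicalSpace M :=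
  TopologicalSpace.generateFrom
    {U | ∃ c ∈ 𝒜, ∃ O : Set c.E, IsOpen O ∧ U = c.source ∩ c.toFun ⁻¹' O}

/-- `𝒜` is a smooth atlas which makes `M` into a (Hausdorff) Banach manifold. -/
structure IsBanachManifold (𝒜 : Set (BanachChart M)) : Prop where
  injOn : ∀ c ∈ 𝒜, Set.InjOn c.toFun c.source
  cover : ∀ x : M, ∃ c ∈ 𝒜, x ∈ c.source
  isOpen_image : ∀ c ∈ 𝒜, ∀ d ∈ 𝒜, IsOpen (c.toFun '' (c.source ∩ d.source))
  contDiffOn : ∀ c ∈ 𝒜, ∀ d ∈ 𝒜,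
    ContDiffOn ℝ ∞ (c.pull d.toFun) (c.toFun '' (c.source ∩ d.source))
  t2 : @T2Space M (atlasTopology 𝒜)

/-- The map `f` between Banach manifolds is smooth: all local representatives `d ∘ f ∘ c⁻¹` have
open domain (that is, `f` is continuous) and are smooth. -/
def IsSmoothMap (𝒜 : Set (BanachChart M)) (ℬ : Set (BanachChart N)) (f : M → N) : Prop :=
  ∀ c ∈ 𝒜, ∀ d ∈ ℬ,
    IsOpen (c.toFun '' (c.source ∩ f ⁻¹' d.source)) ∧
    ContDiffOn ℝ ∞ (c.pull fun x => d.toFun (f x)) (c.toFun '' (c.source ∩ f ⁻¹' d.source))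

/-- The map `f` between Banach manifolds is a submersion: it is smooth and each tangent map is
surjective with split kernel. -/
def IsSubmersionMap (𝒜 : Set (BanachChart M)) (ℬ : Set (BanachChart N)) (f : M → N) : Prop :=
  IsSmoothMap 𝒜 ℬ f ∧
  ∀ c ∈ 𝒜, ∀ d ∈ ℬ, ∀ x ∈ c.source, f x ∈ d.source →
    Function.Surjective (fderiv ℝ (c.pull fun x => d.toFun (f x)) (c.toFun x)) ∧
    (fderiv ℝ (c.pull fun x => d.toFun (f x)) (c.toFun x)).ker.ClosedComplemented

/-- The map `f` between Banach manifolds is a diffeomorphism. -/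
def IsDiffeo (𝒜 : Set (BanachChart M)) (ℬ : Set (BanachChart N)) (f : M → N) : Prop :=
  IsSmoothMap 𝒜 ℬ f ∧
  ∃ g : N → M, IsSmoothMap ℬ 𝒜 g ∧ Function.LeftInverse g f ∧ Function.RightInverse g f

/-- Smoothness of a map `f` defined on a subset `S` of a product of two Banach manifolds: near each
point of `S`, in charts, `f` is the restriction to `S` of a smooth map defined on an open set of the
product. If `S` is a (split) submanifold, this is smoothness for the submanifold structure. -/
def IsSmoothOnSubset (𝒜 : Set (BanachChart M)) (ℬ : Set (BanachChart N)) (𝒞 : Set (BanachChart P))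
    {S : M × N → Prop} (f : {z : M × N // S z} → P) : Prop :=
  ∀ c ∈ 𝒜, ∀ d ∈ ℬ, ∀ e ∈ 𝒞, ∀ z : {z : M × N // S z},
    z.1.1 ∈ c.source → z.1.2 ∈ d.source → f z ∈ e.source →
    ∃ (O : Set (c.E × d.E)) (F : c.E × d.E → e.E),
      IsOpen O ∧ (c.toFun z.1.1, d.toFun z.1.2) ∈ O ∧ ContDiffOn ℝ ∞ F O ∧
      ∀ w : {z : M × N // S z}, w.1.1 ∈ c.source → w.1.2 ∈ d.source →
        (c.toFun w.1.1, d.toFun w.1.2) ∈ O →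
        f w ∈ e.source ∧ e.toFun (f w) = F (c.toFun w.1.1, d.toFun w.1.2)

end Manifold

/-! ### Banach Lie groupoids -/

/-- `G ⇉ M`, with source `s`, target `t`, multiplication `m` of the composable pairs `(g, h)`,
`s g = t h`, identity section `ε` and inversion `i`, is a Banach Lie groupoid for the manifold
structures given by the atlases `𝒢` and `ℳ`. -/
structure IsBanachLieGroupoid {G M : Type u} (𝒢 : Set (BanachChart G)) (ℳ : Set (BanachChart M))
    (s t : G → M) (m : {z : G × G // s z.1 = t z.2} → G) (ε : M → G) (i : G → G) : Prop where
  manifold_total : IsBanachManifold 𝒢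
  manifold_base : IsBanachManifold ℳ
  source_surjective : Function.Surjective s
  source_submersion : IsSubmersionMap 𝒢 ℳ s
  target_surjective : Function.Surjective t
  target_submersion : IsSubmersionMap 𝒢 ℳ t
  mul_smooth : IsSmoothOnSubset 𝒢 𝒢 𝒢 m
  mul_defined_iff : ∀ g h k : G,
    (∃ gh : s g = t h, s (m ⟨(g, h), gh⟩) = t k) ↔ (∃ hk : s h = t k, s g = t (m ⟨(h, k), hk⟩))
  mul_assoc : ∀ (g h k : G) (gh : s g = t h) (ghk : s (m ⟨(g, h), gh⟩) = t k)
    (hk : s h = t k) (ghk' : s g = t (m ⟨(h, k), hk⟩)),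
    m ⟨(m ⟨(g, h), gh⟩, k), ghk⟩ = m ⟨(g, m ⟨(h, k), hk⟩), ghk'⟩
  unit_embedding : @Topology.IsEmbedding M G (atlasTopology ℳ) (atlasTopology 𝒢) ε
  mul_unit : ∀ (g : G) (x : M), s g = x → ∃ hgx : s g = t (ε x), m ⟨(g, ε x), hgx⟩ = g
  unit_mul : ∀ (g : G) (x : M), t g = x → ∃ hxg : s (ε x) = t g, m ⟨(ε x, g), hxg⟩ = g
  inv_diffeo : IsDiffeo 𝒢 𝒢 i
  mul_inv : ∀ g : G, ∃ h : s g = t (i g), m ⟨(g, i g), h⟩ = ε (t g)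
  inv_mul : ∀ g : G, ∃ h : s (i g) = t g, m ⟨(i g, g), h⟩ = ε (s g)

/-! ### The unitary group of a Hilbert space -/

section Unitary

variable (K : Type u) [NormedAddCommGroup K] [InnerProductSpace ℂ K] [CompleteSpace K]

/-- The Banach Lie algebra of skew-adjoint bounded operators on `K`, with the operator norm. -/
def SkewOp : Type u := ↥(skewAdjoint.submodule ℝ (K →L[ℂ] K))

instance : NormedAddCommGroup (SkewOp K) :=
  inferInstanceAs (NormedAddCommGroup ↥(skewAdjoint.submodule ℝ (K →L[ℂ] K)))

instance : NormedSpace ℝ (SkewOp K) :=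
  inferInstanceAs (NormedSpace ℝ ↥(skewAdjoint.submodule ℝ (K →L[ℂ] K)))

instance : CompleteSpace (SkewOp K) := by
  refine completeSpace_coe_iff_isComplete.2 (IsClosed.isComplete ?_)
  exact isClosed_eq continuous_star continuous_neg

/-- A smooth chart of the unitary group of `K`, with values in the space of skew-adjoint operators.
The unitary group has its usual structure of Banach Lie group, that is, it is a submanifold of the
space of bounded operators: a chart is a bijection from a (relatively) open set of unitary operators
onto an open set of skew-adjoint operators which is smooth (locally the restriction of a smooth map
on an open set of bounded operators) with smooth inverse. -/
structure UnitaryChart where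
  source : Set (K →L[ℂ] K)
  toFun : (K →L[ℂ] K) → SkewOp K
  isOpen_source : ∃ O : Set (K →L[ℂ] K), IsOpen O ∧ source = O ∩ unitary (K →L[ℂ] K)
  injOn : Set.InjOn toFun source
  isOpen_image : IsOpen (toFun '' source)
  smooth : ∀ k ∈ source, ∃ F : (K →L[ℂ] K) → SkewOp K,
    ContDiffAt ℝ ∞ F k ∧ ∀ᶠ l in 𝓝[source] k, F l = toFun l
  smooth_symm : ContDiffOn ℝ ∞ (Function.invFunOn toFun source) (toFun '' source)

variable {K} in
/-- The inverse of a chart of the unitary group. -/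
def UnitaryChart.symm (a : UnitaryChart K) : SkewOp K → (K →L[ℂ] K) :=
  Function.invFunOn a.toFun a.source

end Unitary

/-! ### The restricted Grassmannian

`H` is a Hilbert space and `Hp` (for `H₊`) is a closed (that is, complete) subspace; `H₋` is the
orthogonal complement `Hpᗮ`. -/

section Restricted

variable {H : Type u} [NormedAddCommGroup H] [InnerProductSpace ℂ H] [CompleteSpace H]

/-- The closed subspaces `W` of `H` such that the orthogonal projection `W → H₊` is Fredholm and the
orthogonal projection `W → H₋` is Hilbert–Schmidt. -/
def restrictedSubspaces (Hp : Submodule ℂ H) [CompleteSpace Hp] : Set (Submodule ℂ H) :=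
  {W | IsClosed (W : Set H) ∧
    ContinuousLinearMap.IsFredholm (Hp.orthogonalProjectionOnto ∘L W.subtypeL) ∧
    IsHilbertSchmidt (Hpᗮ.orthogonalProjectionOnto ∘L W.subtypeL)}

/-- The restricted Grassmannian; a subspace `W` is identified with its orthogonal projector. -/
@[ext]
structure GrRes (Hp : Submodule ℂ H) [CompleteSpace Hp] where
  proj : H →L[ℂ] H
  isStarProjection : IsStarProjection proj
  range_mem : proj.range ∈ restrictedSubspaces Hp

variable {Hp : Submodule ℂ H} [CompleteSpace Hp]

/-- The subspace `W` onto which the projector projects. -/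
def GrRes.space (W : GrRes Hp) : Submodule ℂ H := W.proj.range

instance (W : GrRes Hp) : CompleteSpace W.space :=
  completeSpace_coe_iff_isComplete.2 (IsClosed.isComplete W.range_mem.1)

/-- The restriction `P_W|_V : V → W` of the orthogonal projection onto `W`. -/
def GrRes.projRestrict (W V : GrRes Hp) : V.space →L[ℂ] W.space :=
  W.space.orthogonalProjectionOnto ∘L V.space.subtypeL

/-- `φ_W(V) = P_{W^⊥} (P_W|_V)⁻¹`, the operator `W → W^⊥` with graph `V`. -/
def GrRes.coord (W V : GrRes Hp) : HS W.space W.spaceᗮ :=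
  HS.ofCLM (W.spaceᗮ.orthogonalProjectionOnto ∘L V.space.subtypeL ∘L (W.projRestrict V).inverse)

/-- The chart `φ_W` of the restricted Grassmannian, with values in `L²(W, W^⊥)`. -/
def GrRes.chart (W : GrRes Hp) : BanachChart (GrRes Hp) where
  E := HS W.space W.spaceᗮ
  source := {V | (W.projRestrict V).IsInvertible}
  toFun := W.coord

variable (Hp) in
/-- The atlas of the restricted Grassmannian. -/
def grAtlas : Set (BanachChart (GrRes Hp)) := Set.range GrRes.chart

/-! ### Partial isometries over the restricted Grassmannian -/

variable (Hp) in
/-- The set of partial isometries `u` with initial and final projectors `u*u`, `uu*` in the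
restricted Grassmannian. -/
@[ext]
structure URes where
  op : H →L[ℂ] H
  isStarProjection_source : IsStarProjection (star op * op)
  isStarProjection_target : IsStarProjection (op * star op)
  source_mem : (star op * op).range ∈ restrictedSubspaces Hp
  target_mem : (op * star op).range ∈ restrictedSubspaces Hp

namespace URes

/-- The source `u*u`. -/
def src (u : URes Hp) : GrRes Hp := ⟨star u.op * u.op, u.isStarProjection_source, u.source_mem⟩

/-- The target `uu*`. -/
def tgt (u : URes Hp) : GrRes Hp := ⟨u.op * star u.op, u.isStarProjection_target, u.target_mem⟩

theorem star_mul_mul (z : {z : URes Hp × URes Hp // src z.1 = tgt z.2}) :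
    star (z.1.1.op * z.1.2.op) * (z.1.1.op * z.1.2.op) = star z.1.2.op * z.1.2.op := by
  have h : star z.1.1.op * z.1.1.op = z.1.2.op * star z.1.2.op := congrArg GrRes.proj z.2
  rw [star_mul, mul_assoc, ← mul_assoc (star z.1.1.op), h, mul_assoc, ← mul_assoc]
  exact z.1.2.isStarProjection_source.isIdempotentElem

theorem mul_mul_star (z : {z : URes Hp × URes Hp // src z.1 = tgt z.2}) :
    (z.1.1.op * z.1.2.op) * star (z.1.1.op * z.1.2.op) = z.1.1.op * star z.1.1.op := by
  have h : star z.1.1.op * z.1.1.op = z.1.2.op * star z.1.2.op := congrArg GrRes.proj z.2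
  rw [star_mul, mul_assoc, ← mul_assoc z.1.2.op, ← h, mul_assoc, ← mul_assoc]
  exact z.1.1.isStarProjection_target.isIdempotentElem

/-- The multiplication `(u₁, u₂) ↦ u₁u₂`, defined for `u₁*u₁ = u₂u₂*`. -/
def mul (z : {z : URes Hp × URes Hp // src z.1 = tgt z.2}) : URes Hp where
  op := z.1.1.op * z.1.2.op
  isStarProjection_source := by
    rw [star_mul_mul]
    exact z.1.2.isStarProjection_source
  isStarProjection_target := by
    rw [mul_mul_star]
    exact z.1.1.isStarProjection_target
  source_mem := by
    rw [star_mul_mul]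
    exact z.1.2.source_mem
  target_mem := by
    rw [mul_mul_star]
    exact z.1.1.target_mem

/-- The identity section `p ↦ p`. -/
def unit (p : GrRes Hp) : URes Hp :=
  have h₁ : star p.proj * p.proj = p.proj := by
    rw [p.isStarProjection.isSelfAdjoint.star_eq]
    exact p.isStarProjection.isIdempotentElem
  have h₂ : p.proj * star p.proj = p.proj := by
    rw [p.isStarProjection.isSelfAdjoint.star_eq]
    exact p.isStarProjection.isIdempotentElem
  { op := p.proj
    isStarProjection_source := h₁.symm ▸ p.isStarProjection
    isStarProjection_target := h₂.symm ▸ p.isStarProjection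
    source_mem := h₁.symm ▸ p.range_mem
    target_mem := h₂.symm ▸ p.range_mem }

/-- The inversion `u ↦ u*`. -/
def inv (u : URes Hp) : URes Hp where
  op := star u.op
  isStarProjection_source := by
    rw [star_star]
    exact u.isStarProjection_target
  isStarProjection_target := by
    rw [star_star]
    exact u.isStarProjection_source
  source_mem := by
    rw [star_star]
    exact u.target_mem
  target_mem := by
    rw [star_star]
    exact u.source_mem

end URes

/-! ### Local cross sections -/

variable (Hp) in
/-- The commutator `[X, P₊]`. -/
def commPlus (X : H →L[ℂ] H) : H →L[ℂ] H := X * Hp.starProjection - Hp.starProjection * X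

variable (Hp) in
/-- The restricted unitary group: unitary operators `u` on `H` with `[u, P₊]` Hilbert–Schmidt. -/
def unitaryRes : Set (H →L[ℂ] H) :=
  {X | X ∈ unitary (H →L[ℂ] H) ∧ IsHilbertSchmidt (commPlus Hp X)}

variable (Hp) in
/-- A smooth local cross section `σ : Ω → U_res` of the map `g ↦ g H₊`, on an open neighbourhood `Ω`
of a point `W` of the restricted Grassmannian that is contained in the domain of the chart `φ_W`.

The Banach Lie group `U_res` is a submanifold of the Banach algebra of all `X` with `[X, P₊]`
Hilbert–Schmidt, normed by `‖X‖ + ‖[X, P₊]‖₂`; a map `σ` to it is smooth if and only if `σ` is smooth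
for the operator norm and `[σ, P₊]` is smooth for the Hilbert–Schmidt norm. -/
structure LocalSection where
  base : GrRes Hp
  domain : Set (GrRes Hp)
  base_mem : base ∈ domain
  isOpen_domain : IsOpen[atlasTopology (grAtlas Hp)] domain
  domain_subset : domain ⊆ base.chart.source
  toFun : GrRes Hp → (H →L[ℂ] H)
  mem_unitaryRes : ∀ p ∈ domain, toFun p ∈ unitaryRes Hp
  map_eq : ∀ p ∈ domain, Hp.map (toFun p).toLinearMap = p.space
  contDiffOn : ∀ c ∈ grAtlas Hp,
    ContDiffOn ℝ ∞ (c.pull toFun) (c.toFun '' (c.source ∩ domain))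
  contDiffOn_comm : ∀ c ∈ grAtlas Hp,
    ContDiffOn ℝ ∞ (c.pull fun p => HS.ofCLM (commPlus Hp (toFun p)))
      (c.toFun '' (c.source ∩ domain))

/-! ### The manifold structure on the set of partial isometries -/

namespace URes

/-- The operator `σ_γ(uu*)⁻¹ u σ_β(u*u)|_{H₊}` on `H₊`. -/
def reduced (b g : LocalSection Hp) (u : URes Hp) : Hp →L[ℂ] Hp :=
  Hp.orthogonalProjectionOnto ∘L (star (g.toFun u.tgt) * u.op * b.toFun u.src) ∘L Hp.subtypeL

/-- The domain `Ω_{αβγ}`. -/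
def chartSource (a : UnitaryChart Hp) (b g : LocalSection Hp) : Set (URes Hp) :=
  {u | u.src ∈ b.domain ∧ u.tgt ∈ g.domain ∧ reduced b g u ∈ a.source}

/-- The map `Φ_{αβγ}`. -/
def coord (a : UnitaryChart Hp) (b g : LocalSection Hp) (u : URes Hp) :
    HS g.base.space g.base.spaceᗮ × HS b.base.space b.base.spaceᗮ × SkewOp Hp :=
  (g.base.coord u.tgt, b.base.coord u.src, a.toFun (reduced b g u))

/-- The chart `(Ω_{αβγ}, Φ_{αβγ})`. -/
def chart (a : UnitaryChart Hp) (b g : LocalSection Hp) : BanachChart (URes Hp) where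
  E := HS g.base.space g.base.spaceᗮ × HS b.base.space b.base.spaceᗮ × SkewOp Hp
  source := chartSource a b g
  toFun := coord a b g

/-- The atlas obtained from a family of charts of `U₊` and a family of local cross sections. -/
def atlas (A : Set (UnitaryChart Hp)) (S : Set (LocalSection Hp)) : Set (BanachChart (URes Hp)) :=
  {c | ∃ a ∈ A, ∃ b ∈ S, ∃ g ∈ S, c = chart a b g}

end URes

end Restricted

end

end RestrictedGroupoid

open RestrictedGroupoid

namespace RestrictedGroupoid

noncomputable section

/-! ### The ideal of Hilbert–Schmidt operators -/

section HilbertSchmidtIdeal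

variable {E F G : Type u} [NormedAddCommGroup E] [InnerProductSpace ℂ E]
  [NormedAddCommGroup F] [InnerProductSpace ℂ F] [NormedAddCommGroup G] [InnerProductSpace ℂ G]

/-! The groupoid is locally a product. If `σ_γ` and `σ_β` are local sections near `uu*` and `u*u`,
then `u = σ_γ(uu*) k σ_β(u*u)*`, where `k` is a unitary operator on `H₊` extended by zero to `H`.
Conversely, every choice of target, source and `k` gives a partial isometry (`op_eq`,
`exists_reduced_eq`). In these coordinates source and target are projections, inversion swaps the
two base points and replaces `k` by `k*`, and multiplication multiplies the unitary parts, because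
the inner factors `σ_β* σ_β` cancel.

Smoothness is not checked on transition maps one by one. A family of partial isometries with smooth
operator, source and target is smooth in every chart (`SmoothFamily.smoothInto`), and inverse charts
are such families (`smoothFamily_chart_inv`). Compatibility of charts and smoothness of the
structure maps follow, since adjoints and products of smooth operator families are smooth. The
Hausdorff property comes from the continuous injections `u ↦ u` and `W ↦ P_W` into the bounded
operators.

On the Grassmannian, the charts are onto because adding a Hilbert–Schmidt operator preserves the
Fredholm property (`IsFredholm.add_isHilbertSchmidt`). Their transition maps are fractional linear,
and smooth for the Hilbert–Schmidt norm because Hilbert–Schmidt operators form an ideal with bounded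
composition. The inputs are Hilbert–Schmidt because `P_W - P₊` is (`isHilbertSchmidt_proj_sub`).

A section near `W` is a fixed `g` in `U_res` with `g H₊ = W`, followed by a rotation of `W` onto a
nearby `V`. Such a `g` exists because `W` and its complement are infinite-dimensional and separable.
The rotation is the Cayley transform of `A - A*`, which sends `W` to the graph of `2A(1 - A*A)⁻¹`;
the inverse function theorem finds `A` from the coordinate of `V`. The Cayley transform also gives
charts of `U₊`. -/

theorem hsENorm_comp_le (S : F →L[ℂ] G) (T : E →L[ℂ] F) :
    hsENorm (S ∘L T) ≤ ‖S‖ₑ * hsENorm T := by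
  refine hsENorm_le fun n e he => ?_
  calc (∑ i, ‖(S ∘L T) (e i)‖ₑ ^ (2 : ℝ)) ^ (1 / (2 : ℝ))
      ≤ (∑ i, (‖S‖ₑ * ‖T (e i)‖ₑ) ^ (2 : ℝ)) ^ (1 / (2 : ℝ)) := by
        gcongr with i
        exact S.le_opENorm _
    _ = ‖S‖ₑ * (∑ i, ‖T (e i)‖ₑ ^ (2 : ℝ)) ^ (1 / (2 : ℝ)) := by
        simp_rw [ENNReal.mul_rpow_of_nonneg _ _ (by norm_num : (0 : ℝ) ≤ 2)]
        rw [← Finset.mul_sum, ENNReal.mul_rpow_of_nonneg _ _ (by norm_num : (0 : ℝ) ≤ 1 / 2),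
          ← ENNReal.rpow_mul]
        norm_num
    _ ≤ ‖S‖ₑ * hsENorm T := by
        gcongr
        exact le_hsENorm T he

/-- Parseval's identity. With values in `ℝ≥0∞`, the double sums in `hsENorm_adjoint` can be
interchanged without any summability condition. -/
theorem enorm_sq_eq_tsum_inner [CompleteSpace E] {ι : Type*} (b : HilbertBasis ι ℂ E) (x : E) :
    ‖x‖ₑ ^ (2 : ℝ) = ∑' i, ‖⟪b i, x⟫_ℂ‖ₑ ^ (2 : ℝ) := by
  have hs := b.hasSum_inner_mul_inner x x
  have hs' : HasSum (fun i => ‖⟪b i, x⟫_ℂ‖ ^ 2) (‖x‖ ^ 2) := by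
    have := Complex.hasSum_re hs
    convert! this using 1
    · ext i
      have h := inner_mul_symm_re_eq_norm (𝕜 := ℂ) x (b i)
      rw [norm_mul, norm_inner_symm, ← sq] at h
      exact h.symm
    · exact (inner_self_eq_norm_sq (𝕜 := ℂ) x).symm
  have hsqC : ∀ x : ℂ, ‖x‖ₑ ^ (2 : ℝ) = ENNReal.ofReal (‖x‖ ^ 2) := fun x => by
    rw [← ofReal_norm, ENNReal.rpow_ofNat, ENNReal.ofReal_pow (norm_nonneg x)]
  simp_rw [hsqC]
  rw [← ENNReal.ofReal_tsum_of_nonneg (fun _ => by positivity) hs'.summable, hs'.tsum_eq,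
    ← ofReal_norm, ENNReal.rpow_ofNat, ENNReal.ofReal_pow (norm_nonneg x)]

theorem IsHilbertSchmidt.comp_left {T : E →L[ℂ] F} (hT : IsHilbertSchmidt T) (S : F →L[ℂ] G) :
    IsHilbertSchmidt (S ∘L T) :=
  ne_top_of_le_ne_top (ENNReal.mul_ne_top enorm_ne_top hT) (hsENorm_comp_le S T)

theorem IsHilbertSchmidt.add {S T : E →L[ℂ] F} (hS : IsHilbertSchmidt S)
    (hT : IsHilbertSchmidt T) : IsHilbertSchmidt (S + T) :=
  (hilbertSchmidt E F).add_mem hS hT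

theorem IsHilbertSchmidt.sub {S T : E →L[ℂ] F} (hS : IsHilbertSchmidt S)
    (hT : IsHilbertSchmidt T) : IsHilbertSchmidt (S - T) :=
  (hilbertSchmidt E F).sub_mem hS hT

theorem IsHilbertSchmidt.neg {S : E →L[ℂ] F} (hS : IsHilbertSchmidt S) :
    IsHilbertSchmidt (-S) :=
  (hilbertSchmidt E F).neg_mem hS

theorem isHilbertSchmidt_zero : IsHilbertSchmidt (0 : E →L[ℂ] F) :=
  (hilbertSchmidt E F).zero_mem

/-- An orthonormal family has at most `dim E` members, and each contributes at most `‖T‖²`. -/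
theorem isHilbertSchmidt_of_finiteDimensional [FiniteDimensional ℂ E] (T : E →L[ℂ] F) :
    IsHilbertSchmidt T := by
  refine ne_top_of_le_ne_top (b := ((Module.finrank ℂ E : ℝ≥0∞) * ‖T‖ₑ ^ (2 : ℝ)) ^ (1 / (2 : ℝ)))
    ?_ (hsENorm_le fun n e he => ?_)
  · exact ENNReal.rpow_ne_top_of_nonneg (by norm_num) (ENNReal.mul_ne_top (by simp)
      (ENNReal.rpow_ne_top_of_nonneg (by norm_num) enorm_ne_top))
  · gcongr
    calc ∑ i, ‖T (e i)‖ₑ ^ (2 : ℝ) ≤ ∑ _i : Fin n, ‖T‖ₑ ^ (2 : ℝ) := by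
          gcongr with i
          refine (T.le_opENorm _).trans_eq ?_
          rw [← ofReal_norm (e i), he.1 i, ENNReal.ofReal_one, mul_one]
      _ = (n : ℝ≥0∞) * ‖T‖ₑ ^ (2 : ℝ) := by simp
      _ ≤ _ := by
          gcongr
          simpa using he.linearIndependent.fintype_card_le_finrank

/-- A Hilbert–Schmidt operator is a sum of an operator of small norm and one of finite rank. -/
theorem IsHilbertSchmidt.exists_finiteRange {T : E →L[ℂ] F} (hT : IsHilbertSchmidt T) {ε : ℝ}
    (hε : 0 < ε) : ∃ R : E →L[ℂ] F, FiniteDimensional ℂ R.range ∧ ‖T - R‖ ≤ ε := by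
  obtain ⟨C, hC⟩ : ∃ C : ℝ, ∀ n (e : Fin n → E), Orthonormal ℂ e → ∑ i, ‖T (e i)‖ ^ 2 ≤ C := by
    refine ⟨(hsENorm T).toReal ^ 2, fun n e he => ?_⟩
    have h := le_hsENorm T he
    rw [one_div, ENNReal.rpow_inv_le_iff (by norm_num)] at h
    have h2 := ENNReal.toReal_mono (ENNReal.rpow_ne_top_of_nonneg (by norm_num) hT) h
    rw [ENNReal.toReal_sum fun i _ => ENNReal.rpow_ne_top_of_nonneg (by norm_num) enorm_ne_top]
      at h2
    simpa [← ENNReal.toReal_rpow] using h2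
  let s : Set ℝ := {x | ∃ n, ∃ e : Fin n → E, Orthonormal ℂ e ∧ ∑ i, ‖T (e i)‖ ^ 2 = x}
  have hs : BddAbove s := ⟨C, by rintro _ ⟨n, e, he, rfl⟩; exact hC n e he⟩
  have hs0 : s.Nonempty := ⟨_, 0, Fin.elim0, (⟨fun i => i.elim0, fun i => i.elim0⟩ :
    Orthonormal ℂ (Fin.elim0 : Fin 0 → E)), rfl⟩
  -- The family `e` comes within `ε²` of the supremum. Enlarging it by a unit vector `y` orthogonal
  -- to it cannot exceed the supremum, so `‖T y‖ ≤ ε`: off the span of `e` the operator is small.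
  obtain ⟨_, ⟨n, e, he, rfl⟩, hx⟩ := exists_lt_of_lt_csSup hs0
    (sub_lt_self (sSup s) (show 0 < ε ^ 2 by positivity))
  let K : Submodule ℂ E := Submodule.span ℂ (Set.range e)
  have : FiniteDimensional ℂ K := FiniteDimensional.span_of_finite ℂ (Set.finite_range _)
  have key : ∀ x ∈ Kᗮ, ‖T x‖ ≤ ε * ‖x‖ := by
    intro x hxK
    by_cases hx0 : x = 0
    · simp [hx0]
    have hx' : ‖x‖ ≠ 0 := norm_ne_zero_iff.2 hx0
    let y : E := ((‖x‖⁻¹ : ℝ) : ℂ) • x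
    have hy : ‖y‖ = 1 := by simp [y, norm_smul, hx']
    have hyK : ∀ i, ⟪e i, y⟫_ℂ = 0 := fun i =>
      Submodule.inner_right_of_mem_orthogonal (K := K)
        (Submodule.subset_span (Set.mem_range_self i)) (Kᗮ.smul_mem _ hxK)
    have ho : Orthonormal ℂ (Fin.cons y e : Fin (n + 1) → E) := by
      rw [orthonormal_iff_ite]
      intro i j
      refine Fin.cases ?_ (fun i => ?_) i <;> refine Fin.cases ?_ (fun j => ?_) j
      · simp [hy, inner_self_eq_norm_sq_to_K]
      · simp [inner_eq_zero_symm.1 (hyK j), (Fin.succ_ne_zero j).symm]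
      · simp [hyK i]
      · simpa using orthonormal_iff_ite.1 he i j
    have h1 : ∑ i, ‖T ((Fin.cons y e : Fin (n + 1) → E) i)‖ ^ 2 ≤ sSup s :=
      le_csSup hs ⟨_, _, ho, rfl⟩
    rw [Fin.sum_univ_succ] at h1
    simp only [Fin.cons_zero, Fin.cons_succ] at h1
    have h2 : ‖T y‖ ≤ ε := by
      refine le_of_sq_le_sq ?_ hε.le
      linarith
    have h3 : ‖T y‖ = ‖x‖⁻¹ * ‖T x‖ := by simp [y, norm_smul]
    rw [h3, inv_mul_le_iff₀ (by positivity)] at h2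
    linarith
  refine ⟨T ∘L K.starProjection, ?_, ?_⟩
  · have hle : (T ∘L K.starProjection).range ≤ K.map T.toLinearMap := by
      rintro _ ⟨x, rfl⟩
      exact ⟨K.starProjection x, K.starProjection_apply_mem x, rfl⟩
    exact Submodule.finiteDimensional_of_le hle
  · refine ContinuousLinearMap.opNorm_le_bound _ hε.le fun x => ?_
    have h1 : (T - T ∘L K.starProjection) x = T (x - K.starProjection x) := by simp
    rw [h1]
    refine (key _ (K.sub_starProjection_mem_orthogonal x)).trans ?_
    gcongr
    rw [← Submodule.starProjection_orthogonal_val]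
    exact Kᗮ.norm_starProjection_apply_le x

namespace HS

theorem toCLM_ofCLM {T : E →L[ℂ] F} (hT : IsHilbertSchmidt T) : toCLM (ofCLM T) = T := by
  have h : ofCLM T = (⟨T, hT⟩ : ↥(hilbertSchmidt E F)) := dif_pos (c := T ∈ hilbertSchmidt E F) hT
  rw [h]
  rfl

theorem ofCLM_toCLM (T : HS E F) : ofCLM (toCLM T) = T :=
  toCLM_injective (toCLM_ofCLM T.isHilbertSchmidt)

variable (E F) in
/-- The inclusion of the Hilbert–Schmidt operators into the bounded operators. -/
def toCLML : HS E F →L[ℂ] (E →L[ℂ] F) :=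
  toCLM.mkContinuous 1 fun T =>
    ContinuousLinearMap.opNorm_le_bound _ (by positivity) fun x => by
      simpa using norm_apply_le T x

variable (E F G) in
/-- Composition of a Hilbert–Schmidt operator with a bounded operator on the left. -/
def compLeft : (F →L[ℂ] G) →L[ℂ] HS E F →L[ℂ] HS E G :=
  LinearMap.mkContinuous₂
    (LinearMap.mk₂ ℂ (fun S T => (⟨S ∘L toCLM T, T.isHilbertSchmidt.comp_left S⟩ :
        ↥(hilbertSchmidt E G)) : (F →L[ℂ] G) → HS E F → HS E G)
      (fun S S' T => toCLM_injective (ContinuousLinearMap.add_comp _ _ _))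
      (fun c S T => toCLM_injective (ContinuousLinearMap.smul_comp _ _ _))
      (fun S T T' => toCLM_injective (ContinuousLinearMap.comp_add _ _ _))
      (fun c S T => toCLM_injective (ContinuousLinearMap.comp_smul _ _ _))) 1 fun S T => by
    rw [one_mul]
    have h := ENNReal.toReal_mono (ENNReal.mul_ne_top enorm_ne_top T.isHilbertSchmidt)
      (hsENorm_comp_le S (toCLM T))
    rwa [ENNReal.toReal_mul, toReal_enorm] at h

@[simp] theorem toCLM_compLeft (S : F →L[ℂ] G) (T : HS E F) :
    toCLM (compLeft E F G S T) = S ∘L toCLM T := rfl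

end HS

variable [CompleteSpace E] [CompleteSpace F] [CompleteSpace G]

/-- Both sides are the double sum of the squared moduli of the matrix entries of `T` in two Hilbert
bases, taken in the two orders. -/
theorem hsENorm_adjoint (T : E →L[ℂ] F) : hsENorm T.adjoint = hsENorm T := by
  obtain ⟨w, b, -⟩ := exists_hilbertBasis ℂ E
  obtain ⟨w', b', -⟩ := exists_hilbertBasis ℂ F
  rw [hsENorm_eq_tsum b, hsENorm_eq_tsum b']
  congr 1
  simp_rw [enorm_sq_eq_tsum_inner b, enorm_sq_eq_tsum_inner b']
  rw [ENNReal.tsum_comm]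
  refine tsum_congr fun i => tsum_congr fun j => ?_
  rw [ContinuousLinearMap.adjoint_inner_right, ← ofReal_norm, ← ofReal_norm, norm_inner_symm]

theorem hsENorm_comp_le' (T : F →L[ℂ] G) (S : E →L[ℂ] F) :
    hsENorm (T ∘L S) ≤ hsENorm T * ‖S‖ₑ := by
  rw [← hsENorm_adjoint, ContinuousLinearMap.adjoint_comp, mul_comm]
  refine (hsENorm_comp_le _ _).trans ?_
  rw [hsENorm_adjoint, ← ofReal_norm, LinearIsometryEquiv.norm_map, ofReal_norm]

theorem IsHilbertSchmidt.comp_right {T : F →L[ℂ] G} (hT : IsHilbertSchmidt T) (S : E →L[ℂ] F) :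
    IsHilbertSchmidt (T ∘L S) :=
  ne_top_of_le_ne_top (ENNReal.mul_ne_top hT enorm_ne_top) (hsENorm_comp_le' T S)

theorem IsHilbertSchmidt.adjoint {T : E →L[ℂ] F} (hT : IsHilbertSchmidt T) :
    IsHilbertSchmidt T.adjoint := by
  rwa [IsHilbertSchmidt, hsENorm_adjoint]

/-- The operator factors through its range, and the inclusion of that range has finite-dimensional
domain. -/
theorem isHilbertSchmidt_of_finiteRange {T : E →L[ℂ] F}
    (hT : FiniteDimensional ℂ T.range) :
    IsHilbertSchmidt T := by
  have h := (isHilbertSchmidt_of_finiteDimensional T.range.subtypeL).comp_right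
    (T.codRestrict T.range fun x => ⟨x, rfl⟩)
  exact h

namespace HS

variable (E F G) in
/-- Composition of a Hilbert–Schmidt operator with a bounded operator on the right. -/
def compRight : HS F G →L[ℂ] (E →L[ℂ] F) →L[ℂ] HS E G :=
  LinearMap.mkContinuous₂
    (LinearMap.mk₂ ℂ (fun T S => (⟨toCLM T ∘L S, T.isHilbertSchmidt.comp_right S⟩ :
        ↥(hilbertSchmidt E G)) : HS F G → (E →L[ℂ] F) → HS E G)
      (fun S S' T => toCLM_injective (ContinuousLinearMap.add_comp _ _ _))
      (fun c S T => toCLM_injective (ContinuousLinearMap.smul_comp _ _ _))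
      (fun S T T' => toCLM_injective (ContinuousLinearMap.comp_add _ _ _))
      (fun c S T => toCLM_injective (ContinuousLinearMap.comp_smul _ _ _))) 1 fun T S => by
    rw [one_mul]
    have h := ENNReal.toReal_mono (ENNReal.mul_ne_top T.isHilbertSchmidt enorm_ne_top)
      (hsENorm_comp_le' (toCLM T) S)
    rwa [ENNReal.toReal_mul, toReal_enorm] at h

@[simp] theorem toCLM_compRight (T : HS F G) (S : E →L[ℂ] F) :
    toCLM (compRight E F G T S) = toCLM T ∘L S := rfl

variable (E F) in
/-- The adjoint of Hilbert–Schmidt operators, as a real-linear map. -/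
def adjointL : HS E F →L[ℝ] HS F E :=
  LinearMap.mkContinuous
    { toFun := fun T => ((⟨(toCLM T).adjoint, T.isHilbertSchmidt.adjoint⟩ :
        ↥(hilbertSchmidt F E)) : HS F E)
      map_add' := fun S T => toCLM_injective (map_add ContinuousLinearMap.adjoint _ _)
      map_smul' := fun c T => toCLM_injective (by
        change ContinuousLinearMap.adjoint ((c : ℂ) • toCLM T) =
          (c : ℂ) • ContinuousLinearMap.adjoint (toCLM T)
        rw [map_smulₛₗ, Complex.conj_ofReal]) } 1 fun T => by
    rw [one_mul]
    exact (congrArg ENNReal.toReal (hsENorm_adjoint (toCLM T))).le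

@[simp] theorem toCLM_adjointL (T : HS E F) :
    toCLM (adjointL E F T) = ContinuousLinearMap.adjoint (toCLM T) := rfl

end HS

end HilbertSchmidtIdeal

/-! ### Smoothness of operations on operators -/

section OperatorCalculus

variable {Y : Type*} [NormedAddCommGroup Y] [NormedSpace ℝ Y] {n : WithTop ℕ∞} {y : Y}

/-- The compositions are complex bilinear, but smoothness is taken over the reals because adjoints
occur. -/
theorem contDiffAt_bilinear {E₁ E₂ E₃ : Type*} [NormedAddCommGroup E₁] [NormedSpace ℂ E₁]
    [NormedAddCommGroup E₂] [NormedSpace ℂ E₂] [NormedAddCommGroup E₃] [NormedSpace ℂ E₃]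
    (B : E₁ →L[ℂ] E₂ →L[ℂ] E₃) {f : Y → E₁} {g : Y → E₂} (hf : ContDiffAt ℝ n f y)
    (hg : ContDiffAt ℝ n g y) : ContDiffAt ℝ n (fun y => B (f y) (g y)) y :=
  (B.isBoundedBilinearMap.contDiff.restrict_scalars ℝ).contDiffAt.comp y (hf.prodMk hg)

theorem hasFDerivAt_bilinear {E₁ E₂ E₃ : Type*} [NormedAddCommGroup E₁] [NormedSpace ℂ E₁]
    [NormedAddCommGroup E₂] [NormedSpace ℂ E₂] [NormedAddCommGroup E₃] [NormedSpace ℂ E₃]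
    (B : E₁ →L[ℂ] E₂ →L[ℂ] E₃) {f : Y → E₁} {g : Y → E₂} {f' : Y →L[ℝ] E₁} {g' : Y →L[ℝ] E₂}
    (hf : HasFDerivAt f f' y) (hg : HasFDerivAt g g' y) :
    HasFDerivAt (fun y => B (f y) (g y)) ((B (f y)).restrictScalars ℝ ∘L g' +
      (B.flip (g y)).restrictScalars ℝ ∘L f') y := by
  have h := (B.isBoundedBilinearMap.hasFDerivAt (f y, g y)).restrictScalars ℝ
  have h' := HasFDerivAt.comp (g := fun p : E₁ × E₂ => B p.1 p.2) y h (hf.prodMk hg)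
  refine h'.congr_fderiv ?_
  ext
  simp

variable {E F G : Type u} [NormedAddCommGroup E] [InnerProductSpace ℂ E]
  [NormedAddCommGroup F] [InnerProductSpace ℂ F] [NormedAddCommGroup G] [InnerProductSpace ℂ G]

theorem contDiffAt_comp {f : Y → F →L[ℂ] G} {g : Y → E →L[ℂ] F} (hf : ContDiffAt ℝ n f y)
    (hg : ContDiffAt ℝ n g y) : ContDiffAt ℝ n (fun y => f y ∘L g y) y :=
  contDiffAt_bilinear (ContinuousLinearMap.compL ℂ E F G) hf hg

namespace HS

theorem contDiff_toCLM : ContDiff ℝ n fun T : HS E F => toCLM T :=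
  (ContinuousLinearMap.contDiff (𝕜 := ℂ) (toCLML E F)).restrict_scalars ℝ

theorem contDiffAt_compLeft {f : Y → F →L[ℂ] G} {g : Y → HS E F} (hf : ContDiffAt ℝ n f y)
    (hg : ContDiffAt ℝ n g y) : ContDiffAt ℝ n (fun y => compLeft E F G (f y) (g y)) y :=
  contDiffAt_bilinear (compLeft E F G) hf hg

variable [CompleteSpace E] [CompleteSpace F] [CompleteSpace G]

theorem contDiffAt_compRight {f : Y → HS F G} {g : Y → E →L[ℂ] F} (hf : ContDiffAt ℝ n f y)
    (hg : ContDiffAt ℝ n g y) : ContDiffAt ℝ n (fun y => compRight E F G (f y) (g y)) y :=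
  contDiffAt_bilinear (compRight E F G) hf hg

theorem contDiffAt_adjointL {f : Y → HS E F} (hf : ContDiffAt ℝ n f y) :
    ContDiffAt ℝ n (fun y => adjointL E F (f y)) y :=
  (ContinuousLinearMap.contDiff (𝕜 := ℝ) (adjointL E F)).contDiffAt.comp y hf

end HS

theorem contDiffAt_star [CompleteSpace E] {f : Y → E →L[ℂ] E} (hf : ContDiffAt ℝ n f y) :
    ContDiffAt ℝ n (fun y => star (f y)) y :=
  (ContinuousLinearEquiv.contDiff (𝕜 := ℝ) (starL' ℝ : (E →L[ℂ] E) ≃L[ℝ] _)).contDiffAt.comp y hf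

theorem contDiffAt_ringInverse_comp [CompleteSpace E] {f : Y → E →L[ℂ] E}
    (hf : ContDiffAt ℝ n f y) (hu : IsUnit (f y)) :
    ContDiffAt ℝ n (fun y => Ring.inverse (f y)) y := by
  obtain ⟨x, hx⟩ := hu
  have h := contDiffAt_ringInverse ℝ (n := n) x
  rw [hx] at h
  exact h.comp y hf

theorem eventually_isUnit {Z : Type*} [TopologicalSpace Z] [CompleteSpace E]
    {f : Z → E →L[ℂ] E} {y : Z} (hf : ContinuousAt f y) (hu : IsUnit (f y)) :
    ∀ᶠ z in 𝓝 y, IsUnit (f z) :=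
  hf.eventually (Units.isOpen.mem_nhds hu)

end OperatorCalculus

end
end RestrictedGroupoid

namespace RestrictedGroupoid

noncomputable section

/-! ### Fredholm operators and Hilbert–Schmidt perturbations -/

section Fredholm

variable {E F G : Type u} [NormedAddCommGroup E] [InnerProductSpace ℂ E]
  [NormedAddCommGroup F] [InnerProductSpace ℂ F] [NormedAddCommGroup G] [InnerProductSpace ℂ G]

theorem IsFredholm.comp_equiv {T : F →L[ℂ] G} (hT : T.IsFredholm) (e : E ≃L[ℂ] F) :
    (T ∘L (e : E →L[ℂ] F)).IsFredholm := by
  obtain ⟨Q, hQ⟩ := hT.exists_isQuasiInverse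
  refine .of_isQuasiInverse (v := (e.symm : F →L[ℂ] E) ∘L Q) ?_
  exact LinearMap.IsQuasiInverse.comp e.toLinearEquiv.isQuasiInverse hQ

theorem isFredholm_id : (ContinuousLinearMap.id ℂ E).IsFredholm :=
  .of_isQuasiInverse (v := .id ℂ E) (LinearEquiv.refl ℂ E).isQuasiInverse

/-- Distinct members are at distance `√2`, so the balls of radius `1/2` around them are disjoint. -/
theorem countable_of_orthonormal [TopologicalSpace.SeparableSpace E] {ι : Type*} {v : ι → E}
    (hv : Orthonormal ℂ v) : Countable ι := by
  refine Pairwise.countable_of_isOpen_disjoint (s := fun i => Metric.ball (v i) (1 / 2))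
    (fun i j hij => ?_) (fun i => Metric.isOpen_ball) (fun i => ⟨v i, by simp⟩)
  refine Metric.ball_disjoint_ball ?_
  have h : ‖v i - v j‖ ^ 2 = 2 := by
    rw [@norm_sub_sq ℂ, hv.1 i, hv.1 j, hv.2 hij]
    norm_num
  rw [dist_eq_norm]
  nlinarith [norm_nonneg (v i - v j)]

variable [CompleteSpace E] [CompleteSpace F]

theorem exists_inverse_id_add {K : E →L[ℂ] E} (hK : ‖K‖ < 1) :
    ∃ a : E →L[ℂ] E, (ContinuousLinearMap.id ℂ E + K) ∘L a = .id ℂ E ∧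
      a ∘L (ContinuousLinearMap.id ℂ E + K) = .id ℂ E := by
  have h : IsUnit (1 - -K) := isUnit_one_sub_of_norm_lt_one (by rwa [norm_neg])
  rw [sub_neg_eq_add] at h
  exact ⟨Ring.inverse (1 + K), Ring.mul_inverse_cancel _ h, Ring.inverse_mul_cancel _ h⟩

open scoped LinearMap.FiniteRangeSetoid in
-- Split `K = L + R` with `R` of finite rank and `L` small against a quasi-inverse `Q` of `T`. A
-- Neumann series corrects `Q` to a quasi-inverse of `T + L`, and adding `R` changes nothing modulo
-- finite rank.
theorem IsFredholm.add_isHilbertSchmidt {T K : E →L[ℂ] F} (hT : T.IsFredholm)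
    (hK : IsHilbertSchmidt K) : (T + K).IsFredholm := by
  obtain ⟨Q, hQ⟩ := hT.exists_isQuasiInverse
  -- The bound makes `‖L‖ * ‖Q‖ < 1`; the summand `1` covers the case `Q = 0`.
  obtain ⟨R, hR, hKR⟩ := hK.exists_finiteRange (ε := (2 * (‖Q‖ + 1))⁻¹) (by positivity)
  set L := K - R with hL
  have hsmall : ‖L‖ * ‖Q‖ < 1 := by
    calc ‖L‖ * ‖Q‖ ≤ (2 * (‖Q‖ + 1))⁻¹ * ‖Q‖ := by gcongr
      _ < 1 := by
        rw [inv_mul_lt_iff₀ (by positivity)]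
        linarith [norm_nonneg Q]
  obtain ⟨a, ha, ha'⟩ := exists_inverse_id_add
    ((L.opNorm_comp_le Q).trans_lt hsmall)
  obtain ⟨b, hb, hb'⟩ := exists_inverse_id_add
    ((Q.opNorm_comp_le L).trans_lt (by rwa [mul_comm]))
  -- Since `(1 + QL)Q = Q(1 + LQ)`, the corrections on the two sides give the same operator, which
  -- is thus a two-sided quasi-inverse.
  have hab : Q ∘L a = b ∘L Q := by
    calc Q ∘L a = (b ∘L (.id ℂ E + Q ∘L L)) ∘L Q ∘L a := by rw [hb']; rfl
      _ = b ∘L Q ∘L ((.id ℂ F + L ∘L Q) ∘L a) := by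
        ext x; simp
      _ = b ∘L Q := by rw [ha]; rfl
  have h1 : (T + L).toLinearMap ∘ₗ (Q ∘L a).toLinearMap ≈ LinearMap.id := by
    have e : (T + L).toLinearMap ∘ₗ (Q ∘L a).toLinearMap - LinearMap.id =
        (T.toLinearMap ∘ₗ Q.toLinearMap - LinearMap.id) ∘ₗ a.toLinearMap := by
      ext x
      have := congrArg (fun A => A x) ha
      simp only [ContinuousLinearMap.comp_apply, ContinuousLinearMap.id_apply,
        add_apply] at this
      simp only [LinearMap.sub_apply, LinearMap.comp_apply, LinearMap.id_apply,
        ContinuousLinearMap.coe_coe, ContinuousLinearMap.comp_apply, add_apply]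
      nth_rw 3 [← this]
      abel
    rw [LinearMap.FiniteRangeSetoid.equiv_iff_hasNoetherianRange, e]
    exact (LinearMap.FiniteRangeSetoid.equiv_iff_hasNoetherianRange.1 hQ.2).comp_right _
  have h2 : (Q ∘L a).toLinearMap ∘ₗ (T + L).toLinearMap ≈ LinearMap.id := by
    have e : (Q ∘L a).toLinearMap ∘ₗ (T + L).toLinearMap - LinearMap.id =
        b.toLinearMap ∘ₗ (Q.toLinearMap ∘ₗ T.toLinearMap - LinearMap.id) := by
      rw [hab]
      ext x
      have := congrArg (fun A => A x) hb'
      simp only [ContinuousLinearMap.comp_apply, ContinuousLinearMap.id_apply,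
        add_apply, map_add] at this
      simp only [LinearMap.sub_apply, LinearMap.comp_apply, LinearMap.id_apply, map_sub, map_add,
        ContinuousLinearMap.coe_coe, ContinuousLinearMap.comp_apply, add_apply]
      rw [eq_sub_of_add_eq' this]
      abel
    rw [LinearMap.FiniteRangeSetoid.equiv_iff_hasNoetherianRange, e]
    exact (LinearMap.FiniteRangeSetoid.equiv_iff_hasNoetherianRange.1 hQ.1).comp_left _
  have h3 : (T + K).toLinearMap ≈ (T + L).toLinearMap := by
    rw [LinearMap.FiniteRangeSetoid.equiv_iff_hasFiniteRange,
      LinearMap.hasFiniteRange_iff_range]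
    have e : (T + K).toLinearMap - (T + L).toLinearMap = R.toLinearMap := by
      ext x
      simp [hL]
    rw [e]
    exact (Submodule.fg_iff_finiteDimensional _).2 hR
  exact .of_isQuasiInverse (v := Q ∘L a)
    (LinearMap.IsQuasiInverse.congr ⟨h2, h1⟩ (Setoid.refl _) h3)

/-- A finite-rank operator within `1/2` of the identity is invertible, hence onto, so the whole
space is its range. -/
theorem finiteDimensional_of_isHilbertSchmidt_id
    (h : IsHilbertSchmidt (ContinuousLinearMap.id ℂ E)) : FiniteDimensional ℂ E := by
  obtain ⟨R, hR, hε⟩ := h.exists_finiteRange (ε := 1 / 2) (by norm_num)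
  obtain ⟨a, ha, -⟩ := exists_inverse_id_add (K := R - .id ℂ E)
    (by rw [norm_sub_rev]; linarith)
  rw [add_sub_cancel] at ha
  have hs : Function.Surjective R := fun x => ⟨a x, congrArg (fun A => A x) ha⟩
  have : R.range = ⊤ := LinearMap.range_eq_top.2 hs
  rw [this] at hR
  exact Module.Finite.equiv (Submodule.topEquiv (R := ℂ) (M := E))

theorem exists_hilbertBasis_nat [TopologicalSpace.SeparableSpace E]
    (h : ¬ FiniteDimensional ℂ E) : Nonempty (HilbertBasis ℕ ℂ E) := by
  obtain ⟨w, b, -⟩ := exists_hilbertBasis ℂ E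
  have : Countable w := countable_of_orthonormal b.orthonormal
  have : Infinite w := by
    by_contra hfin
    rw [not_infinite_iff_finite] at hfin
    have := Fintype.ofFinite w
    exact h b.toOrthonormalBasis.toBasis.finiteDimensional_of_finite
  obtain ⟨e⟩ := nonempty_equiv_of_countable (α := ℕ) (β := w)
  refine ⟨HilbertBasis.mk (v := b ∘ e) (b.orthonormal.comp _ e.injective) ?_⟩
  rw [e.surjective.range_comp]
  exact b.dense_span.ge

/-- Both spaces are isometric to `ℓ²(ℕ)`. -/
theorem nonempty_linearIsometryEquiv [TopologicalSpace.SeparableSpace E]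
    [TopologicalSpace.SeparableSpace F] (hE : ¬ FiniteDimensional ℂ E)
    (hF : ¬ FiniteDimensional ℂ F) : Nonempty (E ≃ₗᵢ[ℂ] F) := by
  obtain ⟨b⟩ := exists_hilbertBasis_nat hE
  obtain ⟨c⟩ := exists_hilbertBasis_nat hF
  exact ⟨b.repr.trans c.repr.symm⟩

end Fredholm
end
end RestrictedGroupoid

namespace RestrictedGroupoid

noncomputable section

/-! ### Smooth maps into manifolds given by atlases -/

section Manifold

variable {M N : Type u}

variable {Y : Type*} [NormedAddCommGroup Y] [NormedSpace ℝ Y]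

/-- The map `v`, defined on the subset `D` of a normed space, is a smooth map to the manifold `M`,
for `D` open. -/
def SmoothInto (𝒜 : Set (BanachChart M)) (D : Set Y) (v : Y → M) : Prop :=
  ∀ d ∈ 𝒜, IsOpen (D ∩ v ⁻¹' d.source) ∧
    ContDiffOn ℝ ∞ (fun y => d.toFun (v y)) (D ∩ v ⁻¹' d.source)

variable {𝒜 : Set (BanachChart M)} {ℬ : Set (BanachChart N)}

theorem SmoothInto.congr {D : Set Y} {v w : Y → M} (hv : SmoothInto 𝒜 D v)
    (h : ∀ y ∈ D, w y = v y) : SmoothInto 𝒜 D w := by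
  intro d hd
  have e : D ∩ w ⁻¹' d.source = D ∩ v ⁻¹' d.source := by
    ext y
    exact and_congr_right fun hy => by rw [Set.mem_preimage, Set.mem_preimage, h y hy]
  rw [e]
  exact ⟨(hv d hd).1, (hv d hd).2.congr fun y hy => by rw [h y hy.1]⟩

theorem SmoothInto.comp {Z : Type*} [NormedAddCommGroup Z] [NormedSpace ℝ Z] {D : Set Y}
    {v : Y → M} (hv : SmoothInto 𝒜 D v) {D' : Set Z} (hD' : IsOpen D') {f : Z → Y}
    (hf : ContDiffOn ℝ ∞ f D') (hfD : Set.MapsTo f D' D) : SmoothInto 𝒜 D' (v ∘ f) := by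
  intro d hd
  have e : D' ∩ v ∘ f ⁻¹' d.source = D' ∩ f ⁻¹' (D ∩ v ⁻¹' d.source) := by
    ext y
    exact and_congr_right fun hy => (and_iff_right (hfD hy)).symm
  rw [e]
  exact ⟨hf.continuousOn.isOpen_inter_preimage hD' (hv d hd).1,
    (hv d hd).2.comp (hf.mono Set.inter_subset_left) fun y hy => hy.2⟩

/-- A smooth map with local smooth sections is a submersion. -/
theorem IsSmoothMap.isSubmersionMap {f : M → N} (hf : IsSmoothMap 𝒜 ℬ f)
    (hq : ∀ c ∈ 𝒜, ∀ d ∈ ℬ, ∀ x ∈ c.source, f x ∈ d.source → ∃ q : d.E → c.E,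
      DifferentiableAt ℝ q (d.toFun (f x)) ∧ q (d.toFun (f x)) = c.toFun x ∧
      ∀ᶠ z in 𝓝 (d.toFun (f x)), c.pull (fun x => d.toFun (f x)) (q z) = z) :
    IsSubmersionMap 𝒜 ℬ f := by
  refine ⟨hf, fun c hc d hd x hx hfx => ?_⟩
  obtain ⟨q, hqd, hqx, hqz⟩ := hq c hc d hd x hx hfx
  have h1 : DifferentiableAt ℝ (c.pull fun x => d.toFun (f x)) (q (d.toFun (f x))) := by
    rw [hqx]
    exact ((hf c hc d hd).2.contDiffAt ((hf c hc d hd).1.mem_nhds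
      ⟨x, ⟨hx, hfx⟩, rfl⟩)).differentiableAt (by simp)
  have h2 := h1.hasFDerivAt.comp _ hqd.hasFDerivAt
  have h3 := (hasFDerivAt_id (𝕜 := ℝ) (d.toFun (f x))).congr_of_eventuallyEq
    (f₁ := (c.pull fun x => d.toFun (f x)) ∘ q) hqz
  have h4 := h2.unique h3
  rw [hqx] at h4
  -- The derivative of the local section is a continuous right inverse of the tangent map; this
  -- gives surjectivity and the splitting of the kernel at once.
  have h5 : Function.RightInverse (fderiv ℝ q (d.toFun (f x)))
      (fderiv ℝ (c.pull fun x => d.toFun (f x)) (c.toFun x)) :=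
    fun z => congrArg (fun A => A z) h4
  exact ⟨h5.surjective, ContinuousLinearMap.closedComplemented_ker_of_rightInverse _ _ h5⟩

variable [Nonempty M]

/-! ### Inverse charts -/

namespace BanachChart

/-- The inverse of a chart. -/
def inv (c : BanachChart M) : c.E → M := Function.invFunOn c.toFun c.source

theorem inv_mem {c : BanachChart M} {y : c.E} (hy : y ∈ c.toFun '' c.source) :
    c.inv y ∈ c.source :=
  Function.invFunOn_mem hy

theorem toFun_inv {c : BanachChart M} {y : c.E} (hy : y ∈ c.toFun '' c.source) :
    c.toFun (c.inv y) = y :=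
  Function.invFunOn_eq hy

theorem inv_toFun {c : BanachChart M} (hc : Set.InjOn c.toFun c.source) {x : M}
    (hx : x ∈ c.source) : c.inv (c.toFun x) = x :=
  hc (inv_mem ⟨x, hx, rfl⟩) hx (toFun_inv ⟨x, hx, rfl⟩)

theorem pull_eq {c : BanachChart M} (hc : Set.InjOn c.toFun c.source) {F : Type*} [Zero F]
    (f : M → F) {y : c.E} (hy : y ∈ c.toFun '' c.source) : c.pull f y = f (c.inv y) := by
  have h : ∃ x ∈ c.source, c.toFun x = y := hy
  rw [pull, dif_pos h]
  congr 1
  exact hc h.choose_spec.1 (inv_mem hy) (h.choose_spec.2.trans (toFun_inv hy).symm)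

/-- Turns the images in the definition of a manifold into preimages, whose openness follows from
continuity of the inverse chart. -/
theorem image_inter {c : BanachChart M} (hc : Set.InjOn c.toFun c.source) (P : Set M) :
    c.toFun '' (c.source ∩ P) = c.toFun '' c.source ∩ c.inv ⁻¹' P := by
  ext y
  constructor
  · rintro ⟨x, ⟨hx, hxP⟩, rfl⟩
    refine ⟨⟨x, hx, rfl⟩, ?_⟩
    rwa [Set.mem_preimage, inv_toFun hc hx]
  · rintro ⟨hy, hyP⟩
    exact ⟨c.inv y, ⟨inv_mem hy, hyP⟩, toFun_inv hy⟩

end BanachChart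

/-- A smooth atlas, without the Hausdorff condition. -/
structure IsSmoothAtlas (𝒜 : Set (BanachChart M)) : Prop where
  injOn : ∀ c ∈ 𝒜, Set.InjOn c.toFun c.source
  cover : ∀ x : M, ∃ c ∈ 𝒜, x ∈ c.source
  smoothInto_inv : ∀ c ∈ 𝒜, SmoothInto 𝒜 (c.toFun '' c.source) c.inv

theorem IsSmoothAtlas.isOpen_image (h : IsSmoothAtlas 𝒜) {c : BanachChart M} (hc : c ∈ 𝒜) :
    IsOpen (c.toFun '' c.source) := by
  have := (h.smoothInto_inv c hc c hc).1
  rwa [← BanachChart.image_inter (h.injOn c hc), Set.inter_self] at this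

/-- The condition on the right defines a topology in which the generators are open because the
charts are compatible. Conversely, a set satisfying it is a union of generators. -/
theorem IsSmoothAtlas.isOpen_iff (h : IsSmoothAtlas 𝒜) {U : Set M} :
    IsOpen[atlasTopology 𝒜] U ↔ ∀ c ∈ 𝒜, IsOpen (c.toFun '' (c.source ∩ U)) := by
  let τ : TopologicalSpace M :=
    { IsOpen := fun U => ∀ c ∈ 𝒜, IsOpen (c.toFun '' (c.source ∩ U))
      isOpen_univ := fun c hc => by
        rw [Set.inter_univ]
        exact h.isOpen_image hc
      isOpen_inter := fun U V hU hV c hc => by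
        have := (hU c hc).inter (hV c hc)
        rw [BanachChart.image_inter (h.injOn c hc), BanachChart.image_inter (h.injOn c hc)] at this
        rw [BanachChart.image_inter (h.injOn c hc), Set.preimage_inter,
          Set.inter_inter_distrib_left]
        exact this
      isOpen_sUnion := fun s hs c hc => by
        have e : c.toFun '' (c.source ∩ ⋃₀ s) = ⋃ U ∈ s, c.toFun '' (c.source ∩ U) := by
          rw [Set.sUnion_eq_biUnion, Set.inter_iUnion₂, Set.image_iUnion₂]
        rw [e]
        exact isOpen_biUnion fun U hU => hs U hU c hc }
  constructor
  · have hle : τ ≤ atlasTopology 𝒜 := by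
      refine le_generateFrom ?_
      rintro _ ⟨d, hd, O, hO, rfl⟩ c hc
      rw [BanachChart.image_inter (h.injOn c hc)]
      have h1 := h.smoothInto_inv c hc d hd
      have := h1.2.continuousOn.isOpen_inter_preimage h1.1 hO
      rw [Set.preimage_inter, ← Set.inter_assoc]
      exact this
    exact fun hU => hle U hU
  · intro hU
    let _ : TopologicalSpace M := atlasTopology 𝒜
    have e : U = ⋃ c ∈ 𝒜, c.source ∩ c.toFun ⁻¹' (c.toFun '' (c.source ∩ U)) := by
      ext x
      simp only [Set.mem_iUnion]
      constructor
      · intro hx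
        obtain ⟨c, hc, hxc⟩ := h.cover x
        exact ⟨c, hc, hxc, x, ⟨hxc, hx⟩, rfl⟩
      · rintro ⟨c, hc, hxc, y, ⟨hyc, hy⟩, hxy⟩
        rwa [← h.injOn c hc hyc hxc hxy]
    rw [e]
    exact isOpen_biUnion fun c hc =>
      TopologicalSpace.isOpen_generateFrom_of_mem ⟨c, hc, _, hU c hc, rfl⟩

theorem SmoothInto.isOpen_preimage (h : IsSmoothAtlas 𝒜) {D : Set Y} {v : Y → M}
    (hv : SmoothInto 𝒜 D v) {U : Set M} (hU : IsOpen[atlasTopology 𝒜] U) :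
    IsOpen (D ∩ v ⁻¹' U) := by
  have e : D ∩ v ⁻¹' U = ⋃ c ∈ 𝒜, (D ∩ v ⁻¹' c.source) ∩
      (fun y => c.toFun (v y)) ⁻¹' (c.toFun '' (c.source ∩ U)) := by
    ext y
    simp only [Set.mem_iUnion]
    constructor
    · rintro ⟨hy, hyU⟩
      obtain ⟨c, hc, hyc⟩ := h.cover (v y)
      exact ⟨c, hc, ⟨hy, hyc⟩, v y, ⟨hyc, hyU⟩, rfl⟩
    · rintro ⟨c, hc, ⟨hy, hyc⟩, x, ⟨hxc, hx⟩, hxy⟩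
      refine ⟨hy, ?_⟩
      rw [Set.mem_preimage]
      rwa [← h.injOn c hc hxc hyc hxy]
  rw [e]
  exact isOpen_biUnion fun c hc => (hv c hc).2.continuousOn.isOpen_inter_preimage (hv c hc).1
    (h.isOpen_iff.1 hU c hc)

/-- The hypothesis on `f` is in the form of the fields of `LocalSection`, so that sections can be
evaluated along any smooth family of subspaces. -/
theorem SmoothInto.contDiffOn_comp (h : IsSmoothAtlas 𝒜) {D : Set Y} {v : Y → M}
    (hv : SmoothInto 𝒜 D v) {U : Set M} (hU : IsOpen[atlasTopology 𝒜] U)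
    {F : Type*} [NormedAddCommGroup F] [NormedSpace ℝ F] {f : M → F}
    (hf : ∀ c ∈ 𝒜, ContDiffOn ℝ ∞ (c.pull f) (c.toFun '' (c.source ∩ U))) :
    ContDiffOn ℝ ∞ (fun y => f (v y)) (D ∩ v ⁻¹' U) := by
  rintro y ⟨hy, hyU⟩
  obtain ⟨c, hc, hyc⟩ := h.cover (v y)
  have h1 : ContDiffAt ℝ ∞ (fun y => c.toFun (v y)) y :=
    (hv c hc).2.contDiffAt ((hv c hc).1.mem_nhds ⟨hy, hyc⟩)
  have h2 : ContDiffAt ℝ ∞ (c.pull f) (c.toFun (v y)) :=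
    (hf c hc).contDiffAt ((h.isOpen_iff.1 hU c hc).mem_nhds ⟨v y, ⟨hyc, hyU⟩, rfl⟩)
  refine ((h2.comp y h1).congr_of_eventuallyEq ?_).contDiffWithinAt
  filter_upwards [(hv c hc).1.mem_nhds ⟨hy, hyc⟩] with z hz
  rw [Function.comp_apply, BanachChart.pull_eq (h.injOn c hc) f ⟨v z, hz.2, rfl⟩,
    BanachChart.inv_toFun (h.injOn c hc) hz.2]

/-- Points are separated by an injection into a Hausdorff space that is continuous in charts; in the
applications that space consists of bounded operators. -/
theorem IsSmoothAtlas.isBanachManifold (h : IsSmoothAtlas 𝒜) {F : Type*} [TopologicalSpace F]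
    [T2Space F] {f : M → F} (hf : Function.Injective f)
    (hfc : ∀ c ∈ 𝒜, ContinuousOn (fun y => f (c.inv y)) (c.toFun '' c.source)) :
    IsBanachManifold 𝒜 where
  injOn := h.injOn
  cover := h.cover
  isOpen_image c hc d hd := by
    rw [BanachChart.image_inter (h.injOn c hc)]
    exact (h.smoothInto_inv c hc d hd).1
  contDiffOn c hc d hd := by
    rw [BanachChart.image_inter (h.injOn c hc)]
    exact (h.smoothInto_inv c hc d hd).2.congr fun y hy =>
      BanachChart.pull_eq (h.injOn c hc) _ hy.1
  t2 := by
    let _ : TopologicalSpace M := atlasTopology 𝒜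
    refine T2Space.of_injective_continuous hf (continuous_def.2 fun O hO => h.isOpen_iff.2 ?_)
    intro c hc
    rw [BanachChart.image_inter (h.injOn c hc)]
    exact (hfc c hc).isOpen_inter_preimage (h.isOpen_image hc) hO

theorem IsSmoothAtlas.isSmoothMap (h : IsSmoothAtlas 𝒜) {f : M → N}
    (hf : ∀ c ∈ 𝒜, SmoothInto ℬ (c.toFun '' c.source) (fun y => f (c.inv y))) :
    IsSmoothMap 𝒜 ℬ f := by
  intro c hc d hd
  rw [BanachChart.image_inter (h.injOn c hc)]
  exact ⟨(hf c hc d hd).1, (hf c hc d hd).2.congr fun y hy =>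
      BanachChart.pull_eq (h.injOn c hc) _ hy.1⟩

theorem IsSmoothAtlas.continuous (h : IsSmoothAtlas 𝒜) {f : M → N} (hf : IsSmoothMap 𝒜 ℬ f) :
    @Continuous M N (atlasTopology 𝒜) (atlasTopology ℬ) f := by
  let _ : TopologicalSpace M := atlasTopology 𝒜
  refine continuous_generateFrom_iff.2 ?_
  rintro _ ⟨d, hd, O, hO, rfl⟩
  refine h.isOpen_iff.2 fun c hc => ?_
  have h1 := hf c hc d hd
  have := h1.2.continuousOn.isOpen_inter_preimage h1.1 hO
  convert this using 1
  rw [BanachChart.image_inter (h.injOn c hc), BanachChart.image_inter (h.injOn c hc),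
    Set.preimage_inter, Set.preimage_inter, ← Set.inter_assoc]
  ext y
  refine and_congr_right fun hy => ?_
  rw [Set.mem_preimage, Set.mem_preimage, Set.mem_preimage, Set.mem_preimage,
    BanachChart.pull_eq (h.injOn c hc) _ hy.1]

end Manifold
end
end RestrictedGroupoid

namespace RestrictedGroupoid

noncomputable section

/-! ### The charts of the restricted Grassmannian -/

section Grassmannian

variable {H : Type u} [NormedAddCommGroup H] [InnerProductSpace ℂ H] [CompleteSpace H]
  {Hp : Submodule ℂ H} [CompleteSpace Hp]

namespace GrRes

theorem proj_eq (W : GrRes Hp) : W.proj = W.space.starProjection := by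
  obtain ⟨h1, h2⟩ := isStarProjection_iff_eq_starProjection_range.1 W.isStarProjection
  exact h2

theorem ext_space {V W : GrRes Hp} (h : V.space = W.space) : V = W := by
  refine GrRes.ext ?_
  rw [proj_eq, proj_eq]
  congr 1

theorem exists_space_eq {K : Submodule ℂ H} (hK : K ∈ restrictedSubspaces Hp) :
    ∃ V : GrRes Hp, V.space = K := by
  have : CompleteSpace K := completeSpace_coe_iff_isComplete.2 (IsClosed.isComplete hK.1)
  exact ⟨⟨K.starProjection, isStarProjection_starProjection,
    by rwa [Submodule.range_starProjection]⟩, Submodule.range_starProjection K⟩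

/-- `P_W - P₊ = P₋ P_W - ((1 - P_W) P₊)*`. The first term is Hilbert–Schmidt by definition of the
Grassmannian; for the second, the Fredholm condition is needed. -/
theorem isHilbertSchmidt_proj_sub (W : GrRes Hp) :
    IsHilbertSchmidt (W.proj - Hp.starProjection) := by
  obtain ⟨-, hF, hHS⟩ := W.range_mem
  change (Hp.orthogonalProjectionOnto ∘L W.space.subtypeL).IsFredholm at hF
  change IsHilbertSchmidt (Hpᗮ.orthogonalProjectionOnto ∘L W.space.subtypeL) at hHS
  obtain ⟨Q, -, hQ⟩ := hF.exists_isQuasiInverse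
  let T := Hp.orthogonalProjectionOnto ∘L W.space.subtypeL
  have hR : FiniteDimensional ℂ (T ∘L Q - .id ℂ Hp).range := by
    have := LinearMap.FiniteRangeSetoid.equiv_iff_hasFiniteRange.1 hQ
    exact (Submodule.fg_iff_finiteDimensional _).1 (LinearMap.hasFiniteRange_iff_range.1 this)
  let N : Hp →L[ℂ] H := (1 - W.space.starProjection) ∘L Hp.subtypeL
  have h1 : IsHilbertSchmidt (N ∘L T) := by
    -- `1 - P_W` kills `W`, so on `W` it takes opposite values on the `H₊` and `H₋` components.
    have e : N ∘L T = -((1 - W.space.starProjection) ∘L Hpᗮ.subtypeL) ∘L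
        (Hpᗮ.orthogonalProjectionOnto ∘L W.space.subtypeL) := by
      ext x
      have hx : W.space.starProjection (x : H) = x :=
        Submodule.starProjection_eq_self_iff.2 x.2
      have hx' := Hp.starProjection_add_starProjection_orthogonal (x : H)
      change (1 - W.space.starProjection) (Hp.starProjection (x : H)) =
        -((1 - W.space.starProjection) (Hpᗮ.starProjection (x : H)))
      rw [eq_neg_iff_add_eq_zero, ← map_add, hx', sub_apply, hx, one_apply_eq_self, sub_self]
    rw [e]
    exact (hHS.comp_left _).neg
  have h2 : IsHilbertSchmidt N := by
    -- The quasi-inverse `Q` cancels `T` up to finite rank, so `N` inherits the Hilbert–Schmidt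
    -- property of `N ∘L T`.
    have e : N = (N ∘L T) ∘L Q - N ∘L (T ∘L Q - .id ℂ Hp) := by
      ext x
      simp
    rw [e]
    exact (h1.comp_right Q).sub ((isHilbertSchmidt_of_finiteRange hR).comp_left N)
  have h3 : IsHilbertSchmidt ((1 - W.space.starProjection) * Hp.starProjection) :=
    h2.comp_right Hp.orthogonalProjectionOnto
  have h4 : IsHilbertSchmidt (Hpᗮ.starProjection * W.space.starProjection) :=
    (hHS.comp_left Hpᗮ.subtypeL).comp_right W.space.orthogonalProjectionOnto
  have h5 : IsHilbertSchmidt (star ((1 - W.space.starProjection) * Hp.starProjection)) :=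
    h3.adjoint
  have e : W.proj - Hp.starProjection = Hpᗮ.starProjection * W.space.starProjection -
      star ((1 - W.space.starProjection) * Hp.starProjection) := by
    rw [star_mul, star_sub, star_one, isStarProjection_starProjection.isSelfAdjoint.star_eq,
      isStarProjection_starProjection.isSelfAdjoint.star_eq, proj_eq,
      Submodule.starProjection_orthogonal']
    noncomm_ring
  rw [e]
  exact h4.sub h5

theorem isHilbertSchmidt_proj_sub_proj (V W : GrRes Hp) :
    IsHilbertSchmidt (V.proj - W.proj) := by
  have := V.isHilbertSchmidt_proj_sub.sub W.isHilbertSchmidt_proj_sub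
  rwa [sub_sub_sub_cancel_right] at this

/-- On `V`, the projection to the complement of `W` factors through `P_V - P_W`, because it
annihilates `P_W`. -/
theorem isHilbertSchmidt_restrict (W V : GrRes Hp) :
    IsHilbertSchmidt (W.spaceᗮ.orthogonalProjectionOnto ∘L V.space.subtypeL) := by
  have e : W.spaceᗮ.orthogonalProjectionOnto ∘L V.space.subtypeL =
      W.spaceᗮ.orthogonalProjectionOnto ∘L (V.proj - W.proj) ∘L V.space.subtypeL := by
    ext x
    have hx : V.space.starProjection (x : H) = x :=
      Submodule.starProjection_eq_self_iff.2 x.2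
    have hy : W.spaceᗮ.orthogonalProjectionOnto (W.space.starProjection (x : H)) = 0 :=
      Submodule.orthogonalProjectionOnto_orthogonal_apply_eq_zero
        (Submodule.starProjection_apply_mem _ _)
    simp [proj_eq, hx, hy]
  rw [e]
  exact ((V.isHilbertSchmidt_proj_sub_proj W).comp_right _).comp_left _

/-- The map `w ↦ w + A w`, whose range is the graph of `A`. -/
def graphMap (W : GrRes Hp) (A : W.space →L[ℂ] W.spaceᗮ) : W.space →L[ℂ] H :=
  W.space.subtypeL + W.spaceᗮ.subtypeL ∘L A

theorem proj_graphMap (W : GrRes Hp) (A : W.space →L[ℂ] W.spaceᗮ) :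
    W.space.orthogonalProjectionOnto ∘L W.graphMap A = .id ℂ _ := by
  ext x
  have h := Submodule.starProjection_apply_eq_zero_iff W.space |>.2 (A x).2
  simp [graphMap, h]

theorem proj_orthogonal_graphMap (W : GrRes Hp) (A : W.space →L[ℂ] W.spaceᗮ) :
    W.spaceᗮ.orthogonalProjectionOnto ∘L W.graphMap A = A := by
  ext x
  simp [graphMap, Submodule.orthogonalProjectionOnto_orthogonal_apply_eq_zero x.2]

theorem eq_graphMap {W : GrRes Hp} {γ : W.space →L[ℂ] H}
    (h : W.space.orthogonalProjectionOnto ∘L γ = .id ℂ _) :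
    γ = W.graphMap (W.spaceᗮ.orthogonalProjectionOnto ∘L γ) := by
  ext x
  have h1 := W.space.starProjection_add_starProjection_orthogonal (γ x)
  have h2 := congrArg (fun A => A x) h
  simp only [ContinuousLinearMap.comp_apply, ContinuousLinearMap.id_apply] at h2
  simp only [Submodule.starProjection_apply, h2] at h1
  exact h1.symm

/-- The identification of `W` with the graph of an operator. -/
theorem exists_equiv {W V : GrRes Hp} {A : W.space →L[ℂ] W.spaceᗮ}
    (h : V.space = (W.graphMap A).range) :
    ∃ e : W.space ≃L[ℂ] V.space, V.space.subtypeL ∘L (e : W.space →L[ℂ] V.space) = W.graphMap A ∧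
      (e.symm : V.space →L[ℂ] W.space) = W.projRestrict V := by
  let f : W.space →L[ℂ] V.space := (W.graphMap A).codRestrict V.space fun x => by
    rw [h]
    exact ⟨x, rfl⟩
  have hf : ∀ x, W.space.orthogonalProjectionOnto (W.graphMap A x) = x := fun x =>
    congrArg (fun B => B x) (W.proj_graphMap A)
  have h1 : W.projRestrict V ∘L f = .id ℂ _ := by
    ext x
    exact congrArg Subtype.val (hf x)
  have h2 : f ∘L W.projRestrict V = .id ℂ _ := by
    ext ⟨x, hx⟩
    have hx' := hx
    rw [h] at hx'
    obtain ⟨y, rfl⟩ := hx'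
    exact congrArg (W.graphMap A) (hf y)
  exact ⟨ContinuousLinearEquiv.equivOfInverse' f (W.projRestrict V) h2 h1, rfl, rfl⟩

/-- The inverse of `P_W|_V`, viewed as a map into `H`, is a section of `P_W`, hence the graph map of
its component in the complement of `W`. -/
theorem space_eq_of_mem_source {W V : GrRes Hp} (hV : V ∈ W.chart.source) :
    V.space = (W.graphMap (HS.toCLM (W.coord V))).range := by
  obtain ⟨e, he⟩ := hV
  have hHS : IsHilbertSchmidt (W.spaceᗮ.orthogonalProjectionOnto ∘L V.space.subtypeL ∘L
      (W.projRestrict V).inverse) :=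
    (W.isHilbertSchmidt_restrict V).comp_right (W.projRestrict V).inverse
  have hγ : W.space.orthogonalProjectionOnto ∘L (V.space.subtypeL ∘L (W.projRestrict V).inverse) =
      .id ℂ _ := by
    change W.projRestrict V ∘L (W.projRestrict V).inverse = _
    rw [← he]
    ext x
    simp
  rw [coord, HS.toCLM_ofCLM hHS, ← eq_graphMap hγ, ← he, ContinuousLinearMap.inverse_equiv]
  ext x
  constructor
  · intro hx
    exact ⟨e ⟨x, hx⟩, by simp⟩
  · rintro ⟨y, rfl⟩
    exact (e.symm y).2

theorem mem_source_of_space_eq {W V : GrRes Hp} {A : W.space →L[ℂ] W.spaceᗮ}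
    (h : V.space = (W.graphMap A).range) : V ∈ W.chart.source := by
  obtain ⟨e, -, he⟩ := exists_equiv h
  exact ⟨e.symm, he⟩

theorem coord_of_space_eq {W V : GrRes Hp} {A : HS W.space W.spaceᗮ}
    (h : V.space = (W.graphMap (HS.toCLM A)).range) : W.coord V = A := by
  obtain ⟨e, he, he'⟩ := exists_equiv h
  rw [coord, ← he', ContinuousLinearMap.inverse_equiv, ContinuousLinearEquiv.symm_symm, he,
    proj_orthogonal_graphMap, HS.ofCLM_toCLM]

theorem injOn_coord (W : GrRes Hp) : Set.InjOn W.coord W.chart.source := fun V hV V' hV' h =>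
  ext_space (by rw [space_eq_of_mem_source hV, space_eq_of_mem_source hV', h])

/-- The graph map identifies `W` with the graph, with inverse `P_W`. Transported to `W`, the two
projections of the graph differ from those of `W` by Hilbert–Schmidt operators, so both conditions
persist. -/
theorem exists_space_eq_graph (W : GrRes Hp) (A : HS W.space W.spaceᗮ) :
    ∃ V : GrRes Hp, V.space = (W.graphMap (HS.toCLM A)).range := by
  refine exists_space_eq ?_
  set γ := W.graphMap (HS.toCLM A) with hγ
  have hl : ∀ x, W.space.orthogonalProjectionOnto (γ x) = x := fun x =>
    congrArg (fun B => B x) (W.proj_graphMap _)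
  have hr : ∀ x : γ.range, γ (W.space.orthogonalProjectionOnto (x : H)) = x := by
    rintro ⟨_, y, rfl⟩
    exact congrArg γ (hl y)
  let e : γ.range ≃L[ℂ] W.space := ContinuousLinearEquiv.equivOfInverse'
    (W.space.orthogonalProjectionOnto ∘L γ.range.subtypeL)
    (γ.codRestrict γ.range fun x => ⟨x, rfl⟩)
    (by ext x; exact congrArg Subtype.val (hl x))
    (by ext x; exact hr x)
  have he : γ.range.subtypeL = γ ∘L (e : γ.range →L[ℂ] W.space) := by
    ext x
    exact (hr x).symm
  refine ⟨?_, ?_, ?_⟩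
  -- The graph is the fixed-point set of a continuous map.
  · have hc : IsClosed {x : H | γ (W.space.orthogonalProjectionOnto x) = x} :=
      isClosed_eq (by fun_prop) continuous_id
    convert hc
    ext x
    exact ⟨fun hx => hr ⟨x, hx⟩, fun hx => ⟨_, hx⟩⟩
  · rw [he, ← ContinuousLinearMap.comp_assoc]
    refine IsFredholm.comp_equiv ?_ e
    rw [hγ, graphMap, ContinuousLinearMap.comp_add]
    exact IsFredholm.add_isHilbertSchmidt W.range_mem.2.1
      ((A.isHilbertSchmidt.comp_left _).comp_left _)
  · have : CompleteSpace γ.range := 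
      e.isUniformEmbedding.isUniformInducing.completeSpace_congr e.surjective |>.2 inferInstance
    rw [he, ← ContinuousLinearMap.comp_assoc]
    refine IsHilbertSchmidt.comp_right ?_ _
    rw [hγ, graphMap, ContinuousLinearMap.comp_add]
    exact IsHilbertSchmidt.add W.range_mem.2.2 ((A.isHilbertSchmidt.comp_left _).comp_left _)

theorem image_coord (W : GrRes Hp) : W.coord '' W.chart.source = Set.univ := by
  refine Set.eq_univ_of_forall fun A => ?_
  obtain ⟨V, hV⟩ := W.exists_space_eq_graph A
  exact ⟨V, mem_source_of_space_eq hV, coord_of_space_eq hV⟩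

theorem graphMap_zero (W : GrRes Hp) : (W.graphMap 0).range = W.space := by
  rw [graphMap, ContinuousLinearMap.comp_zero, add_zero]
  exact Submodule.range_subtype W.space

theorem self_mem_source (W : GrRes Hp) : W ∈ W.chart.source :=
  mem_source_of_space_eq W.graphMap_zero.symm

theorem coord_self (W : GrRes Hp) : W.coord W = 0 :=
  coord_of_space_eq (by rw [map_zero, graphMap_zero])

/-- The base point is `H₊`; nonemptiness is needed by `Function.invFunOn` in the definition of
inverse charts. -/
instance : Nonempty (GrRes Hp) := by
  have h : Hp ∈ restrictedSubspaces Hp := by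
    refine ⟨(completeSpace_coe_iff_isComplete.1 inferInstance).isClosed, ?_, ?_⟩
    · have : Hp.orthogonalProjectionOnto ∘L Hp.subtypeL = .id ℂ Hp := by
        ext x; simp
      rw [this]
      exact isFredholm_id
    · have : Hpᗮ.orthogonalProjectionOnto ∘L Hp.subtypeL = 0 := by
        ext x
        simp [Submodule.orthogonalProjectionOnto_orthogonal_apply_eq_zero x.2]
      rw [this]
      exact isHilbertSchmidt_zero
  obtain ⟨V, -⟩ := exists_space_eq h
  exact ⟨V⟩

theorem space_inv (W : GrRes Hp) (A : HS W.space W.spaceᗮ) :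
    (W.chart.inv A).space = (W.graphMap (HS.toCLM A)).range := by
  have hA : A ∈ W.chart.toFun '' W.chart.source := W.image_coord ▸ Set.mem_univ A
  have h := space_eq_of_mem_source (BanachChart.inv_mem hA)
  rw [h]
  congr 3
  exact congrArg HS.toCLM (BanachChart.toFun_inv hA)

/-- `P_{W'}` restricted to the graph of `A`, in terms of `A`. -/
theorem inv_mem_source_iff (W W' : GrRes Hp) (A : HS W.space W.spaceᗮ) :
    W.chart.inv A ∈ W'.chart.source ↔
      (W'.space.orthogonalProjectionOnto ∘L W.graphMap (HS.toCLM A)).IsInvertible := by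
  obtain ⟨e, he, -⟩ := exists_equiv (W.space_inv A)
  rw [← he, ← ContinuousLinearMap.comp_assoc]
  exact ContinuousLinearMap.isInvertible_comp_equiv.symm

/-- The fractional linear transition map `(c + dA)(a + bA)⁻¹`. The numerator is an affine map into
`L²` and only the denominator is a bounded operator, which shows smoothness for the Hilbert–Schmidt
norm. -/
theorem coord_eq_of_space_eq {W V : GrRes Hp} (W' : GrRes Hp) {A : HS W.space W.spaceᗮ}
    (h : V.space = (W.graphMap (HS.toCLM A)).range) :
    W'.coord V = HS.compRight _ _ _
      (HS.ofCLM (W'.spaceᗮ.orthogonalProjectionOnto ∘L W.space.subtypeL) +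
        HS.compLeft _ _ _ (W'.spaceᗮ.orthogonalProjectionOnto ∘L W.spaceᗮ.subtypeL) A)
      (W'.space.orthogonalProjectionOnto ∘L W.graphMap (HS.toCLM A)).inverse := by
  obtain ⟨e, he, -⟩ := exists_equiv h
  have h1 : (W'.projRestrict V).inverse = (e : W.space →L[ℂ] _) ∘L
      (W'.space.orthogonalProjectionOnto ∘L W.graphMap (HS.toCLM A)).inverse := by
    rw [← he, ← ContinuousLinearMap.comp_assoc, ContinuousLinearMap.inverse_comp_equiv]
    ext x
    simp [projRestrict]
  apply HS.toCLM_injective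
  have h2 : IsHilbertSchmidt (W'.spaceᗮ.orthogonalProjectionOnto ∘L V.space.subtypeL ∘L
      (W'.projRestrict V).inverse) :=
    (W'.isHilbertSchmidt_restrict V).comp_right (W'.projRestrict V).inverse
  rw [coord, HS.toCLM_ofCLM h2, HS.toCLM_compRight, map_add,
    HS.toCLM_ofCLM (W'.isHilbertSchmidt_restrict W), HS.toCLM_compLeft, h1,
    ContinuousLinearMap.comp_assoc, ← ContinuousLinearMap.comp_add,
    ← ContinuousLinearMap.comp_assoc V.space.subtypeL, he]
  rfl

theorem smoothInto_inv (W : GrRes Hp) : SmoothInto (grAtlas Hp) Set.univ W.chart.inv := by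
  rintro _ ⟨W', rfl⟩
  let f : HS W.space W.spaceᗮ → (W.space →L[ℂ] W'.space) := fun A =>
    W'.space.orthogonalProjectionOnto ∘L W.graphMap (HS.toCLM A)
  have hc : ContDiff ℝ ∞ f := contDiff_iff_contDiffAt.2 fun A =>
    contDiffAt_comp contDiffAt_const
      (contDiffAt_const.add (contDiffAt_comp contDiffAt_const HS.contDiff_toCLM.contDiffAt))
  have e : Set.univ ∩ W.chart.inv ⁻¹' W'.chart.source = f ⁻¹' {T | T.IsInvertible} := by
    ext A
    rw [Set.univ_inter]
    exact W.inv_mem_source_iff W' A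
  rw [e]
  refine ⟨ContinuousLinearEquiv.isOpen.preimage hc.continuous, fun A hA => ?_⟩
  have h1 : ContDiffAt ℝ ∞ (fun A => (f A).inverse) A :=
    (ContinuousLinearMap.IsInvertible.contDiffAt_map_inverse hA |>.restrict_scalars ℝ).comp A
      hc.contDiffAt
  have h2 : ContDiffAt ℝ ∞ (fun A : HS W.space W.spaceᗮ => HS.compRight _ _ _
      (HS.ofCLM (W'.spaceᗮ.orthogonalProjectionOnto ∘L W.space.subtypeL) +
        HS.compLeft _ _ _ (W'.spaceᗮ.orthogonalProjectionOnto ∘L W.spaceᗮ.subtypeL) A)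
      (f A).inverse) A :=
    HS.contDiffAt_compRight
      (contDiffAt_const.add (HS.contDiffAt_compLeft contDiffAt_const contDiffAt_id)) h1
  exact (h2.congr_of_eventuallyEq (Filter.Eventually.of_forall fun A =>
    coord_eq_of_space_eq W' (W.space_inv A))).contDiffWithinAt

end GrRes

theorem isSmoothAtlas_grAtlas : IsSmoothAtlas (grAtlas Hp) where
  injOn := by
    rintro _ ⟨W, rfl⟩
    exact W.injOn_coord
  cover W := ⟨W.chart, ⟨W, rfl⟩, W.self_mem_source⟩
  smoothInto_inv := by
    rintro _ ⟨W, rfl⟩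
    have h : W.chart.toFun '' W.chart.source = Set.univ := W.image_coord
    rw [h]
    exact W.smoothInto_inv

end Grassmannian
end
end RestrictedGroupoid

namespace RestrictedGroupoid

noncomputable section

/-! ### The Cayley transform and charts of the unitary group -/

section Cayley

variable {R : Type*} [Ring R]

/-- The Cayley transform of a skew-adjoint element is unitary. -/
theorem cayley_mem_unitary [StarRing R] {x : R} (hx : star x = -x)
    (hu : IsUnit (1 - x)) : (1 + x) * Ring.inverse (1 - x) ∈ unitary R := by
  have hs : star (1 - x) = 1 + x := by rw [star_sub, star_one, hx, sub_neg_eq_add]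
  have hs' : star (1 + x) = 1 - x := by rw [star_add, star_one, hx, ← sub_eq_add_neg]
  have hu' : IsUnit (1 + x) := hs ▸ hu.star
  have hstar : star ((1 + x) * Ring.inverse (1 - x)) = Ring.inverse (1 + x) * (1 - x) := by
    rw [star_mul, ← Ring.inverse_star, hs, hs']
  have hcomm : (1 - x) * (1 + x) = (1 + x) * (1 - x) := by noncomm_ring
  have hcomm' : Ring.inverse (1 - x) * Ring.inverse (1 + x) =
      Ring.inverse (1 + x) * Ring.inverse (1 - x) :=
    Commute.ringInverse_ringInverse hcomm
  constructor
  · rw [hstar, mul_assoc, ← mul_assoc (1 - x), hcomm, mul_assoc, Ring.mul_inverse_cancel _ hu,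
      mul_one, Ring.inverse_mul_cancel _ hu']
  · rw [hstar, mul_assoc, ← mul_assoc (Ring.inverse (1 - x)), hcomm', mul_assoc,
      Ring.inverse_mul_cancel _ hu, mul_one, Ring.mul_inverse_cancel _ hu']

/-- The inverse Cayley transform `(m - 1)(m + 1)⁻¹`, written with a single inverse `a = (m + 1)⁻¹`;
skewness amounts to `a + a* = 1`. -/
theorem star_one_sub_two_mul_inverse [StarRing R] {m : R} (hm : m ∈ unitary R)
    (hu : IsUnit (m + 1)) :
    star (1 - 2 * Ring.inverse (m + 1)) = -(1 - 2 * Ring.inverse (m + 1)) := by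
  set a := Ring.inverse (m + 1) with ha
  have h1 : (m + 1) * a = 1 := Ring.mul_inverse_cancel _ hu
  have h1' : star a * star (m + 1) = 1 := by rw [← star_mul, h1, star_one]
  have h2 : a + star a = 1 := by
    -- Multiplied by `m + 1` on the left and its adjoint on the right, both sides become `m + m* +
    -- 2`, as `m m* = 1`.
    refine hu.mul_left_cancel (hu.star.mul_right_cancel ?_)
    rw [mul_add, h1, add_mul, mul_assoc, h1', mul_one, one_mul, star_add, star_one,
      mul_add, add_mul, mul_one, hm.2]
    noncomm_ring
  have h3 : star a = 1 - a := eq_sub_of_add_eq' h2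
  rw [star_sub, star_one, star_mul, h3, star_ofNat]
  noncomm_ring

theorem cayley_one_sub_two_mul_inverse (h2 : IsUnit (2 : R)) {m : R} (hu : IsUnit (m + 1)) :
    (1 + (1 - 2 * Ring.inverse (m + 1))) *
      Ring.inverse (1 - (1 - 2 * Ring.inverse (m + 1))) = m := by
  rw [sub_sub_cancel]
  set a := Ring.inverse (m + 1) with ha
  have h2 : IsUnit (2 * a) := h2.mul hu.ringInverse
  refine h2.mul_right_cancel ?_
  rw [mul_assoc, Ring.inverse_mul_cancel _ h2, mul_one]
  have h3 : (m + 1) * a = 1 := Ring.mul_inverse_cancel _ hu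
  have h4 : m * a = 1 - a := by rw [eq_sub_iff_add_eq, ← h3, add_mul, one_mul]
  have h5 : m * (2 * a) = 2 * (m * a) := by noncomm_ring
  rw [h5, h4]
  noncomm_ring

theorem cayley_add_one {x : R} (hu : IsUnit (1 - x)) :
    (1 + x) * Ring.inverse (1 - x) + 1 = 2 * Ring.inverse (1 - x) := by
  have h : (1 + x) * Ring.inverse (1 - x) + (1 - x) * Ring.inverse (1 - x) =
      2 * Ring.inverse (1 - x) := by
    rw [← add_mul, add_add_sub_cancel, one_add_one_eq_two]
  rwa [Ring.mul_inverse_cancel _ hu] at h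

theorem isUnit_cayley_add_one (h2 : IsUnit (2 : R)) {x : R} (hu : IsUnit (1 - x)) :
    IsUnit ((1 + x) * Ring.inverse (1 - x) + 1) := by
  rw [cayley_add_one hu]
  exact h2.mul hu.ringInverse

theorem one_sub_two_mul_inverse_cayley (h2 : IsUnit (2 : R)) {x : R} (hu : IsUnit (1 - x)) :
    1 - 2 * Ring.inverse ((1 + x) * Ring.inverse (1 - x) + 1) = x := by
  have hm := isUnit_cayley_add_one h2 hu
  have h : 2 * Ring.inverse ((1 + x) * Ring.inverse (1 - x) + 1) = 1 - x := by
    refine hm.mul_right_cancel ?_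
    rw [mul_assoc, Ring.inverse_mul_cancel _ hm, cayley_add_one hu]
    have e : (1 - x) * (2 * Ring.inverse (1 - x)) =
        2 * ((1 - x) * Ring.inverse (1 - x)) := by noncomm_ring
    rw [e, Ring.mul_inverse_cancel _ hu]
  rw [h, sub_sub_cancel]

variable {K : Type u} [NormedAddCommGroup K] [InnerProductSpace ℂ K]

theorem isUnit_two : IsUnit (2 : K →L[ℂ] K) := by
  have h : IsUnit (algebraMap ℂ (K →L[ℂ] K) 2) :=
    (IsUnit.mk0 (2 : ℂ) two_ne_zero).map (algebraMap ℂ (K →L[ℂ] K))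
  rwa [map_ofNat] at h

variable [CompleteSpace K]

variable (K) in
/-- The inclusion of the skew-adjoint operators. -/
def SkewOp.incl : SkewOp K →L[ℝ] (K →L[ℂ] K) :=
  (skewAdjoint.submodule ℝ (K →L[ℂ] K)).subtypeL

theorem SkewOp.star_incl (X : SkewOp K) : star (SkewOp.incl K X) = -SkewOp.incl K X := X.2

theorem SkewOp.incl_injective : Function.Injective (SkewOp.incl K) := Subtype.val_injective

variable (K) in
/-- The skew-adjoint part `(T - T*) / 2` of an operator. -/
def SkewOp.part : (K →L[ℂ] K) →L[ℝ] SkewOp K :=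
  ContinuousLinearMap.codRestrict
    ((2⁻¹ : ℝ) • (ContinuousLinearMap.id ℝ (K →L[ℂ] K) -
      ((starL' ℝ : (K →L[ℂ] K) ≃L[ℝ] (K →L[ℂ] K)) : (K →L[ℂ] K) →L[ℝ] (K →L[ℂ] K))))
    (skewAdjoint.submodule ℝ (K →L[ℂ] K)) fun T => by
      change star ((2⁻¹ : ℝ) • (T - star T)) = -((2⁻¹ : ℝ) • (T - star T))
      rw [star_smul, star_sub, star_star, ← smul_neg, neg_sub, star_trivial]

theorem SkewOp.incl_part {T : K →L[ℂ] K} (hT : star T = -T) :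
    SkewOp.incl K (SkewOp.part K T) = T := by
  change (2⁻¹ : ℝ) • (T - star T) = T
  rw [hT, sub_neg_eq_add, ← two_smul ℝ T, smul_smul]
  norm_num

/-- There is a chart of the unitary group around each point, given by the Cayley transform. -/
theorem exists_unitaryChart {k : K →L[ℂ] K} (hk : k ∈ unitary (K →L[ℂ] K)) :
    ∃ a : UnitaryChart K, k ∈ a.source := by
  -- Translation by `k*` moves the base point to `1`, where `1 + 1 = 2` is invertible.
  let O : Set (K →L[ℂ] K) := {l | IsUnit (star k * l + 1)}
  let S : Set (K →L[ℂ] K) := O ∩ unitary (K →L[ℂ] K)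
  -- Taking the skew part makes the formula meaningful for every operator and does not change it on
  -- `S`, so `ψ` serves as its own smooth extension.
  let ψ : (K →L[ℂ] K) → SkewOp K := fun l =>
    SkewOp.part K (1 - 2 * Ring.inverse (star k * l + 1))
  let χ : SkewOp K → (K →L[ℂ] K) := fun X =>
    k * ((1 + SkewOp.incl K X) * Ring.inverse (1 - SkewOp.incl K X))
  have hkm : ∀ {l}, l ∈ unitary (K →L[ℂ] K) → star k * l ∈ unitary (K →L[ℂ] K) := fun hl =>
    mul_mem (Unitary.star_mem hk) hl
  have hpart : ∀ l ∈ S, SkewOp.incl K (ψ l) = 1 - 2 * Ring.inverse (star k * l + 1) :=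
    fun l hl => SkewOp.incl_part (star_one_sub_two_mul_inverse (hkm hl.2) hl.1)
  have hleft : ∀ l ∈ S, χ (ψ l) = l := fun l hl => by
    change k * ((1 + SkewOp.incl K (ψ l)) * Ring.inverse (1 - SkewOp.incl K (ψ l))) = l
    rw [hpart l hl, cayley_one_sub_two_mul_inverse isUnit_two hl.1, ← mul_assoc, hk.2, one_mul]
  have hχS : ∀ X, IsUnit (1 - SkewOp.incl K X) → χ X ∈ S := fun X hX => by
    refine ⟨?_, mul_mem hk (cayley_mem_unitary X.star_incl hX)⟩
    change IsUnit (star k * (k * _) + 1)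
    rw [← mul_assoc, hk.1, one_mul]
    exact isUnit_cayley_add_one isUnit_two hX
  have hright : ∀ X, IsUnit (1 - SkewOp.incl K X) → ψ (χ X) = X := fun X hX => by
    apply SkewOp.incl_injective
    rw [hpart _ (hχS X hX), ← mul_assoc, hk.1, one_mul,
      one_sub_two_mul_inverse_cayley isUnit_two hX]
  have himage : ψ '' S = {X | IsUnit (1 - SkewOp.incl K X)} := by
    ext X
    constructor
    · rintro ⟨l, hl, rfl⟩
      rw [Set.mem_ofPred_eq, hpart l hl, sub_sub_cancel]
      exact isUnit_two.mul hl.1.ringInverse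
    · exact fun hX => ⟨χ X, hχS X hX, hright X hX⟩
  have hinj : Set.InjOn ψ S := fun l hl l' hl' h => by
    rw [← hleft l hl, h, hleft l' hl']
  refine ⟨⟨S, ψ, ⟨O, Units.isOpen.preimage (by fun_prop), rfl⟩, hinj, ?_, ?_, ?_⟩, ?_⟩
  · rw [himage]
    exact Units.isOpen.preimage (by fun_prop)
  · intro l hl
    refine ⟨ψ, ?_, Filter.Eventually.of_forall fun _ => rfl⟩
    have h1 : ContDiffAt ℝ ∞ (fun l => Ring.inverse (star k * l + 1)) l :=
      contDiffAt_ringInverse_comp ((contDiffAt_const.mul contDiffAt_id).add contDiffAt_const) hl.1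
    exact (ContinuousLinearMap.contDiff (𝕜 := ℝ) (SkewOp.part K)).contDiffAt.comp l
      (contDiffAt_const.sub (contDiffAt_const.mul h1))
  · rw [himage]
    intro X hX
    have h0 : ContDiffAt ℝ ∞ (fun X => SkewOp.incl K X) X :=
      (ContinuousLinearMap.contDiff (𝕜 := ℝ) (SkewOp.incl K)).contDiffAt
    have h1 : ContDiffAt ℝ ∞ χ X := contDiffAt_const.mul ((contDiffAt_const.add h0).mul
      (contDiffAt_ringInverse_comp (contDiffAt_const.sub h0) hX))
    refine h1.contDiffWithinAt.congr_of_mem (fun Z hZ => ?_) hX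
    have hZ' : Z ∈ ψ '' S := himage ▸ hZ
    exact hinj (Function.invFunOn_mem hZ') (hχS Z hZ)
      ((Function.invFunOn_eq hZ').trans (hright Z hZ).symm)
  · refine ⟨?_, hk⟩
    change IsUnit (star k * k + 1)
    rw [hk.1, one_add_one_eq_two]
    exact isUnit_two

end Cayley
end
end RestrictedGroupoid

namespace RestrictedGroupoid

noncomputable section

/-! ### Local cross sections -/

section Sections

variable {H : Type u} [NormedAddCommGroup H] [InnerProductSpace ℂ H] [CompleteSpace H]
  {Hp : Submodule ℂ H} [CompleteSpace Hp]

/-! ### Transitivity of the restricted unitary group -/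

namespace GrRes

/-- If `P_W` had finite rank, then `P₊`, and so the identity of `H₊`, would be Hilbert–Schmidt. -/
theorem not_finiteDimensional_space (hplus : ¬ FiniteDimensional ℂ Hp) (W : GrRes Hp) :
    ¬ FiniteDimensional ℂ W.space := by
  intro hW
  refine hplus (finiteDimensional_of_isHilbertSchmidt_id ?_)
  have h1 : IsHilbertSchmidt W.proj := isHilbertSchmidt_of_finiteRange hW
  have h2 := h1.sub W.isHilbertSchmidt_proj_sub
  rw [sub_sub_cancel] at h2
  convert (h2.comp_right Hp.subtypeL).comp_left Hp.orthogonalProjectionOnto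
  ext x
  simp

theorem not_finiteDimensional_orthogonal (hminus : ¬ FiniteDimensional ℂ Hpᗮ) (W : GrRes Hp) :
    ¬ FiniteDimensional ℂ W.spaceᗮ := by
  intro hW
  refine hminus (finiteDimensional_of_isHilbertSchmidt_id ?_)
  have h1 : IsHilbertSchmidt W.spaceᗮ.starProjection :=
    isHilbertSchmidt_of_finiteRange (by rwa [Submodule.range_starProjection])
  have h2 : IsHilbertSchmidt Hpᗮ.starProjection := by
    have e : Hpᗮ.starProjection = W.spaceᗮ.starProjection + (W.proj - Hp.starProjection) := by
      rw [proj_eq, Submodule.starProjection_orthogonal', Submodule.starProjection_orthogonal']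
      abel
    rw [e]
    exact h1.add W.isHilbertSchmidt_proj_sub
  convert (h2.comp_right Hpᗮ.subtypeL).comp_left Hpᗮ.orthogonalProjectionOnto
  ext x
  simp

/-- The restricted unitary group acts transitively on the restricted Grassmannian. -/
theorem exists_mem_unitaryRes [TopologicalSpace.SeparableSpace H]
    (hplus : ¬ FiniteDimensional ℂ Hp) (hminus : ¬ FiniteDimensional ℂ Hpᗮ) (W : GrRes Hp) :
    ∃ g ∈ unitaryRes Hp, Hp.map g.toLinearMap = W.space := by
  have : SecondCountableTopology H := UniformSpace.secondCountable_of_separable H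
  obtain ⟨U⟩ := nonempty_linearIsometryEquiv hplus (W.not_finiteDimensional_space hplus)
  obtain ⟨U'⟩ := nonempty_linearIsometryEquiv hminus (W.not_finiteDimensional_orthogonal hminus)
  -- `g` is the direct sum of isometries `H₊ → W` and `H₋ → W^⊥`, and `g'` is its inverse and
  -- adjoint.
  let g : H →L[ℂ] H :=
    W.space.subtypeL ∘L (U : Hp →L[ℂ] W.space) ∘L Hp.orthogonalProjectionOnto +
    W.spaceᗮ.subtypeL ∘L (U' : Hpᗮ →L[ℂ] W.spaceᗮ) ∘L Hpᗮ.orthogonalProjectionOnto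
  let g' : H →L[ℂ] H :=
    Hp.subtypeL ∘L (U.symm : W.space →L[ℂ] Hp) ∘L W.space.orthogonalProjectionOnto +
    Hpᗮ.subtypeL ∘L (U'.symm : W.spaceᗮ →L[ℂ] Hpᗮ) ∘L W.spaceᗮ.orthogonalProjectionOnto
  have hg : ∀ x, g x = U (Hp.orthogonalProjectionOnto x) +
    U' (Hpᗮ.orthogonalProjectionOnto x) := fun x => rfl
  have hg' : ∀ x, g' x = U.symm (W.space.orthogonalProjectionOnto x) +
    U'.symm (W.spaceᗮ.orthogonalProjectionOnto x) := fun x => rfl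
  have hstar : star g = g' := by
    rw [ContinuousLinearMap.star_eq_adjoint, map_add]
    simp only [ContinuousLinearMap.adjoint_comp, Submodule.adjoint_subtypeL,
      Submodule.adjoint_orthogonalProjectionOnto, LinearIsometryEquiv.adjoint_eq_symm]
    rfl
  have hproj : ∀ (L : Submodule ℂ H) [CompleteSpace L] (x : L) (y : Lᗮ),
      L.orthogonalProjectionOnto ((x : H) + y) = x ∧
      Lᗮ.orthogonalProjectionOnto ((x : H) + y) = y := fun L _ x y => by
    have h1 : L.orthogonalProjectionOnto (y : H) = 0 :=
      Submodule.orthogonalProjectionOnto_apply_of_mem_orthogonal y.2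
    have h2 : Lᗮ.orthogonalProjectionOnto (x : H) = 0 :=
      Submodule.orthogonalProjectionOnto_orthogonal_apply_eq_zero x.2
    constructor
    · rw [map_add, h1, Submodule.orthogonalProjectionOnto_mem_subspace_eq_self, add_zero]
    · rw [map_add, h2, Submodule.orthogonalProjectionOnto_mem_subspace_eq_self, zero_add]
  have hsplit : ∀ (L : Submodule ℂ H) [CompleteSpace L] (x : H),
      (L.orthogonalProjectionOnto x : H) + Lᗮ.orthogonalProjectionOnto x = x := fun L _ x =>
    L.starProjection_add_starProjection_orthogonal x
  have hu : g ∈ unitary (H →L[ℂ] H) := by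
    constructor
    · rw [hstar]
      ext x
      change g' (g x) = x
      rw [hg, hg', (hproj W.space _ _).1, (hproj W.space _ _).2, U.symm_apply_apply,
        U'.symm_apply_apply, hsplit]
    · rw [hstar]
      ext x
      change g (g' x) = x
      rw [hg, hg', (hproj Hp _ _).1, (hproj Hp _ _).2, U.apply_symm_apply,
        U'.apply_symm_apply, hsplit]
  have hgp : ∀ x : Hp, g x = U x := fun x => by
    have h := hproj Hp x 0
    rw [Submodule.coe_zero, add_zero] at h
    rw [hg, h.1, h.2, map_zero, Submodule.coe_zero, add_zero]
  refine ⟨g, ⟨hu, ?_⟩, ?_⟩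
  -- Any unitary `g` with `g P₊ = P_W g` has this commutator, so membership in `U_res` needs no
  -- condition on the two isometries.
  · have e : commPlus Hp g = (W.proj - Hp.starProjection) ∘L g := by
      have : g * Hp.starProjection = W.proj * g := by
        ext x
        change g (Hp.orthogonalProjectionOnto x) = W.proj (g x)
        rw [hgp, proj_eq, Submodule.starProjection_apply, hg, (hproj W.space _ _).1]
      rw [commPlus, this, ← sub_mul]
      rfl
    rw [e]
    exact W.isHilbertSchmidt_proj_sub.comp_right g
  · ext x
    constructor
    · rintro ⟨y, hy, rfl⟩
      have := hgp ⟨y, hy⟩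
      change g y ∈ W.space
      rw [this]
      exact Subtype.mem _
    · intro hx
      refine ⟨U.symm ⟨x, hx⟩, Subtype.mem _, ?_⟩
      change g _ = x
      rw [hgp, U.apply_symm_apply]

/-! ### Rotation of a subspace onto nearby graphs -/

variable (W : GrRes Hp)

/-- The operator `A - A*` on `H`, for `A : W → W^⊥`. -/
def skewLift (A : HS W.space W.spaceᗮ) : HS H H :=
  HS.compLeft _ _ _ W.spaceᗮ.subtypeL (HS.compRight _ _ _ A W.space.orthogonalProjectionOnto) -
  HS.compLeft _ _ _ W.space.subtypeL
    (HS.compRight _ _ _ (HS.adjointL _ _ A) W.spaceᗮ.orthogonalProjectionOnto)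

/-- The Cayley transform of `A - A*`, minus the identity. -/
def rotationHS (A : HS W.space W.spaceᗮ) : HS H H :=
  (2 : ℝ) • HS.compRight _ _ _ (W.skewLift A) (Ring.inverse (1 - HS.toCLM (W.skewLift A)))

/-- The Cayley transform of `A - A*`. -/
def rotation (A : HS W.space W.spaceᗮ) : H →L[ℂ] H := 1 + HS.toCLM (W.rotationHS A)

/-- The operator `A*A` on `W`. -/
def adjointSq (A : HS W.space W.spaceᗮ) : W.space →L[ℂ] W.space :=
  HS.toCLM (HS.adjointL _ _ A) ∘L HS.toCLM A

/-- The operator `A (1 - A*A)⁻¹`. -/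
def doubleAngle (A : HS W.space W.spaceᗮ) : HS W.space W.spaceᗮ :=
  HS.compRight _ _ _ A (Ring.inverse (1 - W.adjointSq A))

variable {W}

theorem skewLift_apply (A : HS W.space W.spaceᗮ) (x : H) : HS.toCLM (W.skewLift A) x =
    (HS.toCLM A (W.space.orthogonalProjectionOnto x) : H) -
      ContinuousLinearMap.adjoint (HS.toCLM A) (W.spaceᗮ.orthogonalProjectionOnto x) := rfl

theorem star_skewLift (A : HS W.space W.spaceᗮ) :
    star (HS.toCLM (W.skewLift A)) = -HS.toCLM (W.skewLift A) := by
  rw [skewLift, map_sub, star_sub, ContinuousLinearMap.star_eq_adjoint,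
    ContinuousLinearMap.star_eq_adjoint]
  simp only [HS.toCLM_compLeft, HS.toCLM_compRight, HS.toCLM_adjointL,
    ContinuousLinearMap.adjoint_comp, Submodule.adjoint_subtypeL,
    Submodule.adjoint_orthogonalProjectionOnto, ContinuousLinearMap.adjoint_adjoint]
  rw [neg_sub]
  rfl

/-- `rotation` is defined as `1 + 2x(1 - x)⁻¹` to keep its difference from the identity in `L²`;
this is what makes the commutator with `P₊` smooth for the Hilbert–Schmidt norm. -/
theorem rotation_eq {A : HS W.space W.spaceᗮ} (h : IsUnit (1 - HS.toCLM (W.skewLift A))) :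
    W.rotation A =
      (1 + HS.toCLM (W.skewLift A)) * Ring.inverse (1 - HS.toCLM (W.skewLift A)) := by
  set x := HS.toCLM (W.skewLift A) with hx
  have h1 : HS.toCLM (W.rotationHS A) = (2 : ℝ) • (x * Ring.inverse (1 - x)) := rfl
  have h2 := Ring.mul_inverse_cancel _ h
  have h3 : (1 + x) * Ring.inverse (1 - x) =
      (1 - x) * Ring.inverse (1 - x) + (x * Ring.inverse (1 - x) + x * Ring.inverse (1 - x)) := by
    noncomm_ring
  rw [rotation, h1, two_smul, h3, h2]

theorem rotation_mem_unitary {A : HS W.space W.spaceᗮ}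
    (h : IsUnit (1 - HS.toCLM (W.skewLift A))) : W.rotation A ∈ unitary (H →L[ℂ] H) := by
  rw [rotation_eq h]
  exact cayley_mem_unitary (star_skewLift A) h

/-- With `x = A - A*`, `(1 - x)(w + Aw) = (1 + A*A)w` and `(1 + x)(w + Aw) = (1 - A*A)w + 2Aw`. This
is the formula for `tan 2θ`, with `A` in the role of `tan θ`. -/
theorem rotation_apply {A : HS W.space W.spaceᗮ} (h : IsUnit (1 - HS.toCLM (W.skewLift A)))
    (h' : IsUnit (1 - W.adjointSq A)) (w : W.space) :
    W.rotation A ((1 + W.adjointSq A) w : W.space) =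
      W.graphMap (HS.toCLM ((2 : ℝ) • W.doubleAngle A)) ((1 - W.adjointSq A) w) := by
  set x := HS.toCLM (W.skewLift A) with hx
  have h1 : x (w : H) = HS.toCLM A w := by
    rw [hx, skewLift_apply, Submodule.orthogonalProjectionOnto_mem_subspace_eq_self,
      Submodule.orthogonalProjectionOnto_orthogonal_apply_eq_zero w.2, map_zero]
    simp
  have h2 : x (HS.toCLM A w : H) = -(W.adjointSq A w : H) := by
    rw [hx, skewLift_apply, Submodule.orthogonalProjectionOnto_mem_subspace_eq_self,
      Submodule.orthogonalProjectionOnto_apply_of_mem_orthogonal (HS.toCLM A w).2, map_zero]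
    simp [adjointSq]
  have h3 : (((1 + W.adjointSq A) w : W.space) : H) = (1 - x) ((w : H) + HS.toCLM A w) := by
    simp only [add_apply, sub_apply, one_apply_eq_self, map_add, h1, h2, Submodule.coe_add]
    abel
  have h4 : HS.toCLM (W.doubleAngle A) ((1 - W.adjointSq A) w) = HS.toCLM A w := by
    change HS.toCLM A ((Ring.inverse (1 - W.adjointSq A) * (1 - W.adjointSq A)) w) = _
    rw [Ring.inverse_mul_cancel _ h']
    rfl
  have h5 : HS.toCLM ((2 : ℝ) • W.doubleAngle A) ((1 - W.adjointSq A) w) =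
      (2 : ℝ) • HS.toCLM A w := by
    rw [← h4]
    rfl
  rw [rotation_eq h, h3]
  change (1 + x) ((Ring.inverse (1 - x) * (1 - x)) ((w : H) + HS.toCLM A w)) = _
  rw [Ring.inverse_mul_cancel _ h]
  change (1 + x) ((w : H) + HS.toCLM A w) = (((1 - W.adjointSq A) w : W.space) : H) +
    ((HS.toCLM ((2 : ℝ) • W.doubleAngle A) ((1 - W.adjointSq A) w) : W.spaceᗮ) : H)
  rw [h5]
  simp only [add_apply, sub_apply, one_apply_eq_self, map_add, h1, h2, two_smul,
    Submodule.coe_sub, Submodule.coe_add]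
  abel

theorem map_rotation {A : HS W.space W.spaceᗮ} (h : IsUnit (1 - HS.toCLM (W.skewLift A)))
    (h' : IsUnit (1 - W.adjointSq A)) (h'' : IsUnit (1 + W.adjointSq A)) :
    W.space.map (W.rotation A).toLinearMap =
      (W.graphMap (HS.toCLM ((2 : ℝ) • W.doubleAngle A))).range := by
  have surj : ∀ {T : W.space →L[ℂ] W.space}, IsUnit T → ∀ y, ∃ z, T z = y := fun {T} hT y =>
    ⟨Ring.inverse T y, congrArg (fun B => B y) (Ring.mul_inverse_cancel _ hT)⟩
  ext y
  constructor
  · rintro ⟨w, hw, rfl⟩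
    obtain ⟨z, hz⟩ := surj h'' ⟨w, hw⟩
    have := rotation_apply h h' z
    rw [hz] at this
    exact ⟨_, this.symm⟩
  · rintro ⟨w, rfl⟩
    obtain ⟨z, rfl⟩ := surj h' w
    exact ⟨_, Subtype.mem _, rotation_apply h h' z⟩

section Smooth

variable {n : WithTop ℕ∞}

theorem contDiff_skewLift : ContDiff ℝ n fun A => W.skewLift A :=
  contDiff_iff_contDiffAt.2 fun _ =>
    (HS.contDiffAt_compLeft contDiffAt_const
      (HS.contDiffAt_compRight contDiffAt_id contDiffAt_const)).sub
    (HS.contDiffAt_compLeft contDiffAt_const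
      (HS.contDiffAt_compRight (HS.contDiffAt_adjointL contDiffAt_id) contDiffAt_const))

theorem contDiff_adjointSq : ContDiff ℝ n fun A => W.adjointSq A :=
  contDiff_iff_contDiffAt.2 fun A =>
    contDiffAt_comp (HS.contDiff_toCLM.contDiffAt.comp A (HS.contDiffAt_adjointL contDiffAt_id))
      HS.contDiff_toCLM.contDiffAt

theorem contDiffAt_rotationHS {A : HS W.space W.spaceᗮ}
    (h : IsUnit (1 - HS.toCLM (W.skewLift A))) : ContDiffAt ℝ n (fun A => W.rotationHS A) A :=
  contDiffAt_const.smul (HS.contDiffAt_compRight contDiff_skewLift.contDiffAt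
    (contDiffAt_ringInverse_comp (contDiffAt_const.sub
      (HS.contDiff_toCLM.contDiffAt.comp A contDiff_skewLift.contDiffAt)) h))

theorem contDiffAt_doubleAngle {A : HS W.space W.spaceᗮ} (h : IsUnit (1 - W.adjointSq A)) :
    ContDiffAt ℝ n (fun A => W.doubleAngle A) A :=
  HS.contDiffAt_compRight contDiffAt_id
    (contDiffAt_ringInverse_comp (contDiffAt_const.sub contDiff_adjointSq.contDiffAt) h)

end Smooth

theorem adjointSq_zero : W.adjointSq 0 = 0 := by
  rw [adjointSq, map_zero, map_zero, map_zero]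
  rfl

theorem skewLift_zero : W.skewLift 0 = 0 := by
  simp [skewLift]

/-- In the product rule at `0`, the factor `A` vanishes and the factor `(1 - A*A)⁻¹` equals `1`, so
only one term survives. -/
theorem hasFDerivAt_doubleAngle :
    HasFDerivAt (fun A => W.doubleAngle A) (ContinuousLinearMap.id ℝ (HS W.space W.spaceᗮ)) 0 := by
  have hu : IsUnit (1 - W.adjointSq 0) := by
    rw [adjointSq_zero, sub_zero]
    exact isUnit_one
  have hg : ContDiffAt ℝ 1 (fun A => Ring.inverse (1 - W.adjointSq A)) 0 :=
    contDiffAt_ringInverse_comp (contDiffAt_const.sub contDiff_adjointSq.contDiffAt) hu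
  have h1 := (hg.differentiableAt (by simp)).hasFDerivAt
  refine (hasFDerivAt_bilinear (HS.compRight W.space W.space W.spaceᗮ)
    (hasFDerivAt_id (0 : HS W.space W.spaceᗮ)) h1).congr_fderiv ?_
  ext1 A
  have e : Ring.inverse (1 - W.adjointSq 0) = 1 := by
    rw [adjointSq_zero, sub_zero, Ring.inverse_one]
  apply HS.toCLM_injective
  simp [e]
  rfl

/-- A smooth local inverse of the map `A ↦ 2 A (1 - A*A)⁻¹`. -/
theorem exists_halfAngle (W : GrRes Hp) : ∃ (T : Set (HS W.space W.spaceᗮ))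
    (h : HS W.space W.spaceᗮ → HS W.space W.spaceᗮ), IsOpen T ∧ 0 ∈ T ∧ ∀ B ∈ T,
      ContDiffAt ℝ ∞ h B ∧ (2 : ℝ) • W.doubleAngle (h B) = B ∧
      IsUnit (1 - HS.toCLM (W.skewLift (h B))) ∧ IsUnit (1 - W.adjointSq (h B)) ∧
      IsUnit (1 + W.adjointSq (h B)) := by
  have hu : IsUnit (1 - W.adjointSq 0) := by
    rw [adjointSq_zero, sub_zero]
    exact isUnit_one
  have hu' : IsUnit (1 + W.adjointSq 0) := by
    rw [adjointSq_zero, add_zero]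
    exact isUnit_one
  have hu'' : IsUnit (1 - HS.toCLM (W.skewLift 0)) := by
    rw [skewLift_zero, map_zero, sub_zero]
    exact isUnit_one
  have hd0 : W.doubleAngle 0 = 0 := by simp [doubleAngle]
  -- Order `ω` rather than `∞`: analyticity at a point extends to a neighbourhood, whereas
  -- `ContDiffAt` of order `∞` at a point need not.
  have hc : ContDiffAt ℝ ω (fun A => W.doubleAngle A) 0 := contDiffAt_doubleAngle hu
  have hf : HasFDerivAt (fun A => W.doubleAngle A)
    ((ContinuousLinearEquiv.refl ℝ (HS W.space W.spaceᗮ) : _ ≃L[ℝ] _) : _ →L[ℝ] _) 0 :=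
    hasFDerivAt_doubleAngle
  have hs := hc.hasStrictFDerivAt' hf (by simp)
  let k := hs.localInverse (fun A => W.doubleAngle A) _ _
  have hk0 : k 0 = 0 := by
    have := hs.localInverse_apply_image
    rwa [hd0] at this
  have hk : ContDiffAt ℝ ω k 0 := by
    have := hc.to_localInverse hf (by simp)
    simp only [hd0] at this
    exact this
  have hr : ∀ᶠ B in 𝓝 0, W.doubleAngle (k B) = B := by
    have := hs.eventually_right_inverse
    simp only [hd0] at this
    exact this
  have hkc : ContinuousAt k 0 := hk.continuousAt
  have e1 : ∀ᶠ B in 𝓝 0, IsUnit (1 - HS.toCLM (W.skewLift (k B))) := by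
    have hcont : ContinuousAt (fun B => 1 - HS.toCLM (W.skewLift (k B))) 0 :=
      continuousAt_const.sub ((HS.contDiff_toCLM (n := 0)).continuous.continuousAt.comp
        ((contDiff_skewLift (n := 0)).continuous.continuousAt.comp hkc))
    exact eventually_isUnit hcont (by rwa [hk0])
  have e2 : ∀ᶠ B in 𝓝 0, IsUnit (1 - W.adjointSq (k B)) := by
    have hcont : ContinuousAt (fun B => 1 - W.adjointSq (k B)) 0 :=
      continuousAt_const.sub ((contDiff_adjointSq (n := 0)).continuous.continuousAt.comp hkc)
    exact eventually_isUnit hcont (by rwa [hk0])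
  have e3 : ∀ᶠ B in 𝓝 0, IsUnit (1 + W.adjointSq (k B)) := by
    have hcont : ContinuousAt (fun B => 1 + W.adjointSq (k B)) 0 :=
      continuousAt_const.add ((contDiff_adjointSq (n := 0)).continuous.continuousAt.comp hkc)
    exact eventually_isUnit hcont (by rwa [hk0])
  have hall := (hk.eventually (by simp)).and (hr.and (e1.and (e2.and e3)))
  obtain ⟨T, hT, hTo, hT0⟩ := mem_nhds_iff.1 hall
  -- `k` inverts `A ↦ A(1 - A*A)⁻¹`; halving its argument accounts for the factor `2`.
  have hsm : ContDiff ℝ ∞ fun B : HS W.space W.spaceᗮ => (2⁻¹ : ℝ) • B := contDiff_const_smul _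
  refine ⟨(fun B => (2⁻¹ : ℝ) • B) ⁻¹' T, fun B => k ((2⁻¹ : ℝ) • B),
    hTo.preimage hsm.continuous, ?_, fun B hB => ?_⟩
  · rwa [Set.mem_preimage, smul_zero]
  · obtain ⟨a1, a2, a3⟩ := hT hB
    refine ⟨(a1.of_le le_top).comp B hsm.contDiffAt, ?_, a3⟩
    rw [a2, smul_smul]
    norm_num

end GrRes

/-- There is a local cross section based at each point. -/
theorem exists_localSection [TopologicalSpace.SeparableSpace H]
    (hplus : ¬ FiniteDimensional ℂ Hp) (hminus : ¬ FiniteDimensional ℂ Hpᗮ) (W : GrRes Hp) :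
    ∃ b : LocalSection Hp, b.base = W := by
  obtain ⟨g, ⟨hgu, hgHS⟩, hgW⟩ := W.exists_mem_unitaryRes hplus hminus
  obtain ⟨T, h, hTo, hT0, hT⟩ := W.exists_halfAngle
  let D : Set (GrRes Hp) := W.chart.source ∩ W.chart.toFun ⁻¹' T
  let ρ : HS W.space W.spaceᗮ → HS H H := fun B => W.rotationHS (h B)
  -- `g` carries `H₊` to `W`, and the rotation carries `W` to `V`.
  let σ : GrRes Hp → (H →L[ℂ] H) := fun V => W.rotation (h (W.coord V)) * g
  -- The commutator of `(1 + ρ)g` with `P₊`, expanded so that every term is visibly in `L²`.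
  let κ : HS W.space W.spaceᗮ → HS H H := fun B =>
    HS.compRight _ _ _ (ρ B) (g * Hp.starProjection) -
      HS.compLeft _ _ _ Hp.starProjection (HS.compRight _ _ _ (ρ B) g) + HS.ofCLM (commPlus Hp g)
  have hρ : ∀ B ∈ T, ContDiffAt ℝ ∞ ρ B := fun B hB =>
    (GrRes.contDiffAt_rotationHS (hT B hB).2.2.1).comp B (hT B hB).1
  have hκ : ∀ B ∈ T, ContDiffAt ℝ ∞ κ B := fun B hB =>
    ((HS.contDiffAt_compRight (hρ B hB) contDiffAt_const).sub
      (HS.contDiffAt_compLeft contDiffAt_const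
        (HS.contDiffAt_compRight (hρ B hB) contDiffAt_const))).add contDiffAt_const
  have hσ : ∀ B ∈ T, ContDiffAt ℝ ∞ (fun B => (1 + HS.toCLM (ρ B)) * g) B := fun B hB =>
    (contDiffAt_const.add (HS.contDiff_toCLM.contDiffAt.comp B (hρ B hB))).mul contDiffAt_const
  have hκσ : ∀ V, commPlus Hp (σ V) = HS.toCLM (κ (W.coord V)) := fun V => by
    have e : HS.toCLM (κ (W.coord V)) = HS.toCLM (ρ (W.coord V)) * (g * Hp.starProjection) -
        Hp.starProjection * (HS.toCLM (ρ (W.coord V)) * g) + commPlus Hp g := by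
      rw [map_add, map_sub, HS.toCLM_ofCLM hgHS]
      rfl
    rw [e, commPlus, commPlus]
    change (1 + HS.toCLM (ρ (W.coord V))) * g * _ - _ * ((1 + HS.toCLM (ρ (W.coord V))) * g) = _
    noncomm_ring
  have hDo : IsOpen[atlasTopology (grAtlas Hp)] D :=
    TopologicalSpace.isOpen_generateFrom_of_mem ⟨W.chart, ⟨W, rfl⟩, T, hTo, rfl⟩
  have hcomp : ∀ {F : Type u} [NormedAddCommGroup F] [NormedSpace ℝ F]
      (φ : HS W.space W.spaceᗮ → F), (∀ B ∈ T, ContDiffAt ℝ ∞ φ B) → ∀ c ∈ grAtlas Hp,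
      ContDiffOn ℝ ∞ (c.pull fun V => φ (W.coord V)) (c.toFun '' (c.source ∩ D)) := by
    intro F _ _ φ hφ c hc
    have hinj := isSmoothAtlas_grAtlas.injOn c hc
    have h1 := isSmoothAtlas_grAtlas.smoothInto_inv c hc W.chart ⟨W, rfl⟩
    rw [BanachChart.image_inter hinj]
    rintro y ⟨hy, hyD⟩
    have h2 : ContDiffAt ℝ ∞ (fun y => W.coord (c.inv y)) y :=
      h1.2.contDiffAt (h1.1.mem_nhds ⟨hy, hyD.1⟩)
    refine ((hφ _ hyD.2).comp y h2).contDiffWithinAt.congr_of_mem (fun z hz => ?_) ⟨hy, hyD⟩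
    exact BanachChart.pull_eq hinj _ hz.1
  refine ⟨⟨W, D, ⟨W.self_mem_source, ?_⟩, hDo, Set.inter_subset_left, σ, fun V hV => ⟨?_, ?_⟩,
    fun V hV => ?_, ?_, ?_⟩, rfl⟩
  · change W.coord W ∈ T
    rwa [W.coord_self]
  · exact mul_mem (GrRes.rotation_mem_unitary (hT _ hV.2).2.2.1) hgu
  · rw [hκσ]
    exact HS.isHilbertSchmidt _
  · obtain ⟨-, a2, a3, a4, a5⟩ := hT (W.coord V) hV.2
    change Hp.map ((W.rotation (h (W.coord V))).toLinearMap ∘ₗ g.toLinearMap) = V.space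
    rw [Submodule.map_comp, hgW, GrRes.map_rotation a3 a4 a5, GrRes.space_eq_of_mem_source hV.1]
    congr 3
    exact congrArg HS.toCLM a2
  · exact hcomp _ hσ
  · have e : (fun V => HS.ofCLM (commPlus Hp (σ V))) = fun V => κ (W.coord V) := by
      ext V
      rw [hκσ, HS.ofCLM_toCLM]
    change ∀ c ∈ grAtlas Hp, ContDiffOn ℝ ∞ (c.pull fun V => HS.ofCLM (commPlus Hp (σ V))) _
    rw [e]
    exact hcomp _ hκ

end Sections
end
end RestrictedGroupoid

namespace RestrictedGroupoid

noncomputable section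

/-! ### The charts of the groupoid of partial isometries -/

section PartialIsometries

variable {H : Type u} [NormedAddCommGroup H] [InnerProductSpace ℂ H]
  {Hp : Submodule ℂ H} [CompleteSpace Hp]

/-- The extension by zero of an operator on `H₊`. -/
def extend (k : Hp →L[ℂ] Hp) : H →L[ℂ] H := Hp.subtypeL ∘L k ∘L Hp.orthogonalProjectionOnto

/-- The compression to `H₊` of an operator on `H`. -/
def compress (Hp : Submodule ℂ H) [CompleteSpace Hp] (T : H →L[ℂ] H) : Hp →L[ℂ] Hp :=
  Hp.orthogonalProjectionOnto ∘L T ∘L Hp.subtypeL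

theorem compress_extend (k : Hp →L[ℂ] Hp) : compress Hp (extend k) = k := by
  ext x
  simp [compress, extend]

theorem extend_compress (T : H →L[ℂ] H) :
    extend (compress Hp T) = Hp.starProjection * T * Hp.starProjection := rfl

theorem extend_mul (k l : Hp →L[ℂ] Hp) : extend (k * l) = extend k * extend l := by
  ext x
  simp [extend]

theorem extend_one : extend (1 : Hp →L[ℂ] Hp) = Hp.starProjection := rfl

theorem extend_injective : Function.Injective (extend (Hp := Hp)) :=
  Function.LeftInverse.injective compress_extend

variable [CompleteSpace H]

theorem star_extend (k : Hp →L[ℂ] Hp) : star (extend k) = extend (star k) := by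
  rw [extend, extend, ContinuousLinearMap.star_eq_adjoint, ContinuousLinearMap.star_eq_adjoint,
    ContinuousLinearMap.adjoint_comp, ContinuousLinearMap.adjoint_comp,
    Submodule.adjoint_subtypeL, Submodule.adjoint_orthogonalProjectionOnto]
  rfl

theorem star_compress (T : H →L[ℂ] H) : star (compress Hp T) = compress Hp (star T) := by
  rw [compress, compress, ContinuousLinearMap.star_eq_adjoint, ContinuousLinearMap.star_eq_adjoint,
    ContinuousLinearMap.adjoint_comp, ContinuousLinearMap.adjoint_comp,
    Submodule.adjoint_subtypeL, Submodule.adjoint_orthogonalProjectionOnto]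
  rfl

/-! ### Conjugation of projectors by local sections -/

namespace LocalSection

/-- `σ P₊ σ*` is an orthogonal projector with range `σ H₊`, and such a projector is determined by
its range. -/
theorem proj_eq (b : LocalSection Hp) {p : GrRes Hp} (hp : p ∈ b.domain) :
    b.toFun p * Hp.starProjection * star (b.toFun p) = p.proj := by
  obtain ⟨⟨h1, h2⟩, -⟩ := b.mem_unitaryRes p hp
  set s := b.toFun p with hs
  have hP : IsStarProjection Hp.starProjection := isStarProjection_starProjection
  have hq : IsStarProjection (s * Hp.starProjection * star s) := by
    constructor
    · change s * Hp.starProjection * star s * (s * Hp.starProjection * star s) = _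
      calc _ = s * Hp.starProjection * (star s * s) * Hp.starProjection * star s := by
            noncomm_ring
        _ = s * (Hp.starProjection * Hp.starProjection) * star s := by
            rw [h1]; noncomm_ring
        _ = _ := by rw [hP.isIdempotentElem]
    · change star (s * Hp.starProjection * star s) = _
      rw [star_mul, star_mul, star_star, hP.isSelfAdjoint.star_eq, mul_assoc]
  have hrange : (s * Hp.starProjection * star s).range = p.space := by
    rw [← b.map_eq p hp, ← hs]
    ext x
    constructor
    · rintro ⟨y, rfl⟩
      exact ⟨Hp.starProjection (star s y), Submodule.starProjection_apply_mem _ _, rfl⟩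
    · rintro ⟨y, hy, rfl⟩
      refine ⟨s y, ?_⟩
      change s (Hp.starProjection ((star s * s) y)) = s y
      rw [h1]
      exact congrArg s (Submodule.starProjection_eq_self_iff.2 hy)
  obtain ⟨_, e⟩ := isStarProjection_iff_eq_starProjection_range.1 hq
  rw [e, GrRes.proj_eq]
  congr 1

theorem star_mul_self (b : LocalSection Hp) {p : GrRes Hp} (hp : p ∈ b.domain) :
    star (b.toFun p) * b.toFun p = 1 := (b.mem_unitaryRes p hp).1.1

theorem mul_star_self (b : LocalSection Hp) {p : GrRes Hp} (hp : p ∈ b.domain) :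
    b.toFun p * star (b.toFun p) = 1 := (b.mem_unitaryRes p hp).1.2

theorem proj_mul (b : LocalSection Hp) {p : GrRes Hp} (hp : p ∈ b.domain) :
    p.proj * b.toFun p = b.toFun p * Hp.starProjection := by
  rw [← b.proj_eq hp, mul_assoc, b.star_mul_self hp, mul_one]

theorem star_mul_proj (b : LocalSection Hp) {p : GrRes Hp} (hp : p ∈ b.domain) :
    star (b.toFun p) * p.proj = Hp.starProjection * star (b.toFun p) := by
  rw [← b.proj_eq hp, ← mul_assoc, ← mul_assoc, b.star_mul_self hp, one_mul]

end LocalSection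

/-! ### Trivialisation of partial isometries -/

namespace URes

instance : Nonempty (URes Hp) := ⟨unit (Classical.arbitrary _)⟩

/-- By the C*-identity it suffices that `(up - u)*(up - u) = 0` for `p = u*u`, and this expands to a
polynomial in the idempotent `p`. -/
theorem op_mul_star_mul (u : URes Hp) : u.op * (star u.op * u.op) = u.op := by
  have hp : star u.op * u.op * (star u.op * u.op) = star u.op * u.op :=
    u.isStarProjection_source.isIdempotentElem
  rw [← sub_eq_zero, ← CStarRing.star_mul_self_eq_zero_iff]
  rw [star_sub, star_mul, star_mul, star_star]
  calc _ = star u.op * u.op * (star u.op * u.op) * (star u.op * u.op) -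
        star u.op * u.op * (star u.op * u.op) - star u.op * u.op * (star u.op * u.op) +
        star u.op * u.op := by noncomm_ring
    _ = 0 := by rw [hp, hp]; noncomm_ring

theorem op_mul_src (u : URes Hp) : u.op * u.src.proj = u.op := u.op_mul_star_mul

theorem tgt_mul_op (u : URes Hp) : u.tgt.proj * u.op = u.op := by
  change u.op * star u.op * u.op = u.op
  rw [mul_assoc, op_mul_star_mul]

theorem reduced_eq (b g : LocalSection Hp) (u : URes Hp) :
    reduced b g u = compress Hp (star (g.toFun u.tgt) * u.op * b.toFun u.src) := rfl

variable {b g : LocalSection Hp} {u : URes Hp}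

/-- Compression to `H₊` loses nothing: `σ_γ* u σ_β` already vanishes on `H₋` and has range in `H₊`.
-/
theorem extend_reduced (hb : u.src ∈ b.domain) (hg : u.tgt ∈ g.domain) :
    extend (reduced b g u) = star (g.toFun u.tgt) * u.op * b.toFun u.src := by
  rw [reduced_eq, extend_compress]
  calc _ = Hp.starProjection * star (g.toFun u.tgt) * u.op *
        (b.toFun u.src * Hp.starProjection) := by noncomm_ring
    _ = star (g.toFun u.tgt) * (u.tgt.proj * u.op * u.src.proj) * b.toFun u.src := by
        rw [← b.proj_mul hb, ← g.star_mul_proj hg]; noncomm_ring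
    _ = _ := by rw [tgt_mul_op, op_mul_src]

theorem op_eq (hb : u.src ∈ b.domain) (hg : u.tgt ∈ g.domain) :
    u.op = g.toFun u.tgt * extend (reduced b g u) * star (b.toFun u.src) := by
  rw [extend_reduced hb hg]
  calc u.op = (g.toFun u.tgt * star (g.toFun u.tgt)) * u.op *
        (b.toFun u.src * star (b.toFun u.src)) := by
        rw [g.mul_star_self hg, b.mul_star_self hb, one_mul, mul_one]
    _ = _ := by noncomm_ring

theorem reduced_mem_unitary (hb : u.src ∈ b.domain) (hg : u.tgt ∈ g.domain) :
    reduced b g u ∈ unitary (Hp →L[ℂ] Hp) := by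
  constructor
  · apply extend_injective
    rw [extend_mul, ← star_extend, extend_reduced hb hg, extend_one]
    simp only [star_mul, star_star]
    calc _ = star (b.toFun u.src) * star u.op * (g.toFun u.tgt * star (g.toFun u.tgt)) * u.op *
          b.toFun u.src := by noncomm_ring
      _ = star (b.toFun u.src) * (u.src.proj * b.toFun u.src) := by
          rw [g.mul_star_self hg]
          change _ = star (b.toFun u.src) * (star u.op * u.op * b.toFun u.src)
          noncomm_ring
      _ = _ := by rw [b.proj_mul hb, ← mul_assoc, b.star_mul_self hb, one_mul]
  · apply extend_injective
    rw [extend_mul, ← star_extend, extend_reduced hb hg, extend_one]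
    simp only [star_mul, star_star]
    calc _ = star (g.toFun u.tgt) * u.op * (b.toFun u.src * star (b.toFun u.src)) * star u.op *
          g.toFun u.tgt := by noncomm_ring
      _ = star (g.toFun u.tgt) * (u.tgt.proj * g.toFun u.tgt) := by
          rw [b.mul_star_self hb]
          change _ = star (g.toFun u.tgt) * (u.op * star u.op * g.toFun u.tgt)
          noncomm_ring
      _ = _ := by rw [g.proj_mul hg, ← mul_assoc, g.star_mul_self hg, one_mul]

/-- The witness is `σ_γ(p) k σ_β(q)*`. Hence target, source and unitary part vary independently, and
the chart images are full products. -/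
theorem exists_reduced_eq {p q : GrRes Hp} (hp : p ∈ g.domain) (hq : q ∈ b.domain)
    {k : Hp →L[ℂ] Hp} (hk : k ∈ unitary (Hp →L[ℂ] Hp)) :
    ∃ u : URes Hp, u.tgt = p ∧ u.src = q ∧ reduced b g u = k := by
  set T := g.toFun p * extend k * star (b.toFun q) with hT
  have h1 : star T * T = q.proj := by
    rw [hT, ← b.proj_eq hq]
    simp only [star_mul, star_star, star_extend]
    calc _ = b.toFun q * extend (star k) * (star (g.toFun p) * g.toFun p) * extend k *
          star (b.toFun q) := by noncomm_ring
      _ = b.toFun q * (extend (star k) * extend k) * star (b.toFun q) := by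
          rw [g.star_mul_self hp]; noncomm_ring
      _ = _ := by rw [← extend_mul, hk.1, extend_one]
  have h2 : T * star T = p.proj := by
    rw [hT, ← g.proj_eq hp]
    simp only [star_mul, star_star, star_extend]
    calc _ = g.toFun p * extend k * (star (b.toFun q) * b.toFun q) * extend (star k) *
          star (g.toFun p) := by noncomm_ring
      _ = g.toFun p * (extend k * extend (star k)) * star (g.toFun p) := by
          rw [b.star_mul_self hq]; noncomm_ring
      _ = _ := by rw [← extend_mul, hk.2, extend_one]
  let u : URes Hp := ⟨T, h1 ▸ q.isStarProjection, h2 ▸ p.isStarProjection, h1 ▸ q.range_mem,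
    h2 ▸ p.range_mem⟩
  have ht : u.tgt = p := GrRes.ext h2
  have hs : u.src = q := GrRes.ext h1
  refine ⟨u, ht, hs, extend_injective ?_⟩
  rw [extend_reduced (by rwa [hs]) (by rwa [ht]), ht, hs]
  change star (g.toFun p) * (g.toFun p * extend k * star (b.toFun q)) * b.toFun q = extend k
  calc _ = (star (g.toFun p) * g.toFun p) * extend k * (star (b.toFun q) * b.toFun q) := by
        noncomm_ring
    _ = _ := by rw [g.star_mul_self hp, b.star_mul_self hq, one_mul, mul_one]

theorem ext_reduced {v : URes Hp} (hb : u.src ∈ b.domain) (hg : u.tgt ∈ g.domain)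
    (hs : u.src = v.src) (ht : u.tgt = v.tgt) (h : reduced b g u = reduced b g v) : u = v := by
  apply URes.ext
  rw [op_eq hb hg, op_eq (u := v) (hs ▸ hb) (ht ▸ hg), hs, ht, h]

theorem src_inv (u : URes Hp) : u.inv.src = u.tgt := GrRes.ext (by simp [src, tgt, inv])

theorem tgt_inv (u : URes Hp) : u.inv.tgt = u.src := GrRes.ext (by simp [src, tgt, inv])

theorem reduced_inv (b g : LocalSection Hp) (u : URes Hp) :
    reduced g b u.inv = star (reduced b g u) := by
  rw [reduced_eq, reduced_eq, star_compress]
  rw [src_inv, tgt_inv, star_mul, star_mul, star_star, mul_assoc]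
  rfl

theorem inv_inv (u : URes Hp) : u.inv.inv = u := URes.ext (star_star _)

theorem src_mul (z : {z : URes Hp × URes Hp // src z.1 = tgt z.2}) : (mul z).src = z.1.2.src :=
  GrRes.ext (star_mul_mul z)

theorem tgt_mul (z : {z : URes Hp × URes Hp // src z.1 = tgt z.2}) : (mul z).tgt = z.1.1.tgt :=
  GrRes.ext (mul_mul_star z)

theorem src_unit (p : GrRes Hp) : (unit p).src = p :=
  GrRes.ext (by
    change star p.proj * p.proj = p.proj
    rw [p.isStarProjection.isSelfAdjoint.star_eq]
    exact p.isStarProjection.isIdempotentElem)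

theorem tgt_unit (p : GrRes Hp) : (unit p).tgt = p :=
  GrRes.ext (by
    change p.proj * star p.proj = p.proj
    rw [p.isStarProjection.isSelfAdjoint.star_eq]
    exact p.isStarProjection.isIdempotentElem)

/-- Since the same section `b` is used at the common intermediate subspace, `σ_β σ_β* = 1` can be
inserted between the factors. -/
theorem reduced_mul {b' : LocalSection Hp} (z : {z : URes Hp × URes Hp // src z.1 = tgt z.2})
    (hg : z.1.1.tgt ∈ g.domain) (hb : z.1.1.src ∈ b.domain) (hb' : z.1.2.src ∈ b'.domain) :
    reduced b' g (mul z) = reduced b g z.1.1 * reduced b' b z.1.2 := by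
  have hb2 : z.1.2.tgt ∈ b.domain := z.2 ▸ hb
  apply extend_injective
  rw [extend_mul, extend_reduced hb hg, extend_reduced hb' hb2,
    extend_reduced (by rwa [src_mul]) (by rwa [tgt_mul]), src_mul, tgt_mul, ← z.2]
  calc _ = star (g.toFun z.1.1.tgt) * z.1.1.op * z.1.2.op * b'.toFun z.1.2.src := by
        change star _ * (z.1.1.op * z.1.2.op) * _ = _
        noncomm_ring
    _ = star (g.toFun z.1.1.tgt) * z.1.1.op * (b.toFun z.1.1.src * star (b.toFun z.1.1.src)) *
        z.1.2.op * b'.toFun z.1.2.src := by rw [b.mul_star_self hb, mul_one]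
    _ = _ := by noncomm_ring

end URes

theorem UnitaryChart.source_subset {K : Type u} [NormedAddCommGroup K] [InnerProductSpace ℂ K]
    [CompleteSpace K] (a : UnitaryChart K) : a.source ⊆ unitary (K →L[ℂ] K) := by
  obtain ⟨O, -, h⟩ := a.isOpen_source
  rw [h]
  exact Set.inter_subset_right

theorem UnitaryChart.symm_toFun {K : Type u} [NormedAddCommGroup K] [InnerProductSpace ℂ K]
    [CompleteSpace K] (a : UnitaryChart K) {k : K →L[ℂ] K} (hk : k ∈ a.source) :
    a.symm (a.toFun k) = k :=
  a.injOn (Function.invFunOn_mem ⟨k, hk, rfl⟩) hk (Function.invFunOn_eq ⟨k, hk, rfl⟩)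

namespace URes

variable (a : UnitaryChart Hp) (b g : LocalSection Hp)

theorem image_coord : coord a b g '' chartSource a b g =
    (g.base.coord '' g.domain) ×ˢ (b.base.coord '' b.domain) ×ˢ (a.toFun '' a.source) := by
  ext y
  constructor
  · rintro ⟨u, ⟨hb, hg, ha⟩, rfl⟩
    exact ⟨⟨_, hg, rfl⟩, ⟨_, hb, rfl⟩, ⟨_, ha, rfl⟩⟩
  · obtain ⟨A, B, X⟩ := y
    rintro ⟨⟨p, hp, rfl⟩, ⟨q, hq, rfl⟩, ⟨k, hk, rfl⟩⟩
    obtain ⟨u, rfl, rfl, rfl⟩ := exists_reduced_eq hp hq (a.source_subset hk)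
    exact ⟨u, ⟨hq, hp, hk⟩, rfl⟩

theorem injOn_coord : Set.InjOn (coord a b g) (chartSource a b g) := by
  rintro u ⟨hb, hg, ha⟩ v ⟨hb', hg', ha'⟩ h
  have h1 := congrArg Prod.fst h
  have h2 := congrArg (fun y => y.2.1) h
  have h3 := congrArg (fun y => y.2.2) h
  exact ext_reduced hb hg (b.base.injOn_coord (b.domain_subset hb) (b.domain_subset hb') h2)
    (g.base.injOn_coord (g.domain_subset hg) (g.domain_subset hg') h1) (a.injOn ha ha' h3)

theorem inv_coord {c : UnitaryChart Hp} {u : URes Hp} (h : u ∈ chartSource a b g)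
    (hc : star (a.symm (coord a b g u).2.2) ∈ c.source) :
    u.inv ∈ chartSource c g b ∧ coord c g b u.inv =
      ((coord a b g u).2.1, (coord a b g u).1, c.toFun (star (a.symm (coord a b g u).2.2))) := by
  obtain ⟨hb, hg, ha⟩ := h
  have e : star (a.symm (coord a b g u).2.2) = reduced g b u.inv := by
    rw [reduced_inv]
    exact congrArg star (a.symm_toFun ha)
  rw [e] at hc ⊢
  refine ⟨⟨?_, ?_, hc⟩, ?_⟩
  · rwa [src_inv]
  · rwa [tgt_inv]
  · rw [coord, src_inv, tgt_inv]
    rfl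

theorem mul_coord {a' a'' : UnitaryChart Hp} {b' : LocalSection Hp} {u v : URes Hp}
    (hu : u ∈ chartSource a b g) (hv : v ∈ chartSource a' b' b)
    (h : (coord a b g u).2.1 = (coord a' b' b v).1)
    (ha'' : a.symm (coord a b g u).2.2 * a'.symm (coord a' b' b v).2.2 ∈ a''.source) :
    ∃ h : u.src = v.tgt, mul ⟨(u, v), h⟩ ∈ chartSource a'' b' g ∧
      coord a'' b' g (mul ⟨(u, v), h⟩) = ((coord a b g u).1, (coord a' b' b v).2.1,
        a''.toFun (a.symm (coord a b g u).2.2 * a'.symm (coord a' b' b v).2.2)) := by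
  obtain ⟨hb, hg, ha⟩ := hu
  obtain ⟨hb', hg', ha'⟩ := hv
  -- Equal middle coordinates force composability, because both come from the same injective chart
  -- of the Grassmannian.
  have hst : u.src = v.tgt :=
    b.base.injOn_coord (b.domain_subset hb) (b.domain_subset hg') h
  have e : a.symm (coord a b g u).2.2 * a'.symm (coord a' b' b v).2.2 =
      reduced b' g (mul ⟨(u, v), hst⟩) := by
    rw [reduced_mul ⟨(u, v), hst⟩ hg hb hb']
    exact congrArg₂ (· * ·) (a.symm_toFun ha) (a'.symm_toFun ha')
  rw [e] at ha'' ⊢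
  refine ⟨hst, ⟨?_, ?_, ha''⟩, ?_⟩
  · rwa [src_mul]
  · rwa [tgt_mul]
  · rw [coord, src_mul, tgt_mul]
    rfl

end URes

end PartialIsometries
end
end RestrictedGroupoid

namespace RestrictedGroupoid

noncomputable section

/-! ### The Banach Lie groupoid of partial isometries -/

section Groupoid

variable {H : Type u} [NormedAddCommGroup H] [InnerProductSpace ℂ H] [CompleteSpace H]
  {Hp : Submodule ℂ H} [CompleteSpace Hp]
  {Y : Type*} [NormedAddCommGroup Y] [NormedSpace ℝ Y]

namespace LocalSection

variable {D : Set Y} {v : Y → GrRes Hp}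

theorem isOpen_preimage (b : LocalSection Hp) (hv : SmoothInto (grAtlas Hp) D v) :
    IsOpen (D ∩ v ⁻¹' b.domain) :=
  hv.isOpen_preimage isSmoothAtlas_grAtlas b.isOpen_domain

theorem contDiffAt_comp (b : LocalSection Hp) (hv : SmoothInto (grAtlas Hp) D v) {y : Y}
    (hy : y ∈ D) (hb : v y ∈ b.domain) : ContDiffAt ℝ ∞ (fun y => b.toFun (v y)) y :=
  (hv.contDiffOn_comp isSmoothAtlas_grAtlas b.isOpen_domain b.contDiffOn).contDiffAt
    ((b.isOpen_preimage hv).mem_nhds ⟨hy, hb⟩)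

/-- Locally `P_W = σ(W) P₊ σ(W)*`, so no formula for the projector onto a graph is needed. -/
theorem contDiffAt_proj (b : LocalSection Hp) (hv : SmoothInto (grAtlas Hp) D v) {y : Y}
    (hy : y ∈ D) (hb : v y ∈ b.domain) : ContDiffAt ℝ ∞ (fun y => (v y).proj) y := by
  have h := b.contDiffAt_comp hv hy hb
  refine ((h.mul (contDiffAt_const (c := Hp.starProjection))).mul
    (contDiffAt_star h)).congr_of_eventuallyEq ?_
  filter_upwards [(b.isOpen_preimage hv).mem_nhds ⟨hy, hb⟩] with z hz
  exact (b.proj_eq hz.2).symm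

theorem isOpen_image (b : LocalSection Hp) : IsOpen (b.base.coord '' b.domain) := by
  have h := isSmoothAtlas_grAtlas.isOpen_iff.1 b.isOpen_domain b.base.chart ⟨b.base, rfl⟩
  rwa [Set.inter_eq_right.2 b.domain_subset] at h

end LocalSection

theorem GrRes.contDiffAt_coord (W : GrRes Hp) {D : Set Y} {v : Y → GrRes Hp}
    (hv : SmoothInto (grAtlas Hp) D v) {y : Y} (hy : y ∈ D) (hW : v y ∈ W.chart.source) :
    ContDiffAt ℝ ∞ (fun y => W.coord (v y)) y :=
  (hv W.chart ⟨W, rfl⟩).2.contDiffAt ((hv W.chart ⟨W, rfl⟩).1.mem_nhds ⟨hy, hW⟩)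

/-- The composition of a chart of the unitary group with a smooth family of unitary operators. -/
theorem UnitaryChart.contDiffAt_comp {K : Type u} [NormedAddCommGroup K] [InnerProductSpace ℂ K]
    [CompleteSpace K] (a : UnitaryChart K) {r : Y → K →L[ℂ] K} {y : Y} (hr : ContDiffAt ℝ ∞ r y)
    (hra : ∀ᶠ z in 𝓝 y, r z ∈ a.source) : ContDiffAt ℝ ∞ (fun y => a.toFun (r y)) y := by
  obtain ⟨F, hF, hFa⟩ := a.smooth (r y) hra.self_of_nhds
  refine (hF.comp y hr).congr_of_eventuallyEq ?_
  have ht : Filter.Tendsto r (𝓝 y) (𝓝[a.source] r y) :=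
    tendsto_nhdsWithin_iff.2 ⟨hr.continuousAt, hra⟩
  filter_upwards [ht.eventually hFa] with z hz
  exact hz.symm

namespace URes

/-- A smooth family of partial isometries: the family of operators and the families of initial and
final projectors are smooth. -/
structure SmoothFamily (D : Set Y) (v : Y → URes Hp) : Prop where
  isOpen : IsOpen D
  src : SmoothInto (grAtlas Hp) D fun y => (v y).src
  tgt : SmoothInto (grAtlas Hp) D fun y => (v y).tgt
  op : ∀ y ∈ D, ContDiffAt ℝ ∞ (fun y => (v y).op) y

/-- The criterion behind all smoothness statements for partial isometries: the unitary part `σ_γ* v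
σ_β` is a product of smooth operator families. -/
theorem SmoothFamily.smoothInto {D : Set Y} {v : Y → URes Hp} (hv : SmoothFamily D v)
    (A : Set (UnitaryChart Hp)) (S : Set (LocalSection Hp)) : SmoothInto (atlas A S) D v := by
  rintro _ ⟨a, -, b, -, g, -, rfl⟩
  set D' := (D ∩ (fun y => (v y).src) ⁻¹' b.domain) ∩ (D ∩ (fun y => (v y).tgt) ⁻¹' g.domain)
    with hD'
  have hD'o : IsOpen D' := (b.isOpen_preimage hv.src).inter (g.isOpen_preimage hv.tgt)
  have hr : ∀ y ∈ D', ContDiffAt ℝ ∞ (fun y => reduced b g (v y)) y := fun y hy =>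
    RestrictedGroupoid.contDiffAt_comp contDiffAt_const
      (RestrictedGroupoid.contDiffAt_comp
        (((contDiffAt_star (g.contDiffAt_comp hv.tgt hy.2.1 hy.2.2)).mul (hv.op y hy.1.1)).mul
          (b.contDiffAt_comp hv.src hy.1.1 hy.1.2)) contDiffAt_const)
  obtain ⟨O, hO, hOa⟩ := a.isOpen_source
  -- The unitary part is automatically unitary, so a condition relatively open in `U₊` becomes one
  -- open in all bounded operators.
  have e : D ∩ v ⁻¹' (chart a b g).source = D' ∩ (fun y => reduced b g (v y)) ⁻¹' O := by
    ext y
    constructor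
    · rintro ⟨hy, hb, hg, ha⟩
      rw [hOa] at ha
      exact ⟨⟨⟨hy, hb⟩, hy, hg⟩, ha.1⟩
    · rintro ⟨⟨⟨hy, hb⟩, -, hg⟩, ha⟩
      refine ⟨hy, hb, hg, ?_⟩
      rw [hOa]
      exact ⟨ha, reduced_mem_unitary hb hg⟩
  have ho : IsOpen (D ∩ v ⁻¹' (chart a b g).source) := by
    rw [e]
    exact ContinuousOn.isOpen_inter_preimage
      (fun y hy => (hr y hy).continuousAt.continuousWithinAt) hD'o hO
  refine ⟨ho, fun y hy => ContDiffAt.contDiffWithinAt ?_⟩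
  obtain ⟨hyD, hb, hg, ha⟩ := hy
  refine (g.base.contDiffAt_coord hv.tgt hyD (g.domain_subset hg)).prodMk
    ((b.base.contDiffAt_coord hv.src hyD (b.domain_subset hb)).prodMk
      (a.contDiffAt_comp (hr y ⟨⟨hyD, hb⟩, hyD, hg⟩) ?_))
  filter_upwards [ho.mem_nhds ⟨hyD, hb, hg, ha⟩] with z hz
  exact hz.2.2.2

variable (a : UnitaryChart Hp) (b g : LocalSection Hp)

theorem image_chart : (chart a b g).toFun '' (chart a b g).source =
    (g.base.coord '' g.domain) ×ˢ (b.base.coord '' b.domain) ×ˢ (a.toFun '' a.source) :=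
  image_coord a b g

theorem tgt_chart_inv {y : (chart a b g).E}
    (hy : y ∈ (chart a b g).toFun '' (chart a b g).source) :
    ((chart a b g).inv y).tgt = g.base.chart.inv y.1 := by
  obtain ⟨u, hu, rfl⟩ := hy
  rw [BanachChart.inv_toFun (injOn_coord a b g) hu]
  exact (BanachChart.inv_toFun g.base.injOn_coord (g.domain_subset hu.2.1)).symm

theorem src_chart_inv {y : (chart a b g).E}
    (hy : y ∈ (chart a b g).toFun '' (chart a b g).source) :
    ((chart a b g).inv y).src = b.base.chart.inv y.2.1 := by
  obtain ⟨u, hu, rfl⟩ := hy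
  rw [BanachChart.inv_toFun (injOn_coord a b g) hu]
  exact (BanachChart.inv_toFun b.base.injOn_coord (b.domain_subset hu.1)).symm

theorem reduced_chart_inv {y : (chart a b g).E}
    (hy : y ∈ (chart a b g).toFun '' (chart a b g).source) :
    reduced b g ((chart a b g).inv y) = a.symm y.2.2 := by
  obtain ⟨u, hu, rfl⟩ := hy
  rw [BanachChart.inv_toFun (injOn_coord a b g) hu]
  exact (a.symm_toFun hu.2.2).symm

theorem isOpen_image_chart : IsOpen ((chart a b g).toFun '' (chart a b g).source) := by
  rw [image_chart]
  exact g.isOpen_image.prod (b.isOpen_image.prod a.isOpen_image)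

/-- In coordinates the operator is `σ_γ k σ_β*` by `op_eq`, with each factor depending smoothly on
one coordinate. -/
theorem smoothFamily_chart_inv :
    SmoothFamily ((chart a b g).toFun '' (chart a b g).source) (chart a b g).inv := by
  set D := (chart a b g).toFun '' (chart a b g).source with hD
  have hDo : IsOpen D := isOpen_image_chart a b g
  have ht : SmoothInto (grAtlas Hp) D fun y => ((chart a b g).inv y).tgt :=
    (g.base.smoothInto_inv.comp hDo (f := fun y : (chart a b g).E => y.1) contDiff_fst.contDiffOn
      (Set.mapsTo_univ _ _)).congr fun y hy => tgt_chart_inv a b g hy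
  have hs : SmoothInto (grAtlas Hp) D fun y => ((chart a b g).inv y).src :=
    (b.base.smoothInto_inv.comp hDo (f := fun y : (chart a b g).E => y.2.1)
      (contDiff_fst.comp contDiff_snd).contDiffOn
      (Set.mapsTo_univ _ _)).congr fun y hy => src_chart_inv a b g hy
  have hmem : ∀ y ∈ D, (chart a b g).inv y ∈ chartSource a b g := fun y hy =>
    BanachChart.inv_mem hy
  refine ⟨hDo, hs, ht, fun y hy => ?_⟩
  have hk : ContDiffAt ℝ ∞ (fun y : (chart a b g).E => a.symm y.2.2) y := by
    have h1 : y.2.2 ∈ a.toFun '' a.source := by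
      rw [hD, image_chart] at hy
      exact hy.2.2
    exact (a.smooth_symm.contDiffAt (a.isOpen_image.mem_nhds h1)).comp y
      (contDiff_snd.comp contDiff_snd).contDiffAt
  have h1 := ((g.contDiffAt_comp ht hy (hmem y hy).2.1).mul
    (RestrictedGroupoid.contDiffAt_comp (contDiffAt_const (c := Hp.subtypeL))
      (RestrictedGroupoid.contDiffAt_comp hk
        (contDiffAt_const (c := Hp.orthogonalProjectionOnto))))).mul
    (contDiffAt_star (b.contDiffAt_comp hs hy (hmem y hy).1))
  refine h1.congr_of_eventuallyEq ?_
  filter_upwards [hDo.mem_nhds hy] with z hz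
  have h2 := op_eq (hmem z hz).1 (hmem z hz).2.1
  rw [reduced_chart_inv a b g hz] at h2
  exact h2

variable {A : Set (UnitaryChart Hp)} {S : Set (LocalSection Hp)}

theorem isSmoothAtlas_atlas (hA : ∀ k ∈ unitary (Hp →L[ℂ] Hp), ∃ a ∈ A, k ∈ a.source)
    (hS : ∀ p : GrRes Hp, ∃ b ∈ S, p ∈ b.domain) : IsSmoothAtlas (atlas A S) where
  injOn := by
    rintro _ ⟨a, -, b, -, g, -, rfl⟩
    exact injOn_coord a b g
  cover u := by
    obtain ⟨b, hb, hub⟩ := hS u.src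
    obtain ⟨g, hg, hug⟩ := hS u.tgt
    obtain ⟨a, ha, hua⟩ := hA _ (reduced_mem_unitary hub hug)
    exact ⟨_, ⟨a, ha, b, hb, g, hg, rfl⟩, hub, hug, hua⟩
  smoothInto_inv := by
    rintro _ ⟨a, -, b, -, g, -, rfl⟩
    exact (smoothFamily_chart_inv a b g).smoothInto A S

theorem isSmoothMap_src (h : IsSmoothAtlas (atlas A S)) :
    IsSmoothMap (atlas A S) (grAtlas Hp) src := by
  refine h.isSmoothMap ?_
  rintro _ ⟨a, -, b, -, g, -, rfl⟩
  exact (smoothFamily_chart_inv a b g).src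

theorem isSmoothMap_tgt (h : IsSmoothAtlas (atlas A S)) :
    IsSmoothMap (atlas A S) (grAtlas Hp) tgt := by
  refine h.isSmoothMap ?_
  rintro _ ⟨a, -, b, -, g, -, rfl⟩
  exact (smoothFamily_chart_inv a b g).tgt

theorem isSmoothMap_inv (h : IsSmoothAtlas (atlas A S)) :
    IsSmoothMap (atlas A S) (atlas A S) (inv (Hp := Hp)) := by
  refine h.isSmoothMap ?_
  rintro _ ⟨a, -, b, -, g, -, rfl⟩
  have hf := smoothFamily_chart_inv a b g
  refine SmoothFamily.smoothInto ⟨hf.isOpen, ?_, ?_, fun y hy => contDiffAt_star (hf.op y hy)⟩ A S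
  · exact hf.tgt.congr fun y _ => src_inv _
  · exact hf.src.congr fun y _ => tgt_inv _

theorem isSmoothMap_unit (hS : ∀ p : GrRes Hp, ∃ b ∈ S, p ∈ b.domain) :
    IsSmoothMap (grAtlas Hp) (atlas A S) (unit (Hp := Hp)) := by
  refine isSmoothAtlas_grAtlas.isSmoothMap fun c hc => ?_
  have hf := isSmoothAtlas_grAtlas.smoothInto_inv c hc
  refine SmoothFamily.smoothInto ⟨isSmoothAtlas_grAtlas.isOpen_image hc, ?_, ?_, fun y hy => ?_⟩
    A S
  · exact hf.congr fun y _ => src_unit _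
  · exact hf.congr fun y _ => tgt_unit _
  · obtain ⟨b, -, hb⟩ := hS (c.inv y)
    exact b.contDiffAt_proj hf hy hb

theorem isSubmersionMap_src (h : IsSmoothAtlas (atlas A S)) :
    IsSubmersionMap (atlas A S) (grAtlas Hp) src := by
  refine (isSmoothMap_src h).isSubmersionMap ?_
  rintro _ ⟨a, -, b, -, g, -, rfl⟩ d hd u hu hud
  have hinj := isSmoothAtlas_grAtlas.injOn d hd
  have hv := isSmoothAtlas_grAtlas.smoothInto_inv d hd
  have hz : d.toFun u.src ∈ d.toFun '' d.source := ⟨_, hud, rfl⟩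
  have hz' : d.inv (d.toFun u.src) = u.src := BanachChart.inv_toFun hinj hud
  have hub : d.inv (d.toFun u.src) ∈ b.domain := hz'.symm ▸ hu.1
  -- A local section of the source map: the source moves while the target and the unitary part stay
  -- those of `u`.
  refine ⟨fun z => (g.base.coord u.tgt, b.base.coord (d.inv z), a.toFun (reduced b g u)),
    ?_, ?_, ?_⟩
  · exact (differentiableAt_const _).prodMk
      (((b.base.contDiffAt_coord hv hz (b.domain_subset hub)).differentiableAt (by simp)).prodMk
        (differentiableAt_const _))
  · simp only [hz']
    rfl
  · filter_upwards [(b.isOpen_preimage hv).mem_nhds ⟨hz, hub⟩] with z hz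
    have hy : ((g.base.coord u.tgt, b.base.coord (d.inv z), a.toFun (reduced b g u)) :
        (chart a b g).E) ∈ (chart a b g).toFun '' (chart a b g).source := by
      rw [image_chart]
      exact ⟨⟨_, hu.2.1, rfl⟩, ⟨_, hz.2, rfl⟩, ⟨_, hu.2.2, rfl⟩⟩
    rw [BanachChart.pull_eq (injOn_coord a b g) _ hy, src_chart_inv a b g hy]
    have := BanachChart.inv_toFun b.base.injOn_coord (b.domain_subset hz.2)
    exact (congrArg d.toFun this).trans (BanachChart.toFun_inv hz.1)

theorem isSubmersionMap_tgt (h : IsSmoothAtlas (atlas A S)) :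
    IsSubmersionMap (atlas A S) (grAtlas Hp) tgt := by
  refine (isSmoothMap_tgt h).isSubmersionMap ?_
  rintro _ ⟨a, -, b, -, g, -, rfl⟩ d hd u hu hud
  have hinj := isSmoothAtlas_grAtlas.injOn d hd
  have hv := isSmoothAtlas_grAtlas.smoothInto_inv d hd
  have hz : d.toFun u.tgt ∈ d.toFun '' d.source := ⟨_, hud, rfl⟩
  have hz' : d.inv (d.toFun u.tgt) = u.tgt := BanachChart.inv_toFun hinj hud
  have hug : d.inv (d.toFun u.tgt) ∈ g.domain := hz'.symm ▸ hu.2.1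
  refine ⟨fun z => (g.base.coord (d.inv z), b.base.coord u.src, a.toFun (reduced b g u)),
    ?_, ?_, ?_⟩
  · exact ((g.base.contDiffAt_coord hv hz (g.domain_subset hug)).differentiableAt
      (by simp)).prodMk ((differentiableAt_const _).prodMk (differentiableAt_const _))
  · simp only [hz']
    rfl
  · filter_upwards [(g.isOpen_preimage hv).mem_nhds ⟨hz, hug⟩] with z hz
    have hy : ((g.base.coord (d.inv z), b.base.coord u.src, a.toFun (reduced b g u)) :
        (chart a b g).E) ∈ (chart a b g).toFun '' (chart a b g).source := by
      rw [image_chart]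
      exact ⟨⟨_, hz.2, rfl⟩, ⟨_, hu.1, rfl⟩, ⟨_, hu.2.2, rfl⟩⟩
    rw [BanachChart.pull_eq (injOn_coord a b g) _ hy, tgt_chart_inv a b g hy]
    have := BanachChart.inv_toFun g.base.injOn_coord (g.domain_subset hz.2)
    exact (congrArg d.toFun this).trans (BanachChart.toFun_inv hz.1)

open Classical in
-- The product has to be extended smoothly to pairs that are not composable. In charts, the second
-- factor is made composable by overwriting its target coordinate.
theorem isSmoothOnSubset_mul : IsSmoothOnSubset (atlas A S) (atlas A S) (atlas A S)
    (mul (Hp := Hp)) := by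
  rintro _ ⟨a, -, b, -, g, -, rfl⟩ _ ⟨a', -, b', -, g', -, rfl⟩ e he z hz1 hz2 hz
  set c := chart a b g with hc
  set d := chart a' b' g' with hd
  have hci : Set.InjOn c.toFun c.source := injOn_coord a b g
  have hdi : Set.InjOn d.toFun d.source := injOn_coord a' b' g'
  have hcf : SmoothFamily (c.toFun '' c.source) c.inv := smoothFamily_chart_inv a b g
  have hdf : SmoothFamily (d.toFun '' d.source) d.inv := smoothFamily_chart_inv a' b' g'
  let D₁ : Set c.E := c.toFun '' c.source ∩ (fun y => (c.inv y).src) ⁻¹' g'.domain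
  -- The target coordinate is unrestricted because `θ` discards it.
  let D₂ : Set d.E := Set.univ ×ˢ (b'.base.coord '' b'.domain) ×ˢ (a'.toFun '' a'.source)
  have hD₁ : IsOpen D₁ := g'.isOpen_preimage hcf.src
  have hD₂ : IsOpen D₂ := isOpen_univ.prod (b'.isOpen_image.prod a'.isOpen_image)
  let D : Set (c.E × d.E) := D₁ ×ˢ D₂
  have hD : IsOpen D := hD₁.prod hD₂
  -- The new target is the source of the first factor; on composable pairs `θ` returns the second
  -- coordinate unchanged.
  let θ : c.E × d.E → d.E := fun y => (g'.base.coord (c.inv y.1).src, y.2.2)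
  have hθ : ∀ y ∈ D, θ y ∈ d.toFun '' d.source := fun y hy =>
    (Set.ext_iff.1 (image_chart a' b' g') (θ y)).2 ⟨⟨_, hy.1.2, rfl⟩, hy.2.2⟩
  have hθc : ContDiffOn ℝ ∞ θ D := fun y hy => by
    have h1 := (g'.base.contDiffAt_coord hcf.src hy.1.1 (g'.domain_subset hy.1.2)).comp y
      contDiff_fst.contDiffAt
    have h2 : ContDiffAt ℝ ∞ (fun y : c.E × d.E => y.2.2) y :=
      (contDiff_snd.comp contDiff_snd).contDiffAt
    exact (h1.prodMk h2).contDiffWithinAt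
  have hcomp : ∀ y ∈ D, (c.inv y.1).src = (d.inv (θ y)).tgt := fun y hy => by
    have h1 : (d.inv (θ y)).tgt = g'.base.chart.inv (g'.base.coord (c.inv y.1).src) :=
      tgt_chart_inv a' b' g' (hθ y hy)
    rw [h1]
    exact (BanachChart.inv_toFun g'.base.injOn_coord (g'.domain_subset hy.1.2)).symm
  -- The `else` value never occurs on `D`, by `hcomp`.
  let v : c.E × d.E → URes Hp := fun y =>
    if h : (c.inv y.1).src = (d.inv (θ y)).tgt then mul ⟨(c.inv y.1, d.inv (θ y)), h⟩
    else c.inv y.1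
  have hv : ∀ y ∈ D, ∀ h, v y = mul ⟨(c.inv y.1, d.inv (θ y)), h⟩ := fun y hy h => dif_pos h
  have hvf : SmoothFamily D v := by
    refine ⟨hD, ?_, ?_, fun y hy => ?_⟩
    · exact (hdf.src.comp hD hθc hθ).congr fun y hy => by
        rw [hv y hy (hcomp y hy), src_mul]
        rfl
    · exact (hcf.tgt.comp hD contDiff_fst.contDiffOn fun y hy => hy.1.1).congr fun y hy => by
        rw [hv y hy (hcomp y hy), tgt_mul]
        rfl
    · have h1 := (hcf.op y.1 hy.1.1).comp y contDiff_fst.contDiffAt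
      have h2 := (hdf.op (θ y) (hθ y hy)).comp y (hθc.contDiffAt (hD.mem_nhds hy))
      refine (h1.mul h2).congr_of_eventuallyEq ?_
      filter_upwards [hD.mem_nhds hy] with w hw
      rw [hv w hw (hcomp w hw)]
      rfl
  have hval : ∀ w : {z : URes Hp × URes Hp // src z.1 = tgt z.2}, w.1.1 ∈ c.source →
      w.1.2 ∈ d.source → v (c.toFun w.1.1, d.toFun w.1.2) = mul w := by
    rintro ⟨⟨w₁, w₂⟩, hw⟩ h1 h2
    have e1 : c.inv (c.toFun w₁) = w₁ := BanachChart.inv_toFun hci h1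
    have e2 : θ (c.toFun w₁, d.toFun w₂) = d.toFun w₂ := by
      change (g'.base.coord (c.inv (c.toFun w₁)).src, (d.toFun w₂).2) = d.toFun w₂
      rw [e1, hw]
      rfl
    have e3 : d.inv (θ (c.toFun w₁, d.toFun w₂)) = w₂ := by
      rw [e2]
      exact BanachChart.inv_toFun hdi h2
    have hcomp : (c.inv (c.toFun w₁)).src = (d.inv (θ (c.toFun w₁, d.toFun w₂))).tgt := by
      rw [e1, e3]
      exact hw
    have h : v (c.toFun w₁, d.toFun w₂) = mul ⟨(c.inv (c.toFun w₁), d.inv (θ _)), hcomp⟩ :=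
      dif_pos hcomp
    rw [h]
    congr 3
  have hsm := hvf.smoothInto A S e he
  refine ⟨D ∩ v ⁻¹' e.source, fun y => e.toFun (v y), hsm.1, ⟨⟨⟨⟨_, hz1, rfl⟩, ?_⟩, ?_⟩, ?_⟩, hsm.2,
    fun w hw1 hw2 hw => ?_⟩
  · change (c.inv (c.toFun z.1.1)).src ∈ g'.domain
    rw [BanachChart.inv_toFun hci hz1, z.2]
    exact hz2.2.1
  · exact ⟨trivial, ⟨_, hz2.1, rfl⟩, ⟨_, hz2.2.2, rfl⟩⟩
  · rw [Set.mem_preimage, hval z hz1 hz2]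
    exact hz
  · have h := hw.2
    rw [Set.mem_preimage, hval w hw1 hw2] at h
    exact ⟨h, (congrArg e.toFun (hval w hw1 hw2)).symm⟩

theorem isBanachLieGroupoid (hA : ∀ k ∈ unitary (Hp →L[ℂ] Hp), ∃ a ∈ A, k ∈ a.source)
    (hS : ∀ p : GrRes Hp, ∃ b ∈ S, p ∈ b.domain) :
    IsBanachLieGroupoid (atlas A S) (grAtlas Hp) src tgt mul unit inv := by
  have h := isSmoothAtlas_atlas hA hS
  have hinv : Function.Involutive (inv (Hp := Hp)) := inv_inv
  exact
  { manifold_total := by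
      refine h.isBanachManifold (f := URes.op) (fun u v huv => URes.ext huv) ?_
      rintro _ ⟨a, -, b, -, g, -, rfl⟩ y hy
      exact ((smoothFamily_chart_inv a b g).op y hy).continuousAt.continuousWithinAt
    manifold_base := by
      refine isSmoothAtlas_grAtlas.isBanachManifold (f := GrRes.proj)
        (fun p q hpq => GrRes.ext hpq) fun c hc y hy => ?_
      obtain ⟨b, -, hb⟩ := hS (c.inv y)
      exact (b.contDiffAt_proj (isSmoothAtlas_grAtlas.smoothInto_inv c hc)
        hy hb).continuousAt.continuousWithinAt
    source_surjective := fun p => ⟨unit p, src_unit p⟩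
    source_submersion := isSubmersionMap_src h
    target_surjective := fun p => ⟨unit p, tgt_unit p⟩
    target_submersion := isSubmersionMap_tgt h
    mul_smooth := isSmoothOnSubset_mul
    mul_defined_iff := fun u v w => by
      constructor
      · rintro ⟨h1, h2⟩
        rw [src_mul] at h2
        exact ⟨h2, by rw [tgt_mul]; exact h1⟩
      · rintro ⟨h1, h2⟩
        rw [tgt_mul] at h2
        exact ⟨h2, by rw [src_mul]; exact h1⟩
    mul_assoc := fun u v w _ _ _ _ => URes.ext (mul_assoc u.op v.op w.op)
    unit_embedding := by
      let _ : TopologicalSpace (GrRes Hp) := atlasTopology (grAtlas Hp)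
      let _ : TopologicalSpace (URes Hp) := atlasTopology (atlas A S)
      -- The source map is a continuous left inverse of the continuous identity section.
      exact Topology.IsEmbedding.of_leftInverse (f := src) src_unit
        (h.continuous (isSmoothMap_src h))
        (isSmoothAtlas_grAtlas.continuous (isSmoothMap_unit hS))
    mul_unit := by
      rintro u _ rfl
      exact ⟨(tgt_unit _).symm, URes.ext u.op_mul_src⟩
    unit_mul := by
      rintro u _ rfl
      exact ⟨src_unit _, URes.ext u.tgt_mul_op⟩
    inv_diffeo := ⟨isSmoothMap_inv h, inv, isSmoothMap_inv h, hinv.leftInverse, hinv.rightInverse⟩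
    mul_inv := fun u => ⟨(tgt_inv u).symm, URes.ext rfl⟩
    inv_mul := fun u => ⟨src_inv u, URes.ext rfl⟩ }

end URes

end Groupoid
end
end RestrictedGroupoid

theorem theorem5p4 {H : Type u} [NormedAddCommGroup H] [InnerProductSpace ℂ H] [CompleteSpace H]
    [TopologicalSpace.SeparableSpace H] (Hp : Submodule ℂ H) [CompleteSpace Hp]
    (hplus : ¬ FiniteDimensional ℂ Hp) (hminus : ¬ FiniteDimensional ℂ Hpᗮ) :
    -- local cross sections and charts of `U₊` exist around every point
    (∀ p : GrRes Hp, ∃ b : LocalSection Hp, b.base = p) ∧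
    (∀ k ∈ unitary (Hp →L[ℂ] Hp), ∃ a : UnitaryChart Hp, k ∈ a.source) ∧
    ∀ (A : Set (UnitaryChart Hp)) (S : Set (LocalSection Hp)),
      (∀ k ∈ unitary (Hp →L[ℂ] Hp), ∃ a ∈ A, k ∈ a.source) →
      (∀ p : GrRes Hp, ∃ b ∈ S, p ∈ b.domain) →
      IsBanachLieGroupoid (URes.atlas A S) (grAtlas Hp)
        URes.src URes.tgt URes.mul URes.unit URes.inv ∧
      -- the image of a chart is a product, on which target and source are projections
      (∀ a ∈ A, ∀ b ∈ S, ∀ g ∈ S,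
        URes.coord a b g '' URes.chartSource a b g =
          (g.base.coord '' g.domain) ×ˢ (b.base.coord '' b.domain) ×ˢ (a.toFun '' a.source) ∧
        ∀ u ∈ URes.chartSource a b g, ∀ x y z, URes.coord a b g u = (x, y, z) →
          g.base.coord u.tgt = x ∧ b.base.coord u.src = y) ∧
      -- inversion in charts
      (∀ a ∈ A, ∀ a' ∈ A, ∀ b ∈ S, ∀ g ∈ S, ∀ u ∈ URes.chartSource a b g,
        ∀ x y z, URes.coord a b g u = (x, y, z) → star (a.symm z) ∈ a'.source →
          u.inv ∈ URes.chartSource a' g b ∧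
          URes.coord a' g b u.inv = (y, x, a'.toFun (star (a.symm z)))) ∧
      -- multiplication in charts
      (∀ a ∈ A, ∀ a' ∈ A, ∀ a'' ∈ A, ∀ b ∈ S, ∀ g ∈ S, ∀ b' ∈ S,
        ∀ u ∈ URes.chartSource a b g, ∀ v ∈ URes.chartSource a' b' b,
        ∀ x y w z z', URes.coord a b g u = (x, y, z) →
          URes.coord a' b' b v = (y, w, z') →
          a.symm z * a'.symm z' ∈ a''.source →
          ∃ h : u.src = v.tgt, URes.mul ⟨(u, v), h⟩ ∈ URes.chartSource a'' b' g ∧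
            URes.coord a'' b' g (URes.mul ⟨(u, v), h⟩) =
              (x, w, a''.toFun (a.symm z * a'.symm z'))) := by
  refine ⟨fun p => exists_localSection hplus hminus p, fun k hk => exists_unitaryChart hk,
    fun A S hA hS => ⟨URes.isBanachLieGroupoid hA hS, ?_, ?_, ?_⟩⟩
  · intro a _ b _ g _
    exact ⟨URes.image_coord a b g, fun u _ x y z h =>
      ⟨congrArg Prod.fst h, congrArg (fun q => q.2.1) h⟩⟩
  · intro a _ a' _ b _ g _ u hu x y z h hz
    have key := URes.inv_coord a b g hu (c := a') (by rw [h]; exact hz)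
    rwa [h] at key
  · intro a _ a' _ a'' _ b _ g _ b' _ u hu v hv x y w z z' h h' hz
    have key := URes.mul_coord a b g (a'' := a'') hu hv (by rw [h, h']) (by rw [h, h']; exact hz)
    rwa [h, h'] at key
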